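/- Let $p$ be an odd prime, let $\mu_p$ be the group of complex $p$-th roots of unity, and let $X$ be a topological space. For a commutative ring $R$ write $C^b(X,R)$ and $D^b(X,R)$ for the bounded cochain category and the bounded derived category of sheaves of $R$-modules on $X$. For a space $Y$ with an action of $\mu_p$ write $C^b_{\mu_p}(Y,R)$ and $D^b_{\mu_p}(Y,R)$ for the corresponding categories of $\mu_p$-equivariant sheaves. The group $\mu_p$ acts on $X^{\mu_p}$ by translation. **Steenrod's construction.** Fix a generator $\sigma$ of $\mu_p$, hence an isomorphism $\mu_p\cong\mathbb Z/p$. The functor $$St_C:C^b(X,R)\to C^b_{\mu_p}(X^{\mu_p},R),\qquad A\mapsto A^{\boxtimes p},$$ is the $p$-th external tensor power over $R$ (with its usual total differential), where $\mu_p$ permutes the factors cyclically with the Koszul signs. Let $$St_D:D^b(X,R)\to D^b_{\mu_p}(X^{\mu_p},R)$$ be the left derived functor of $St_C$, i.e. the right Kan extension of the composition $C^b(X,R)\xrightarrow{St_C}C^b_{\mu_p}(X^{\mu_p},R)\to D^b_{\mu_p}(X^{\mu_p},R)$ along $C^b(X,R)\to D^b(X,R)$; it comes with a natural map $\alpha$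 from $St_D(A)$ to (the image of) $St_C(A)$. **Localization.** Let $\hbar\in H^2(B\mu_p,\mathbb Z)$ be the first Chern class of the tautological line bundle. It acts on $D^b_{\mu_p}(Y,R)$ by a natural transformation $\hbar:\mathrm{Id}\to\Sigma^2$, namely by the class of the Yoneda extension $$0\to K\to K\otimes R[\mu_p]\xrightarrow{\sigma-1}K\otimes R[\mu_p]\to K\to0 .$$ Let $D^b_{\mu_p}(Y,R)[\hbar^{-1}]$ be the triangulated category obtained by inverting the morphisms $\hbar:K\to\Sigma^2K$, i.e. the Verdier quotient of $D^b_{\mu_p}(Y,R)$ by the thick subcategory generated by their cones, and let $St_D'$ be the composition $$St_D':D^b(X,R)\xrightarrow{St_D}D^b_{\mu_p}(X^{\mu_p},R)\to D^b_{\mu_p}(X^{\mu_p},R)[\hbar^{-1}].$$ **Proposition.** 1. Let $R$ be a commutative ring of finite weak dimension, i.e. there is $d$ with $\mathrm{Tor}^R_n(M,N)=0$ for all $n>d$ and all $R$-modules $M,N$ (for example a field, or $\mathbb Z$, or a Noetherian ring of finite global dimension). Then $St_D$ exists, and * $St_D'$ is exact: there are isomorphisms commuting $St_D'$ with shifts for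 which $St_D'$ is a triangulated functor; * $St_D'$ is Frobenius-linear: the category $D^b_{\mu_p}(X^{\mu_p},R)[\hbar^{-1}]$ is annihilated by $p$ (so that it is linear over $R/p$), and for parallel morphisms $f,g$ and for $r\in R$ one has $St_D'(f+g)=St_D'(f)+St_D'(g)$ and $St_D'(rf)=r^p\,St_D'(f)$; * $St_D'$ preserves finite direct sums. 2. Let $R=k$ be a perfect field of characteristic $p$. Then $St_D$ exists and $\alpha$ is an isomorphism, so $St_C$ itself descends to $St_D$. Let $F^*D^b(X,k)$ be the category $D^b(X,k)$ in which $c\in k$ acts on morphisms as $c^{1/p}$ does in $D^b(X,k)$. Then $St_D'$ is a triangulated $k$-linear functor $$St_D':F^*D^b(X,k)\to D^b_{\mu_p}(X^{\mu_p},k)[\hbar^{-1}].$$ -/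

import Mathlib

open CategoryTheory Limits TopologicalSpace Opposite
open scoped DirectSum TensorProduct

universe u

namespace SteenrodTate

section Koszul

variable {ι : Type} [Fintype ι] [LinearOrder ι]

/-- The Koszul sign of the rearrangement `⨂ l, a l ↦ ⨂ l, a (e l)` of a tensor product of
homogeneous elements `a l` of degrees `n l`: the product of `(-1) ^ (deg a * deg b)` over all pairs
of factors `a`, `b` whose order is reversed. -/
def koszulSign (e : Equiv.Perm ι) (n : ι → ℤ) : ℤˣ :=
  ∏ l, ∏ m, if l < m ∧ e m < e l then (n (e l) * n (e m)).negOnePow else 1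

/-- The sign `(-1) ^ (sum of the n l over l < j)` by which the differential of the `j`-th factor
enters the differential of a tensor product. -/
def leftSign (n : ι → ℤ) (j : ι) : ℤˣ :=
  ∏ l, if l < j then (n l).negOnePow else 1

lemma prod_pairs_perm (g : ι → ι → ℤˣ) (hg : ∀ l m, g l m = g m l) (e : Equiv.Perm ι) :
    (∏ l, ∏ m, if l < m then g (e l) (e m) else 1) = ∏ l, ∏ m, if l < m then g l m else 1 := by
  rw [← Fintype.prod_prod_type', ← Fintype.prod_prod_type', ← Finset.prod_filter,
    ← Finset.prod_filter]
  refine Finset.prod_bij' (fun z _ => if e z.1 < e z.2 then (e z.1, e z.2) else (e z.2, e z.1))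
    (fun z _ => if e.symm z.1 < e.symm z.2 then (e.symm z.1, e.symm z.2)
      else (e.symm z.2, e.symm z.1)) ?_ ?_ ?_ ?_ ?_
  · rintro ⟨a, b⟩ h
    simp only [Finset.mem_filter, Finset.mem_univ, true_and] at h ⊢
    split_ifs with h'
    · exact h'
    · exact lt_of_le_of_ne (not_lt.1 h') fun h2 => h.ne' (e.injective h2)
  · rintro ⟨a, b⟩ h
    simp only [Finset.mem_filter, Finset.mem_univ, true_and] at h ⊢
    split_ifs with h'
    · exact h'
    · exact lt_of_le_of_ne (not_lt.1 h') fun h2 => h.ne' (e.symm.injective h2)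
  · rintro ⟨a, b⟩ h
    simp only [Finset.mem_filter, Finset.mem_univ, true_and] at h ⊢
    by_cases h' : e a < e b <;> simp [h', h, h.le, not_lt]
  · rintro ⟨a, b⟩ h
    simp only [Finset.mem_filter, Finset.mem_univ, true_and] at h ⊢
    by_cases h' : e.symm a < e.symm b <;> simp [h', h, h.le, not_lt]
  · rintro ⟨a, b⟩ h
    by_cases h' : e a < e b <;> simp [h', hg]

lemma koszulSign_one (n : ι → ℤ) : koszulSign (1 : Equiv.Perm ι) n = 1 := by
  refine Finset.prod_eq_one fun l _ => Finset.prod_eq_one fun m _ => ?_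
  rw [if_neg]
  rintro ⟨h, h'⟩
  exact lt_asymm h h'

lemma koszulSign_mul (e e' : Equiv.Perm ι) (n : ι → ℤ) :
    koszulSign (e * e') n = koszulSign e' (n ∘ e) * koszulSign e n := by
  have key : koszulSign e n =
      ∏ l, ∏ m, if l < m then
        (if (e' l < e' m ∧ e (e' m) < e (e' l)) ∨ (e' m < e' l ∧ e (e' l) < e (e' m)) then
          (n (e (e' l)) * n (e (e' m))).negOnePow else 1) else 1 := by
    rw [prod_pairs_perm (fun l m => if (l < m ∧ e m < e l) ∨ (m < l ∧ e l < e m) then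
          (n (e l) * n (e m)).negOnePow else 1) (fun l m => by
            rw [mul_comm (n (e l))]; exact if_congr (or_comm) rfl rfl) e']
    refine Finset.prod_congr rfl fun l _ => Finset.prod_congr rfl fun m _ => ?_
    by_cases h : l < m
    · simp [h, h.asymm]
    · simp [h]
  rw [key]
  unfold koszulSign
  rw [← Finset.prod_mul_distrib]
  refine Finset.prod_congr rfl fun l _ => ?_
  rw [← Finset.prod_mul_distrib]
  refine Finset.prod_congr rfl fun m _ => ?_
  by_cases h : l < m
  · have h1 : e' l ≠ e' m := fun h2 => h.ne (e'.injective h2)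
    have h2 : e (e' l) ≠ e (e' m) := fun h2 => h1 (e.injective h2)
    rcases lt_or_gt_of_ne h1 with h1 | h1 <;> rcases lt_or_gt_of_ne h2 with h2 | h2 <;>
      simp [h, h1, h2, h1.asymm, h2.asymm, Int.units_mul_self]
  · simp [h]

lemma koszulSign_single (e : Equiv.Perm ι) (n : ι → ℤ) (j : ι) :
    leftSign n (e j) * koszulSign e (n + Pi.single (e j) 1) =
      koszulSign e n * leftSign (n ∘ e) j := by
  have h1 : koszulSign e (n + Pi.single (e j) 1) = koszulSign e n *
      ∏ m, if (m < j ∧ e j < e m) ∨ (j < m ∧ e m < e j) then (n (e m)).negOnePow else 1 := by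
    have : (∏ m, if (m < j ∧ e j < e m) ∨ (j < m ∧ e m < e j) then (n (e m)).negOnePow else 1) =
        ∏ l, ∏ m, (if l = j then (if j < m ∧ e m < e j then (n (e m)).negOnePow else 1) else 1) *
          (if m = j then (if l < j ∧ e j < e l then (n (e l)).negOnePow else 1) else 1) := by
      simp_rw [Finset.prod_mul_distrib]
      rw [Finset.prod_comm]
      simp only [Finset.prod_ite_eq', Finset.mem_univ, if_true]
      rw [← Finset.prod_mul_distrib]
      refine Finset.prod_congr rfl fun m _ => ?_
      rcases lt_trichotomy m j with h | h | h
      · simp [h, h.asymm]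
      · simp [h]
      · simp [h, h.asymm]
    rw [this]
    unfold koszulSign
    rw [← Finset.prod_mul_distrib]
    refine Finset.prod_congr rfl fun l _ => ?_
    rw [← Finset.prod_mul_distrib]
    refine Finset.prod_congr rfl fun m _ => ?_
    by_cases hl : l = j
    · subst hl
      by_cases hm : m = l
      · simp [hm]
      · by_cases h : l < m ∧ e m < e l
        · simp [h, hm, add_mul, Int.negOnePow_add]
        · simp [h, hm]
    · by_cases hm : m = j
      · subst hm
        by_cases h : l < m ∧ e m < e l
        · simp [h, hl, mul_add, Int.negOnePow_add]
        · simp [h, hl]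
      · simp [hl, hm]
  have h2 : leftSign n (e j) = ∏ m, if e m < e j then (n (e m)).negOnePow else 1 :=
    (Equiv.prod_comp e (fun m => if m < e j then (n m).negOnePow else 1)).symm
  rw [h1, h2, mul_left_comm]
  congr 1
  unfold leftSign
  rw [← Finset.prod_mul_distrib]
  refine Finset.prod_congr rfl fun m _ => ?_
  by_cases hm : m = j
  · simp [hm]
  · have h3 : e m ≠ e j := fun h => hm (e.injective h)
    rcases lt_or_gt_of_ne hm with h1 | h1 <;> rcases lt_or_gt_of_ne h3 with h2 | h2 <;>
      simp [h1, h2, h1.asymm, h2.asymm, Int.units_mul_self]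

lemma leftSign_single_of_lt (n : ι → ℤ) {j k : ι} (h : j < k) :
    leftSign (n + Pi.single j 1) k = - leftSign n k := by
  unfold leftSign
  rw [← Finset.mul_prod_erase _ _ (Finset.mem_univ j), ← Finset.mul_prod_erase _ _ (Finset.mem_univ j)]
  have : ∀ l ∈ Finset.univ.erase j, (if l < k then ((n + Pi.single j 1 : ι → ℤ) l).negOnePow else 1) =
      if l < k then (n l).negOnePow else 1 := by
    intro l hl
    simp [Finset.ne_of_mem_erase hl]
  rw [Finset.prod_congr rfl this]
  simp [h, Int.negOnePow_succ]

lemma leftSign_single_of_le (n : ι → ℤ) {j k : ι} (h : k ≤ j) :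
    leftSign (n + Pi.single j 1) k = leftSign n k := by
  unfold leftSign
  refine Finset.prod_congr rfl fun l _ => ?_
  by_cases hl : l < k
  · simp [hl, (hl.trans_le h).ne]
  · simp [hl]

end Koszul

section TensorComplex

set_option linter.unusedSectionVars false

variable {R : Type u} [CommRing R] {ι : Type} [Fintype ι] [LinearOrder ι]

/-- The graded endomorphism `id + d` of a complex, as a family of maps `K.X a ⟶ K.X b`:
it is the identity if `a = b`, and the differential otherwise (thus `0` if `b` is not `a + 1`). -/
noncomputable def step (K : CochainComplex (ModuleCat.{u} R) ℤ) (a b : ℤ) : K.X a ⟶ K.X b :=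
  if h : a = b then eqToHom (by rw [h]) else K.d a b

lemma step_self (K : CochainComplex (ModuleCat.{u} R) ℤ) (a : ℤ) : step K a a = 𝟙 _ := by
  simp [step]

lemma step_succ (K : CochainComplex (ModuleCat.{u} R) ℤ) (a : ℤ) :
    step K a (a + 1) = K.d a (a + 1) := by
  simp [step]

lemma step_naturality {K L : CochainComplex (ModuleCat.{u} R) ℤ} (f : K ⟶ L) (a b : ℤ) :
    step K a b ≫ f.f b = f.f a ≫ step L a b := by
  by_cases h : a = b
  · subst h; simp [step_self]
  · simp [step, h]

variable (K : ι → CochainComplex (ModuleCat.{u} R) ℤ)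

/-- The multi-indices `ι → ℤ` of total degree `n`. -/
abbrev MultiDegree (ι : Type) [Fintype ι] (n : ℤ) : Type := {i : ι → ℤ // ∑ l, i l = n}

/-- The degree `n` part of the tensor product of a finite ordered family of complexes `K l`:
the direct sum over all multi-degrees `i` of total degree `n` of the tensor products over `R` of the
modules `(K l).X (i l)`. -/
abbrev tensorX (n : ℤ) : Type u :=
  ⨁ i : MultiDegree ι n, ⨂[R] l, ((K l).X (i.1 l) : Type u)

/-- The inclusion of the summand of multi-degree `i`. -/
noncomputable def incl {n : ℤ} (i : ι → ℤ) (hi : ∑ l, i l = n) :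
    (⨂[R] l, ((K l).X (i l) : Type u)) →ₗ[R] tensorX K n :=
  DirectSum.lof R (MultiDegree ι n) (fun i => ⨂[R] l, ((K l).X (i.1 l) : Type u)) ⟨i, hi⟩

lemma sum_add_single {i : ι → ℤ} {m n : ℤ} (hi : ∑ l, i l = m) (h : m + 1 = n) (j : ι) :
    ∑ l, (i + Pi.single j 1 : ι → ℤ) l = n := by
  simp [Finset.sum_add_distrib, hi, h]

/-- The differential of the tensor product: on a pure tensor it is the sum over `j` of the tensors
obtained by applying the differential to the `j`-th factor, with the sign `(-1)` to the sum of the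
degrees of the preceding factors. -/
noncomputable def tensorD (m n : ℤ) : tensorX K m →ₗ[R] tensorX K n :=
  if h : m + 1 = n then
    DirectSum.toModule R _ _ fun i => ∑ j, ((leftSign i.1 j : ℤˣ) : ℤ) •
      (incl K (i.1 + Pi.single j 1) (sum_add_single i.2 h j) ∘ₗ
        PiTensorProduct.map fun l => (step (K l) (i.1 l) ((i.1 + Pi.single j 1 : ι → ℤ) l)).hom)
  else 0

variable {K}

lemma tensorX_hom_ext {n : ℤ} {M : Type*} [AddCommGroup M] [Module R M]
    {f g : tensorX K n →ₗ[R] M}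
    (h : ∀ (i : ι → ℤ) (hi : ∑ l, i l = n) (x : ∀ l, (K l).X (i l)),
      f (incl K i hi (PiTensorProduct.tprod R x)) = g (incl K i hi (PiTensorProduct.tprod R x))) :
    f = g := by
  refine DirectSum.linearMap_ext R fun i => PiTensorProduct.ext ?_
  ext x
  exact h i.1 i.2 x

lemma tensorD_incl {m n : ℤ} (h : m + 1 = n) (i : ι → ℤ) (hi : ∑ l, i l = m)
    (x : ∀ l, (K l).X (i l)) :
    tensorD K m n (incl K i hi (PiTensorProduct.tprod R x)) =
      ∑ j, ((leftSign i j : ℤˣ) : ℤ) • incl K (i + Pi.single j 1) (sum_add_single hi h j)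
        (PiTensorProduct.tprod R fun l =>
          step (K l) (i l) ((i + Pi.single j 1 : ι → ℤ) l) (x l)) := by
  rw [tensorD, dif_pos h, incl, DirectSum.toModule_lof, LinearMap.sum_apply]
  refine Finset.sum_congr rfl fun j _ => ?_
  rw [LinearMap.smul_apply, LinearMap.comp_apply, PiTensorProduct.map_tprod]

/-- The tensors `⊗ step (x l)` of two equal target multi-degrees agree. -/
lemma incl_congr {n : ℤ} {i m m' : ι → ℤ} (h : m = m') (hm : ∑ l, m l = n) (hm' : ∑ l, m' l = n)
    (x : ∀ l, (K l).X (i l)) :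
    incl K m hm (PiTensorProduct.tprod R fun l => step (K l) (i l) (m l) (x l)) =
      incl K m' hm' (PiTensorProduct.tprod R fun l => step (K l) (i l) (m' l) (x l)) := by
  subst h; rfl

lemma tensorD_comp_tensorD (a b c : ℤ) : tensorD K b c ∘ₗ tensorD K a b = 0 := by
  by_cases hab : a + 1 = b
  swap
  · rw [tensorD.eq_1 K a b, dif_neg hab, LinearMap.comp_zero]
  by_cases hbc : b + 1 = c
  swap
  · rw [tensorD, dif_neg hbc, LinearMap.zero_comp]
  refine tensorX_hom_ext fun i hi x => ?_
  rw [LinearMap.comp_apply, tensorD_incl hab, map_sum]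
  simp only [map_zsmul, tensorD_incl hbc, Finset.smul_sum, LinearMap.zero_apply]
  have key : ∀ j k, j ≠ k → ∀ l (y : (K l).X (i l)),
      step (K l) ((i + Pi.single j 1 : ι → ℤ) l) ((i + Pi.single j 1 + Pi.single k 1 : ι → ℤ) l)
        (step (K l) (i l) ((i + Pi.single j 1 : ι → ℤ) l) y) =
      step (K l) (i l) ((i + Pi.single j 1 + Pi.single k 1 : ι → ℤ) l) y := by
    intro j k hjk l y
    by_cases hl : l = j
    · have e : (i + Pi.single j 1 + Pi.single k 1 : ι → ℤ) l = (i + Pi.single j 1 : ι → ℤ) l := by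
        subst hl; simp [hjk]
      rw [e, step_self]; rfl
    · have e : (i + Pi.single j 1 : ι → ℤ) l = i l := by simp [hl]
      rw [e, step_self]; rfl
  have diag : ∀ j, (PiTensorProduct.tprod R fun l =>
      step (K l) ((i + Pi.single j 1 : ι → ℤ) l) ((i + Pi.single j 1 + Pi.single j 1 : ι → ℤ) l)
        (step (K l) (i l) ((i + Pi.single j 1 : ι → ℤ) l) (x l))) = 0 := by
    intro j
    refine MultilinearMap.map_coord_zero _ j ?_
    have e : (i + Pi.single j 1 : ι → ℤ) j = i j + 1 := by simp
    have e' : (i + Pi.single j 1 + Pi.single j 1 : ι → ℤ) j = i j + 1 + 1 := by simp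
    rw [e, e', step_succ, step_succ, ← ModuleCat.comp_apply, HomologicalComplex.d_comp_d]
    rfl
  rw [← Finset.sum_product', Finset.univ_product_univ]
  refine Finset.sum_ninvolution (fun z => (z.2, z.1)) ?_ ?_ (fun _ => Finset.mem_univ _)
    (fun _ => rfl)
  · rintro ⟨j, k⟩
    dsimp only
    rcases eq_or_ne j k with rfl | hjk
    · rw [diag, map_zero, smul_zero, smul_zero, add_zero]
    · simp only [key j k hjk, key k j hjk.symm]
      rw [incl_congr (add_right_comm i (Pi.single j 1) (Pi.single k 1)) _
        (sum_add_single (sum_add_single hi hab k) hbc j)]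
      rw [← mul_smul, ← mul_smul, ← add_smul]
      have : ((leftSign i j : ℤˣ) : ℤ) * ((leftSign (i + Pi.single j 1) k : ℤˣ) : ℤ) +
          ((leftSign i k : ℤˣ) : ℤ) * ((leftSign (i + Pi.single k 1) j : ℤˣ) : ℤ) = 0 := by
        rcases lt_or_gt_of_ne hjk with h | h
        · rw [leftSign_single_of_lt i h, leftSign_single_of_le i h.le]
          push_cast; ring
        · rw [leftSign_single_of_lt i h, leftSign_single_of_le i h.le]
          push_cast; ring
      rw [this, zero_smul]
  · rintro ⟨j, k⟩ hne heq
    have : k = j := congrArg Prod.fst heq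
    subst this
    apply hne
    dsimp only
    rw [diag, map_zero, smul_zero, smul_zero]

variable (K) in
/-- The tensor product of a finite ordered family of complexes of `R`-modules. -/
noncomputable def tensorComplex : CochainComplex (ModuleCat.{u} R) ℤ where
  X n := ModuleCat.of R (tensorX K n)
  d m n := ModuleCat.ofHom (tensorD K m n)
  shape m n h := by
    have h' : ¬ m + 1 = n := h
    rw [tensorD, dif_neg h']
    rfl
  d_comp_d' a b c _ _ := by
    rw [← ModuleCat.ofHom_comp, tensorD_comp_tensorD]
    rfl

variable {K' K'' : ι → CochainComplex (ModuleCat.{u} R) ℤ}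

lemma sum_comp_perm {i : ι → ℤ} {n : ℤ} (hi : ∑ l, i l = n) (e : Equiv.Perm ι) :
    ∑ l, (i ∘ e) l = n := by
  rw [← hi]; exact Equiv.sum_comp e i

/-- The map between tensor products of complexes induced by a permutation `e` of the factors and
chain maps `φ l : K (e l) ⟶ K' l`. In multi-degree `i` it is
`⊗ x l ↦ koszulSign e i • ⊗ φ l (x (e l))`. -/
noncomputable def tensorPermX (e : Equiv.Perm ι) (φ : ∀ l, K (e l) ⟶ K' l) (n : ℤ) :
    tensorX K n →ₗ[R] tensorX K' n :=
  DirectSum.toModule R _ _ fun i => ((koszulSign e i.1 : ℤˣ) : ℤ) •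
    (incl K' (i.1 ∘ e) (sum_comp_perm i.2 e) ∘ₗ
      (PiTensorProduct.map fun l => ((φ l).f (i.1 (e l))).hom) ∘ₗ
        (PiTensorProduct.reindex R (fun l => ((K l).X (i.1 l) : Type u)) e.symm).toLinearMap)

lemma tensorPermX_incl (e : Equiv.Perm ι) (φ : ∀ l, K (e l) ⟶ K' l) {n : ℤ}
    (i : ι → ℤ) (hi : ∑ l, i l = n) (x : ∀ l, (K l).X (i l)) :
    tensorPermX e φ n (incl K i hi (PiTensorProduct.tprod R x)) =
      ((koszulSign e i : ℤˣ) : ℤ) • incl K' (i ∘ e) (sum_comp_perm hi e)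
        (PiTensorProduct.tprod R fun l => (φ l).f (i (e l)) (x (e l))) := by
  have h : PiTensorProduct.reindex R (fun l => ((K l).X (i l) : Type u)) e.symm
      (PiTensorProduct.tprod R x) = PiTensorProduct.tprod R fun l => x (e l) :=
    PiTensorProduct.reindex_tprod e.symm x
  rw [tensorPermX, incl, DirectSum.toModule_lof, LinearMap.smul_apply, LinearMap.comp_apply,
    LinearMap.comp_apply, LinearEquiv.coe_coe, h]
  exact congrArg (fun z => ((koszulSign e i : ℤˣ) : ℤ) • incl K' (i ∘ e) (sum_comp_perm hi e) z)
    (PiTensorProduct.map_tprod _ _)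

lemma tensorPermX_comm (e : Equiv.Perm ι) (φ : ∀ l, K (e l) ⟶ K' l) (m n : ℤ) :
    tensorD K' m n ∘ₗ tensorPermX e φ m = tensorPermX e φ n ∘ₗ tensorD K m n := by
  by_cases h : m + 1 = n
  swap
  · rw [tensorD, tensorD, dif_neg h, dif_neg h, LinearMap.comp_zero, LinearMap.zero_comp]
  refine tensorX_hom_ext fun i hi x => ?_
  rw [LinearMap.comp_apply, LinearMap.comp_apply, tensorPermX_incl, map_zsmul, tensorD_incl h,
    tensorD_incl h, map_sum, Finset.smul_sum]
  rw [← Equiv.sum_comp e (fun j => tensorPermX e φ n (((leftSign i j : ℤˣ) : ℤ) •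
    incl K (i + Pi.single j 1) (sum_add_single hi h j) (PiTensorProduct.tprod R fun l =>
      step (K l) (i l) ((i + Pi.single j 1 : ι → ℤ) l) (x l))))]
  refine Finset.sum_congr rfl fun j _ => ?_
  rw [map_zsmul, tensorPermX_incl, smul_smul, smul_smul, ← Units.val_mul, ← Units.val_mul,
    koszulSign_single]
  congr 1
  have hE : (i ∘ e + Pi.single j 1 : ι → ℤ) = (i + Pi.single (e j) 1) ∘ e := by
    funext l
    by_cases hl : l = j
    · subst hl; simp
    · simp [hl]
  have nat : ∀ l, (φ l).f ((i + Pi.single (e j) 1 : ι → ℤ) (e l))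
      (step (K (e l)) (i (e l)) ((i + Pi.single (e j) 1 : ι → ℤ) (e l)) (x (e l))) =
      step (K' l) (i (e l)) (((i + Pi.single (e j) 1) ∘ e : ι → ℤ) l)
        ((φ l).f (i (e l)) (x (e l))) := by
    intro l
    rw [← ModuleCat.comp_apply, step_naturality, ModuleCat.comp_apply]
    rfl
  simp only [nat]
  exact incl_congr (K := K') (i := i ∘ e) hE _ _ fun l => (φ l).f (i (e l)) (x (e l))

lemma tensorPermX_one (φ : ∀ l, K ((1 : Equiv.Perm ι) l) ⟶ K l) (hφ : ∀ l, φ l = eqToHom rfl)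
    (n : ℤ) : tensorPermX (1 : Equiv.Perm ι) φ n = LinearMap.id := by
  refine tensorX_hom_ext fun i hi x => ?_
  have h : ∀ l, (φ l).f (i ((1 : Equiv.Perm ι) l)) (x ((1 : Equiv.Perm ι) l)) = x l := by
    intro l
    rw [hφ]
    rfl
  rw [tensorPermX_incl, koszulSign_one, Units.val_one, one_smul, LinearMap.id_apply]
  simp only [h]
  rfl

lemma tensorPermX_mul (e e' : Equiv.Perm ι) (φ : ∀ l, K (e l) ⟶ K' l)
    (φ' : ∀ l, K' (e' l) ⟶ K'' l) (φ'' : ∀ l, K ((e * e') l) ⟶ K'' l)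
    (hφ : ∀ l, φ'' l = eqToHom rfl ≫ φ (e' l) ≫ φ' l) (n : ℤ) :
    tensorPermX (e * e') φ'' n = tensorPermX e' φ' n ∘ₗ tensorPermX e φ n := by
  refine tensorX_hom_ext fun i hi x => ?_
  have h : ∀ l, (φ'' l).f (i ((e * e') l)) (x ((e * e') l)) =
      (φ' l).f (i (e (e' l))) ((φ (e' l)).f (i (e (e' l))) (x (e (e' l)))) := by
    intro l
    rw [hφ]
    rfl
  rw [LinearMap.comp_apply, tensorPermX_incl, tensorPermX_incl, map_zsmul, tensorPermX_incl,
    smul_smul, koszulSign_mul, mul_comm, Units.val_mul]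
  simp only [h]
  rfl

/-- The chain map given in each degree by `tensorPermX`. -/
noncomputable def tensorPerm (e : Equiv.Perm ι) (φ : ∀ l, K (e l) ⟶ K' l) :
    tensorComplex K ⟶ tensorComplex K' where
  f n := ModuleCat.ofHom (tensorPermX e φ n)
  comm' m n _ := by
    change ModuleCat.ofHom _ ≫ ModuleCat.ofHom _ = ModuleCat.ofHom _ ≫ ModuleCat.ofHom _
    rw [← ModuleCat.ofHom_comp, ← ModuleCat.ofHom_comp, tensorPermX_comm]

lemma tensorPerm_one (e : Equiv.Perm ι) (he : e = 1) (φ : ∀ l, K (e l) ⟶ K l)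
    (hφ : ∀ l, φ l = eqToHom (by rw [he]; rfl)) : tensorPerm e φ = 𝟙 _ := by
  subst he
  ext n : 1
  change ModuleCat.ofHom _ = _
  rw [tensorPermX_one φ hφ]
  rfl

lemma tensorPerm_mul (e e' e'' : Equiv.Perm ι) (he : e'' = e * e') (φ : ∀ l, K (e l) ⟶ K' l)
    (φ' : ∀ l, K' (e' l) ⟶ K'' l) (φ'' : ∀ l, K (e'' l) ⟶ K'' l)
    (hφ : ∀ l, φ'' l = eqToHom (by rw [he]; rfl) ≫ φ (e' l) ≫ φ' l) :
    tensorPerm e'' φ'' = tensorPerm e φ ≫ tensorPerm e' φ' := by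
  subst he
  ext n : 1
  change ModuleCat.ofHom _ = ModuleCat.ofHom _ ≫ ModuleCat.ofHom _
  rw [tensorPermX_mul e e' φ φ' φ'' hφ, ← ModuleCat.ofHom_comp]

end TensorComplex

section EquivariantSheaves

/-- The site of a space `Y` with an action of a discrete group `G`: its objects are the open subsets
of `Y`, and its morphisms `U ⟶ V` are the elements `g` of `G` that map `U` into `V`. A presheaf on it
is a presheaf `F` on `Y` with compatible isomorphisms `F (g U) ≅ F U`. -/
structure EqOpens (G : Type) (Y : Type u) [Group G] [TopologicalSpace Y] [MulAction G Y]
    [ContinuousConstSMul G Y] where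
  /-- The underlying open set. -/
  opens : Opens Y

namespace EqOpens

variable {G : Type} {Y : Type u} [Group G] [TopologicalSpace Y] [MulAction G Y]
  [ContinuousConstSMul G Y]

/-- Morphisms `U ⟶ V`: elements of the group that map `U` into `V`. -/
@[ext]
structure Hom (U V : EqOpens G Y) : Type u where
  /-- The group element. -/
  g : G
  /-- The group element maps `U` into `V`. -/
  mapsTo : ∀ y ∈ U.opens, g • y ∈ V.opens

instance : Category.{u} (EqOpens G Y) where
  Hom := Hom
  id U := ⟨1, fun y hy => by rwa [one_smul]⟩
  comp f f' := ⟨f'.g * f.g, fun y hy => by rw [mul_smul]; exact f'.mapsTo _ (f.mapsTo _ hy)⟩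
  id_comp f := Hom.ext (mul_one _)
  comp_id f := Hom.ext (one_mul _)
  assoc f f' f'' := Hom.ext (mul_assoc _ _ _).symm

@[simp] lemma id_g (U : EqOpens G Y) : Hom.g (𝟙 U) = 1 := rfl

@[simp] lemma comp_g {U V W : EqOpens G Y} (f : U ⟶ V) (f' : V ⟶ W) :
    Hom.g (f ≫ f') = f'.g * f.g := rfl

variable (G Y) in
/-- A sieve on `U` is covering if the translates `g V` of its members `g : V ⟶ U` cover `U`. -/
def topology : GrothendieckTopology (EqOpens G Y) where
  sieves U := {S | ∀ y ∈ U.opens, ∃ (V : EqOpens G Y) (f : V ⟶ U) (z : Y),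
    S f ∧ z ∈ V.opens ∧ f.g • z = y}
  top_mem' U y hy := ⟨U, 𝟙 U, y, trivial, hy, one_smul _ _⟩
  pullback_stable' := by
    intro U V S f hS y hy
    obtain ⟨W, h, z, hh, hz, e⟩ := hS _ (f.mapsTo y hy)
    refine ⟨⟨V.opens ⊓ ⟨(fun x => (h.g⁻¹ * f.g) • x) ⁻¹' W.opens,
      W.opens.isOpen.preimage (continuous_const_smul _)⟩⟩, ⟨1, fun x hx => ?_⟩, y, ?_, ?_, ?_⟩
    · rw [one_smul]; exact hx.1
    · let k : (⟨V.opens ⊓ ⟨(fun x => (h.g⁻¹ * f.g) • x) ⁻¹' W.opens,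
        W.opens.isOpen.preimage (continuous_const_smul _)⟩⟩ : EqOpens G Y) ⟶ W :=
        ⟨h.g⁻¹ * f.g, fun x hx => hx.2⟩
      have := S.downward_closed hh k
      rw [Sieve.pullback_apply]
      convert this using 1
      exact Hom.ext (by simp [k])
    · refine ⟨hy, ?_⟩
      change (h.g⁻¹ * f.g) • y ∈ W.opens
      rwa [mul_smul, ← e, inv_smul_smul]
    · exact one_smul _ _
  transitive' := by
    intro U S hS S' hS' y hy
    obtain ⟨V, f, z, hf, hz, e⟩ := hS y hy
    obtain ⟨W, h, x, hh, hx, e'⟩ := hS' hf z hz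
    exact ⟨W, h ≫ f, x, hh, hx, by rw [comp_g, mul_smul, e', e]⟩

end EqOpens

end EquivariantSheaves

section Categories

variable (R : Type u) [CommRing R]

/-- The category of sheaves of `R`-modules on a topological space. -/
abbrev Sh (X : TopCat.{u}) := Sheaf (Opens.grothendieckTopology X) (ModuleCat.{u} R)

/-- The category of `G`-equivariant sheaves of `R`-modules on `Y`, for a discrete group `G`. -/
abbrev EqSh (G : Type) (Y : Type u) [Group G] [TopologicalSpace Y] [MulAction G Y]
    [ContinuousConstSMul G Y] := Sheaf (EqOpens.topology G Y) (ModuleCat.{u} R)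

noncomputable instance (X : TopCat.{u}) : HasDerivedCategory (Sh R X) :=
  HasDerivedCategory.standard _

noncomputable instance (G : Type) (Y : Type u) [Group G] [TopologicalSpace Y] [MulAction G Y]
    [ContinuousConstSMul G Y] : HasDerivedCategory (EqSh R G Y) :=
  HasDerivedCategory.standard _

end Categories

section CyclicPower

variable (p : ℕ) [NeZero p]

/-- The group `μ_p`, written as the cyclic group `{0, ..., p - 1}` (that is, after the choice of a
primitive root of unity). -/
abbrev Mu : Type := Multiplicative (Fin p)

/-- The space `X ^ μ_p` of maps from `μ_p` to `X`, with the product topology. -/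
def MuPower (X : Type u) : Type u := Fin p → X

instance (X : Type u) [TopologicalSpace X] : TopologicalSpace (MuPower p X) :=
  inferInstanceAs (TopologicalSpace (Fin p → X))

variable {p}

/-- The group `μ_p` acts on `X ^ μ_p` by translation, the generator acting by
`(x 0, ..., x (p - 1)) ↦ (x 1, ..., x (p - 1), x 0)`. -/
instance (X : Type u) : MulAction (Mu p) (MuPower p X) where
  smul g x := fun l => x (l + g.toAdd)
  one_smul x := funext fun l => congrArg x (add_zero l)
  mul_smul g h x := funext fun l => congrArg x (by
    rw [toAdd_mul, add_assoc])

lemma smul_apply {X : Type u} (g : Mu p) (x : MuPower p X) (l : Fin p) :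
    (g • x) l = x (l + g.toAdd) := rfl

instance (X : Type u) [TopologicalSpace X] : ContinuousConstSMul (Mu p) (MuPower p X) where
  continuous_const_smul g := continuous_pi fun l => continuous_apply (l + g.toAdd)

/-- The open set `pr l (U)` of `X`, the image of an open set `U` of `X ^ μ_p` under the (open)
projection to the `l`-th factor. -/
def proj {X : TopCat.{u}} (U : EqOpens (Mu p) (MuPower p X)) (l : Fin p) : Opens X :=
  ⟨(fun x : MuPower p X => x l) '' U.opens, isOpenMap_eval (X := fun _ => X) l _ U.opens.isOpen⟩

/-- The permutation of the factors of a tensor power that corresponds to an element of `μ_p`. -/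
def rotation (g : Mu p) : Equiv.Perm (Fin p) := Equiv.addRight (-g.toAdd)

lemma proj_le {X : TopCat.{u}} {U V : EqOpens (Mu p) (MuPower p X)} (f : U ⟶ V) (l : Fin p) :
    proj U l ≤ proj V (rotation f.g l) := by
  rintro _ ⟨x, hx, rfl⟩
  refine ⟨f.g • x, f.mapsTo x hx, ?_⟩
  change x (l + -f.g.toAdd + f.g.toAdd) = x l
  rw [neg_add_cancel_right]

lemma rotation_one : rotation (1 : Mu p) = 1 := by
  ext l : 1
  change l + -0 = l
  rw [neg_zero, add_zero]

lemma rotation_mul (g h : Mu p) : rotation (g * h) = rotation g * rotation h := by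
  ext l : 1
  change l + -(g.toAdd + h.toAdd) = l + -h.toAdd + -g.toAdd
  rw [neg_add_rev, add_assoc]

end CyclicPower

section SteenrodComplex

variable {R : Type u} [CommRing R]

/-- The complex of sections over `U` of a complex of sheaves, as a functor of the complex and of
the open set. -/
noncomputable def sectionsComplex (X : TopCat.{u}) :
    (Opens X)ᵒᵖ ⥤ CochainComplex (Sh R X) ℤ ⥤ CochainComplex (ModuleCat.{u} R) ℤ where
  obj U := (sheafToPresheaf _ _ ⋙ (evaluation _ _).obj U).mapHomologicalComplex _
  map f := NatTrans.mapHomologicalComplex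
    (Functor.whiskerLeft (sheafToPresheaf _ _) ((evaluation _ _).map f)) _

lemma sectionsComplex_map_eq {X : TopCat.{u}} (A : CochainComplex (Sh R X) ℤ) {U V : (Opens X)ᵒᵖ}
    (h : U = V) (f : U ⟶ V) :
    ((sectionsComplex X).map f).app A = eqToHom (by rw [h]) := by
  subst h
  rw [show f = 𝟙 U from Subsingleton.elim _ _, CategoryTheory.Functor.map_id, NatTrans.id_app,
    eqToHom_refl]

/-- A functor with values in complexes, seen as a complex of functors. -/
@[simps]
def complexOfFunctor (D : Type*) [Category* D] (C : Type*) [Category* C] [Preadditive C] :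
    (D ⥤ CochainComplex C ℤ) ⥤ CochainComplex (D ⥤ C) ℤ where
  obj T :=
    { X n := T ⋙ HomologicalComplex.eval _ _ n
      d m n :=
        { app U := (T.obj U).d m n
          naturality _ _ f := (T.map f).comm m n }
      shape m n h := by
        ext U
        exact (T.obj U).shape m n h
      d_comp_d' i j k _ _ := by
        ext U
        exact (T.obj U).d_comp_d i j k }
  map τ :=
    { f n := Functor.whiskerRight τ _
      comm' i j _ := by
        ext U
        exact (τ.app U).comm i j }

variable {p : ℕ} [NeZero p] {X : TopCat.{u}}

/-- The presheaf of complexes `U ↦ ⨂ l, A (pr l (U))` on `X ^ μ_p`, the tensor product (over `R`,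
with the usual Koszul signs) of the presheaf inverse images of the complex of sheaves `A` under the
projections, with its `μ_p`-equivariant structure, which rotates the factors with Koszul signs. -/
noncomputable def tensorPresheaf (p : ℕ) [NeZero p] (A : CochainComplex (Sh R X) ℤ) :
    (EqOpens (Mu p) (MuPower p X))ᵒᵖ ⥤ CochainComplex (ModuleCat.{u} R) ℤ where
  obj U := tensorComplex fun l => ((sectionsComplex X).obj (op (proj U.unop l))).obj A
  map {U V} f := tensorPerm (rotation f.unop.g) fun l =>
    ((sectionsComplex X).map (homOfLE (proj_le f.unop l)).op).app A
  map_id U := by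
    refine tensorPerm_one _ rotation_one _ fun l => sectionsComplex_map_eq A ?_ _
    rw [unop_id, EqOpens.id_g, rotation_one]
    rfl
  map_comp {U V W} f f' := by
    refine tensorPerm_mul _ _ _ (rotation_mul f.unop.g f'.unop.g) _ _ _ fun l => ?_
    have h : op (proj U.unop (rotation (f ≫ f').unop.g l)) =
        op (proj U.unop (rotation f.unop.g (rotation f'.unop.g l))) :=
      congrArg (fun e : Equiv.Perm (Fin p) => op (proj U.unop (e l)))
        (rotation_mul f.unop.g f'.unop.g)
    rw [← sectionsComplex_map_eq A h (eqToHom h), ← NatTrans.comp_app, ← NatTrans.comp_app,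
      ← Functor.map_comp, ← Functor.map_comp]
    congr 2

lemma tensorPerm_comp_of_one {R : Type u} [CommRing R] {ι : Type} [Fintype ι] [LinearOrder ι]
    {K K' L L' : ι → CochainComplex (ModuleCat.{u} R) ℤ} (e : Equiv.Perm ι)
    (φ : ∀ l, K (e l) ⟶ L l) (φ' : ∀ l, K' (e l) ⟶ L' l) (ψ : ∀ l, K l ⟶ K' l)
    (ψ' : ∀ l, L l ⟶ L' l) (h : ∀ l, φ l ≫ ψ' l = ψ (e l) ≫ φ' l) :
    tensorPerm e φ ≫ tensorPerm (1 : Equiv.Perm ι) (K := L) (K' := L') ψ' =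
      tensorPerm (1 : Equiv.Perm ι) (K := K) (K' := K') ψ ≫ tensorPerm e φ' := by
  rw [← tensorPerm_mul e 1 e (mul_one e).symm φ ψ' (fun l => φ l ≫ ψ' l) fun l =>
      (Category.id_comp (φ l ≫ ψ' l)).symm,
    ← tensorPerm_mul 1 e e (one_mul e).symm ψ φ' (fun l => φ l ≫ ψ' l) fun l =>
      (h l).trans (Category.id_comp (ψ (e l) ≫ φ' l)).symm]

/-- The presheaf of complexes `U ↦ ⨂ l, A (pr l (U))`, as a functor of `A`. -/
noncomputable def tensorPresheafFunctor (R : Type u) [CommRing R] (X : TopCat.{u}) (p : ℕ)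
    [NeZero p] : CochainComplex (Sh R X) ℤ ⥤
      ((EqOpens (Mu p) (MuPower p X))ᵒᵖ ⥤ CochainComplex (ModuleCat.{u} R) ℤ) where
  obj A := tensorPresheaf p A
  map {A B} f :=
    { app U := tensorPerm (1 : Equiv.Perm (Fin p))
        (K := fun l => ((sectionsComplex X).obj (op (proj U.unop l))).obj A)
        (K' := fun l => ((sectionsComplex X).obj (op (proj U.unop l))).obj B)
        fun l => ((sectionsComplex X).obj (op (proj U.unop l))).map f
      naturality {U V} g := tensorPerm_comp_of_one _ _ _ _ _ fun l =>
        (NatTrans.naturality _ _).symm }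
  map_id A := by
    ext U : 2
    refine tensorPerm_one _ rfl _ fun l => ?_
    rw [CategoryTheory.Functor.map_id]
    rfl
  map_comp {A B C} f g := by
    ext U : 2
    refine tensorPerm_mul _ _ _ (mul_one 1).symm _ _ _ fun l => ?_
    rw [CategoryTheory.Functor.map_comp]
    exact (Category.id_comp (((sectionsComplex X).obj (op (proj U.unop l))).map f ≫
      ((sectionsComplex X).obj (op (proj U.unop l))).map g)).symm

/-- Steenrod's construction on complexes: the external tensor power `A ⊠ ... ⊠ A` (`p` factors) of
a complex of sheaves on `X`, as a complex of `μ_p`-equivariant sheaves on `X ^ μ_p`. It is the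
complex of sheaves associated to the complex of presheaves `U ↦ ⨂ l, A (pr l (U))`. -/
noncomputable def steenrodC (R : Type u) [CommRing R] (X : TopCat.{u}) (p : ℕ) [NeZero p] :
    CochainComplex (Sh R X) ℤ ⥤ CochainComplex (EqSh R (Mu p) (MuPower p X)) ℤ :=
  tensorPresheafFunctor R X p ⋙ complexOfFunctor _ _ ⋙
    (presheafToSheaf (EqOpens.topology (Mu p) (MuPower p X)) _).mapHomologicalComplex _

end SteenrodComplex

section Bounded

variable (C : Type*) [Category* C]

/-- The property of being a bounded cochain complex. -/
def boundedComplex [HasZeroMorphisms C] : ObjectProperty (CochainComplex C ℤ) :=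
  fun K => ∃ a b : ℤ, K.IsStrictlyGE a ∧ K.IsStrictlyLE b

/-- The functor from bounded complexes to the bounded derived category. -/
noncomputable def boundedQ [Abelian C] [HasDerivedCategory C] :
    (boundedComplex C).FullSubcategory ⥤ DerivedCategory.Bounded C :=
  ObjectProperty.lift _ ((boundedComplex C).ι ⋙ DerivedCategory.Q) (by
    rintro ⟨K, a, b, h, h'⟩
    exact ⟨⟨a, inferInstanceAs ((DerivedCategory.Q.obj K).IsGE a)⟩,
      ⟨b, inferInstanceAs ((DerivedCategory.Q.obj K).IsLE b)⟩⟩)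

end Bounded

section SteenrodBounded

variable {R : Type u} [CommRing R] {X : TopCat.{u}} {p : ℕ} [NeZero p]

lemma isZero_steenrodC_X (A : CochainComplex (Sh R X) ℤ) (n : ℤ)
    (h : ∀ i : Fin p → ℤ, ∑ l, i l = n → ∃ l, IsZero (A.X (i l))) :
    IsZero (((steenrodC R X p).obj A).X n) := by
  refine Functor.map_isZero (presheafToSheaf (EqOpens.topology (Mu p) (MuPower p X)) _) ?_
  refine Functor.isZero _ fun U => ?_
  change IsZero (ModuleCat.of R (tensorX
    (fun l => ((sectionsComplex X).obj (op (proj U.unop l))).obj A) n))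
  rw [ModuleCat.isZero_iff_subsingleton]
  have : (LinearMap.id : tensorX
    (fun l => ((sectionsComplex X).obj (op (proj U.unop l))).obj A) n →ₗ[R] _) = 0 := by
    refine tensorX_hom_ext fun i hi x => ?_
    obtain ⟨l, hl⟩ := h i hi
    have h0 : IsZero ((((sectionsComplex X).obj (op (proj U.unop l))).obj A).X (i l)) :=
      Functor.map_isZero (sheafToPresheaf _ _ ⋙ (evaluation _ _).obj (op (proj U.unop l))) hl
    have : Subsingleton ((((sectionsComplex X).obj (op (proj U.unop l))).obj A).X (i l)) :=
      ModuleCat.isZero_iff_subsingleton.1 h0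
    have hx : PiTensorProduct.tprod R x = 0 :=
      MultilinearMap.map_coord_zero _ l (Subsingleton.elim _ _)
    rw [hx, map_zero, map_zero, map_zero]
  exact ⟨fun a b => (LinearMap.congr_fun this a).trans (LinearMap.congr_fun this b).symm⟩

variable (R X p)

/-- Steenrod's construction on bounded complexes. -/
noncomputable def steenrodCb : (boundedComplex (Sh R X)).FullSubcategory ⥤
    (boundedComplex (EqSh R (Mu p) (MuPower p X))).FullSubcategory :=
  ObjectProperty.lift _ ((boundedComplex (Sh R X)).ι ⋙ steenrodC R X p) (by
    rintro ⟨A, a, b, ha, hb⟩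
    rw [CochainComplex.isStrictlyGE_iff] at ha
    rw [CochainComplex.isStrictlyLE_iff] at hb
    refine ⟨p * a, p * b, ?_, ?_⟩
    · rw [CochainComplex.isStrictlyGE_iff]
      intro n hn
      refine isZero_steenrodC_X A n fun i hi => ?_
      by_contra! hc
      have : ∀ l, a ≤ i l := fun l => not_lt.1 fun hl => hc l (ha _ hl)
      have := Finset.card_nsmul_le_sum Finset.univ i a fun l _ => this l
      simp at this
      lia
    · rw [CochainComplex.isStrictlyLE_iff]
      intro n hn
      refine isZero_steenrodC_X A n fun i hi => ?_
      by_contra! hc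
      have : ∀ l, i l ≤ b := fun l => not_lt.1 fun hl => hc l (hb _ hl)
      have := Finset.sum_le_card_nsmul Finset.univ i b fun l _ => this l
      simp at this
      lia)

end SteenrodBounded

section DerivedCategories

variable (R : Type u) [CommRing R] (X : TopCat.{u})

/-- The bounded derived category `D^b(X, R)` of sheaves of `R`-modules on `X`. -/
abbrev Db := DerivedCategory.Bounded (Sh R X)

/-- The bounded derived category of `G`-equivariant sheaves of `R`-modules on `Y`, for a discrete
group `G`. -/
abbrev EqDb (G : Type) (Y : Type u) [Group G] [TopologicalSpace Y] [MulAction G Y]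
    [ContinuousConstSMul G Y] := DerivedCategory.Bounded (EqSh R G Y)

end DerivedCategories

section Hbar

section Modules

variable {R : Type u} [CommRing R] {p : ℕ} [NeZero p] {M N L : Type u} [AddCommGroup M] [Module R M]
  [AddCommGroup N] [Module R N] [AddCommGroup L] [Module R L]

variable (R p M) in
/-- The augmentation `M ⊗ R[μ_p] ⟶ M`, an element `∑ j, s j ⊗ [j]` of `M ⊗ R[μ_p]` being written as
the family `s`. -/
def augmentation : (Fin p → M) →ₗ[R] M where
  toFun s := ∑ j, s j
  map_add' s t := Finset.sum_add_distrib
  map_smul' r s := by simp [Finset.smul_sum]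

variable (R p M) in
/-- The module `M ⊗ I`, where `I` is the augmentation ideal of `R[μ_p]`. -/
abbrev AugIdeal : Type u := LinearMap.ker (augmentation R p M)

variable (R p M) in
/-- The map `σ - 1 : M ⊗ R[μ_p] ⟶ M ⊗ I`, where `σ` is the generator of `μ_p`. -/
def sigmaSubOne : (Fin p → M) →ₗ[R] AugIdeal R p M where
  toFun s := ⟨fun j => s (j - 1) - s j, by
    change ∑ j, (s (j - 1) - s j) = 0
    rw [Finset.sum_sub_distrib, sub_eq_zero]
    exact Equiv.sum_comp (Equiv.subRight (1 : Fin p)) s⟩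
  map_add' s t := Subtype.ext (funext fun j => add_sub_add_comm _ _ _ _)
  map_smul' r s := Subtype.ext (funext fun j => (smul_sub r (s (j - 1)) (s j)).symm)

lemma eq_of_sigmaSubOne_eq_zero (s : Fin p → M) (h : sigmaSubOne R p M s = 0) (j : Fin p) :
    s j = s 0 := by
  have h' : ∀ i : Fin p, s (i - 1) = s i := fun i =>
    sub_eq_zero.1 (congrFun (congrArg Subtype.val h) i)
  have key : ∀ n : ℕ, s (Fin.ofNat p n) = s 0 := by
    intro n
    induction n with
    | zero => rfl
    | succ n ih =>
      rw [← ih, ← h' (Fin.ofNat p (n + 1))]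
      congr 1
      rw [sub_eq_iff_eq_add]
      ext
      simp [Fin.val_add]
  have := key j.1
  rwa [Fin.ofNat_val_eq_self] at this

lemma sigmaSubOne_surjective : Function.Surjective (sigmaSubOne R p M) := by
  rintro ⟨t, ht⟩
  obtain ⟨n, rfl⟩ := Nat.exists_eq_succ_of_ne_zero (NeZero.ne p)
  have ht : ∑ j, t j = 0 := ht
  refine ⟨fun j => - ∑ i with i ≤ j, t i, Subtype.ext (funext fun j => ?_)⟩
  change -(∑ i with i ≤ j - 1, t i) - -(∑ i with i ≤ j, t i) = t j
  induction j using Fin.cases with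
  | zero =>
    have h1 : (Finset.univ.filter fun i : Fin (n + 1) => i ≤ 0 - 1) = Finset.univ := by
      ext i
      simp only [Finset.mem_filter, Finset.mem_univ, true_and, iff_true]
      have hlast : (-1 : Fin (n + 1)) = Fin.last n := by rw [← Fin.neg_last, neg_neg]
      rw [zero_sub, hlast]
      exact Fin.le_last i
    have h2 : (Finset.univ.filter fun i : Fin (n + 1) => i ≤ 0) = {0} := by
      ext i; simp
    rw [h1, h2, ht]; simp
  | succ j =>
    have h0 : j.succ - 1 = j.castSucc := by
      rw [sub_eq_iff_eq_add, Fin.coeSucc_eq_succ]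
    have h1 : (Finset.univ.filter fun i : Fin (n + 1) => i ≤ j.succ) =
        insert j.succ (Finset.univ.filter fun i : Fin (n + 1) => i ≤ j.castSucc) := by
      ext i
      simp only [Finset.mem_filter, Finset.mem_univ, true_and, Finset.mem_insert, Fin.le_def,
        Fin.ext_iff, Fin.val_succ, Fin.val_castSucc]
      lia
    rw [h0, h1, Finset.sum_insert]
    · abel
    · simp [Fin.le_def]

/-- The map `M ⊗ R[μ_p] ⟶ N ⊗ R[μ_p]` given by `φ : M ⟶ N` and the inverse of `g : μ_p`. -/
def regularMap (φ : M →ₗ[R] N) (g : Fin p) : (Fin p → M) →ₗ[R] (Fin p → N) where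
  toFun s j := φ (s (j + g))
  map_add' _ _ := funext fun _ => map_add φ _ _
  map_smul' _ _ := funext fun _ => map_smul φ _ _

lemma augmentation_regularMap (φ : M →ₗ[R] N) (g : Fin p) (s : Fin p → M) :
    augmentation R p N (regularMap φ g s) = φ (augmentation R p M s) := by
  change ∑ j, φ (s (j + g)) = φ (∑ j, s j)
  rw [map_sum]
  exact Equiv.sum_comp (Equiv.addRight g) fun j => φ (s j)

/-- The restriction of `regularMap` to the augmentation ideals. -/
def augIdealMap (φ : M →ₗ[R] N) (g : Fin p) : AugIdeal R p M →ₗ[R] AugIdeal R p N :=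
  (regularMap φ g).restrict fun s hs => by
    rw [LinearMap.mem_ker] at hs ⊢
    rw [augmentation_regularMap, hs, map_zero]

lemma regularMap_id (g : Fin p) (hg : g = 0) :
    regularMap (LinearMap.id : M →ₗ[R] M) g = LinearMap.id :=
  LinearMap.ext fun s => funext fun j => congrArg s (by rw [hg, add_zero])

lemma regularMap_comp (φ : M →ₗ[R] N) (ψ : N →ₗ[R] L) (g h k : Fin p) (hk : k = g + h) :
    regularMap (ψ ∘ₗ φ) k = regularMap ψ h ∘ₗ regularMap φ g :=
  LinearMap.ext fun s => funext fun j => congrArg (fun i => ψ (φ (s i))) (by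
    rw [hk, add_assoc, add_comm h])

lemma sigmaSubOne_regularMap (φ : M →ₗ[R] N) (g : Fin p) (s : Fin p → M) :
    sigmaSubOne R p N (regularMap φ g s) = augIdealMap φ g (sigmaSubOne R p M s) := by
  refine Subtype.ext (funext fun j => ?_)
  change φ (s (j - 1 + g)) - φ (s (j + g)) = φ (s (j + g - 1) - s (j + g))
  rw [map_sub, sub_add_eq_add_sub]

end Modules

variable (R : Type u) [CommRing R] (p : ℕ) [NeZero p] (Y : Type u) [TopologicalSpace Y]
  [MulAction (Mu p) Y] [ContinuousConstSMul (Mu p) Y]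

/-- The category of presheaves of `R`-modules on the site of equivariant open sets. -/
abbrev EqPsh := (EqOpens (Mu p) Y)ᵒᵖ ⥤ ModuleCat.{u} R

/-- The functor `F ↦ F ⊗ R[μ_p]` on equivariant presheaves. -/
def regular : EqPsh R p Y ⥤ EqPsh R p Y where
  obj F :=
    { obj U := ModuleCat.of R (Fin p → F.obj U)
      map f := ModuleCat.ofHom (regularMap (F.map f).hom f.unop.g.toAdd)
      map_id U := by
        rw [F.map_id]
        exact ModuleCat.hom_ext (regularMap_id _ rfl)
      map_comp f f' := by
        rw [F.map_comp]
        exact ModuleCat.hom_ext (regularMap_comp _ _ _ _ _ rfl) }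
  map τ :=
    { app U := ModuleCat.ofHom (regularMap (τ.app U).hom 0)
      naturality U V f := by
        refine ModuleCat.hom_ext ((regularMap_comp _ _ _ _ _ (add_zero _).symm).symm.trans
          (Eq.trans ?_ (regularMap_comp _ _ _ _ _ (zero_add _).symm)))
        rw [← ModuleCat.hom_comp, ← ModuleCat.hom_comp, τ.naturality f] }
  map_id F := by
    ext U : 2
    exact ModuleCat.hom_ext (regularMap_id _ rfl)
  map_comp τ τ' := by
    ext U : 2
    exact ModuleCat.hom_ext (regularMap_comp _ _ _ _ _ (add_zero 0).symm)

/-- The functor `F ↦ F ⊗ I` on equivariant presheaves, where `I` is the augmentation ideal of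
`R[μ_p]`. -/
def augIdeal : EqPsh R p Y ⥤ EqPsh R p Y where
  obj F :=
    { obj U := ModuleCat.of R (AugIdeal R p (F.obj U))
      map f := ModuleCat.ofHom (augIdealMap (F.map f).hom f.unop.g.toAdd)
      map_id U := by
        refine ModuleCat.hom_ext (LinearMap.ext fun s => Subtype.ext ?_)
        exact (ConcreteCategory.congr_hom (((regular R p Y).obj F).map_id U) s.1 :)
      map_comp f f' := by
        refine ModuleCat.hom_ext (LinearMap.ext fun s => Subtype.ext ?_)
        exact (ConcreteCategory.congr_hom (((regular R p Y).obj F).map_comp f f') s.1 :) }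
  map {F F'} τ :=
    { app U := ModuleCat.ofHom (augIdealMap (τ.app U).hom 0)
      naturality U V f := by
        refine ModuleCat.hom_ext (LinearMap.ext fun s => Subtype.ext ?_)
        exact (ConcreteCategory.congr_hom (((regular R p Y).map τ).naturality f) s.1 :) }
  map_id F := by
    ext U : 2
    refine ModuleCat.hom_ext (LinearMap.ext fun s => Subtype.ext ?_)
    exact (ConcreteCategory.congr_hom (congr_app ((regular R p Y).map_id F) U) s.1 :)
  map_comp τ τ' := by
    ext U : 2
    refine ModuleCat.hom_ext (LinearMap.ext fun s => Subtype.ext ?_)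
    exact (ConcreteCategory.congr_hom (congr_app ((regular R p Y).map_comp τ τ') U) s.1 :)

instance : (regular R p Y).Additive where
  map_add := rfl

instance : (augIdeal R p Y).Additive where
  map_add := rfl

/-- The inclusion `F ⊗ I ⟶ F ⊗ R[μ_p]`. -/
def augIncl : augIdeal R p Y ⟶ regular R p Y where
  app F := { app U := ModuleCat.ofHom (Submodule.subtype _) }

/-- The augmentation `F ⊗ R[μ_p] ⟶ F`. -/
def augMap : regular R p Y ⟶ 𝟭 _ where
  app F :=
    { app U := ModuleCat.ofHom (augmentation R p (F.obj U))
      naturality U V f := ModuleCat.hom_ext (LinearMap.ext fun s =>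
        augmentation_regularMap (F.map f).hom f.unop.g.toAdd s) }
  naturality F F' τ := by
    ext U : 2
    exact ModuleCat.hom_ext (LinearMap.ext fun s => augmentation_regularMap (τ.app U).hom 0 s)

/-- The map `F ⟶ F ⊗ R[μ_p]` given by the sum of the elements of `μ_p`. -/
def normMap : 𝟭 _ ⟶ regular R p Y where
  app F := { app U := ModuleCat.ofHom (LinearMap.pi fun _ => LinearMap.id) }

/-- The map `σ - 1 : F ⊗ R[μ_p] ⟶ F ⊗ I`. -/
def sigmaMap : regular R p Y ⟶ augIdeal R p Y where
  app F :=
    { app U := ModuleCat.ofHom (sigmaSubOne R p (F.obj U))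
      naturality U V f := ModuleCat.hom_ext (LinearMap.ext fun s =>
        sigmaSubOne_regularMap (F.map f).hom f.unop.g.toAdd s) }
  naturality F F' τ := by
    ext U : 2
    exact ModuleCat.hom_ext (LinearMap.ext fun s => sigmaSubOne_regularMap (τ.app U).hom 0 s)

/-- The short complex `0 ⟶ F ⊗ I ⟶ F ⊗ R[μ_p] ⟶ F ⟶ 0`. -/
def shortComplex₁ (F : EqPsh R p Y) : ShortComplex (EqPsh R p Y) :=
  ShortComplex.mk ((augIncl R p Y).app F) ((augMap R p Y).app F) (by
    ext U : 2
    exact ModuleCat.hom_ext (LinearMap.ext fun s => s.2))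

/-- The short complex `0 ⟶ F ⟶ F ⊗ R[μ_p] ⟶ F ⊗ I ⟶ 0`. -/
def shortComplex₂ (F : EqPsh R p Y) : ShortComplex (EqPsh R p Y) :=
  ShortComplex.mk ((normMap R p Y).app F) ((sigmaMap R p Y).app F) (by
    ext U : 2
    exact ModuleCat.hom_ext (LinearMap.ext fun s => Subtype.ext (funext fun j => sub_self s)))

variable {R p Y}

lemma shortExact_of_evaluation {D : Type u} [Category.{u} D] (S : ShortComplex (D ⥤ ModuleCat.{u} R))
    (h : ∀ U, (S.map ((evaluation _ _).obj U)).ShortExact) : S.ShortExact where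
  exact := by
    rw [ShortComplex.exact_iff_isZero_homology]
    refine Functor.isZero _ fun U => ?_
    have := (S.map ((evaluation _ _).obj U)).exact_iff_isZero_homology.1 (h U).exact
    exact this.of_iso (S.mapHomologyIso ((evaluation _ _).obj U)).symm
  mono_f := by
    have : ∀ U, Mono (S.f.app U) := fun U => (h U).mono_f
    exact NatTrans.mono_of_mono_app _
  epi_g := by
    have : ∀ U, Epi (S.g.app U) := fun U => (h U).epi_g
    exact NatTrans.epi_of_epi_app _

lemma shortExact₁ (F : EqPsh R p Y) : (shortComplex₁ R p Y F).ShortExact := by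
  refine shortExact_of_evaluation _ fun U => ModuleCat.shortComplex_shortExact _ ?_ ?_ ?_
  · rintro (s : Fin p → F.obj U)
    exact ⟨fun h => ⟨⟨s, h⟩, rfl⟩, by rintro ⟨t, rfl⟩; exact t.2⟩
  · exact Subtype.val_injective
  · intro (x : F.obj U)
    refine ⟨(Pi.single 0 x : Fin p → F.obj U), ?_⟩
    exact Fintype.sum_pi_single' (0 : Fin p) x

lemma shortExact₂ (F : EqPsh R p Y) : (shortComplex₂ R p Y F).ShortExact := by
  refine shortExact_of_evaluation _ fun U => ModuleCat.shortComplex_shortExact _ ?_ ?_ ?_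
  · rintro (s : Fin p → F.obj U)
    refine ⟨fun h => ⟨s 0, funext fun j => (eq_of_sigmaSubOne_eq_zero s h j).symm⟩, ?_⟩
    rintro ⟨(x : F.obj U), rfl⟩
    exact Subtype.ext (funext fun j => sub_self x)
  · intro (x : F.obj U) (y : F.obj U) h
    exact congrFun h 0
  · exact sigmaSubOne_surjective

end Hbar

section HbarDerived

variable (R : Type u) [CommRing R] (p : ℕ) [NeZero p] (Y : Type u) [TopologicalSpace Y]
  [MulAction (Mu p) Y] [ContinuousConstSMul (Mu p) Y]

/-- The sheaf associated to a presheaf functorially attached to a sheaf. -/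
noncomputable abbrev sheafified (T : EqPsh R p Y ⥤ EqPsh R p Y) :
    EqSh R (Mu p) Y ⥤ EqSh R (Mu p) Y :=
  sheafToPresheaf _ _ ⋙ T ⋙ presheafToSheaf (EqOpens.topology (Mu p) Y) (ModuleCat.{u} R)

/-- The functor `K ↦ a (T K)` on complexes of sheaves, where `a` is sheafification. -/
noncomputable abbrev sheafifiedComplex (T : EqPsh R p Y ⥤ EqPsh R p Y) [T.Additive] :
    CochainComplex (EqSh R (Mu p) Y) ℤ ⥤ CochainComplex (EqSh R (Mu p) Y) ℤ :=
  (sheafified R p Y T).mapHomologicalComplex _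

variable {R p Y}

/-- The natural map on complexes induced by a natural map of functors on presheaves. -/
noncomputable abbrev sheafifiedMap {T T' : EqPsh R p Y ⥤ EqPsh R p Y} [T.Additive] [T'.Additive]
    (τ : T ⟶ T') : sheafifiedComplex R p Y T ⟶ sheafifiedComplex R p Y T' :=
  NatTrans.mapHomologicalComplex
    (Functor.whiskerLeft (sheafToPresheaf _ _) (Functor.whiskerRight τ (presheafToSheaf _ _))) _

lemma sheafifiedMap_comp_eq_zero {T T' T'' : EqPsh R p Y ⥤ EqPsh R p Y} [T.Additive] [T'.Additive]
    [T''.Additive] (τ : T ⟶ T') (τ' : T' ⟶ T'') (h : ∀ F, τ.app F ≫ τ'.app F = 0)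
    (K : CochainComplex (EqSh R (Mu p) Y) ℤ) :
    (sheafifiedMap τ).app K ≫ (sheafifiedMap τ').app K = 0 := by
  ext n : 1
  change (presheafToSheaf _ _).map _ ≫ (presheafToSheaf _ _).map _ = _
  rw [← Functor.map_comp, h, Functor.map_zero]
  rfl

/-- The short exact sequence `0 ⟶ K ⊗ I ⟶ K ⊗ R[μ_p] ⟶ K ⟶ 0` of complexes of equivariant
sheaves. -/
noncomputable def sheafSES₁ (K : CochainComplex (EqSh R (Mu p) Y) ℤ) :
    ShortComplex (CochainComplex (EqSh R (Mu p) Y) ℤ) :=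
  ShortComplex.mk ((sheafifiedMap (augIncl R p Y)).app K) ((sheafifiedMap (augMap R p Y)).app K)
    (sheafifiedMap_comp_eq_zero _ _ (fun F => (shortComplex₁ R p Y F).zero) K)

/-- The short exact sequence `0 ⟶ K ⟶ K ⊗ R[μ_p] ⟶ K ⊗ I ⟶ 0` of complexes of equivariant
sheaves. -/
noncomputable def sheafSES₂ (K : CochainComplex (EqSh R (Mu p) Y) ℤ) :
    ShortComplex (CochainComplex (EqSh R (Mu p) Y) ℤ) :=
  ShortComplex.mk ((sheafifiedMap (normMap R p Y)).app K) ((sheafifiedMap (sigmaMap R p Y)).app K)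
    (sheafifiedMap_comp_eq_zero _ _ (fun F => (shortComplex₂ R p Y F).zero) K)

lemma sheafSES₁_shortExact (K : CochainComplex (EqSh R (Mu p) Y) ℤ) :
    (sheafSES₁ K).ShortExact :=
  HomologicalComplex.shortExact_of_degreewise_shortExact _ fun n =>
    (shortExact₁ ((sheafToPresheaf _ _).obj (K.X n))).map_of_exact
      (presheafToSheaf (EqOpens.topology (Mu p) Y) (ModuleCat.{u} R))

lemma sheafSES₂_shortExact (K : CochainComplex (EqSh R (Mu p) Y) ℤ) :
    (sheafSES₂ K).ShortExact :=
  HomologicalComplex.shortExact_of_degreewise_shortExact _ fun n =>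
    (shortExact₂ ((sheafToPresheaf _ _).obj (K.X n))).map_of_exact
      (presheafToSheaf (EqOpens.topology (Mu p) Y) (ModuleCat.{u} R))

/-- The functoriality of the first short exact sequence. -/
noncomputable def sheafSES₁Map {K L : CochainComplex (EqSh R (Mu p) Y) ℤ} (f : K ⟶ L) :
    sheafSES₁ K ⟶ sheafSES₁ L where
  τ₁ := (sheafifiedComplex R p Y (augIdeal R p Y)).map f
  τ₂ := (sheafifiedComplex R p Y (regular R p Y)).map f
  τ₃ := (sheafifiedComplex R p Y (𝟭 _)).map f
  comm₁₂ := (sheafifiedMap (augIncl R p Y)).naturality f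
  comm₂₃ := (sheafifiedMap (augMap R p Y)).naturality f

/-- The functoriality of the second short exact sequence. -/
noncomputable def sheafSES₂Map {K L : CochainComplex (EqSh R (Mu p) Y) ℤ} (f : K ⟶ L) :
    sheafSES₂ K ⟶ sheafSES₂ L where
  τ₁ := (sheafifiedComplex R p Y (𝟭 _)).map f
  τ₂ := (sheafifiedComplex R p Y (regular R p Y)).map f
  τ₃ := (sheafifiedComplex R p Y (augIdeal R p Y)).map f
  comm₁₂ := (sheafifiedMap (normMap R p Y)).naturality f
  comm₂₃ := (sheafifiedMap (sigmaMap R p Y)).naturality f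

variable (R p Y) in
/-- A complex of sheaves is isomorphic to its sheafification. -/
noncomputable def sheafifiedIdIso : 𝟭 (CochainComplex (EqSh R (Mu p) Y) ℤ) ≅
    sheafifiedComplex R p Y (𝟭 _) :=
  (Functor.mapHomologicalComplexIdIso _ _).symm ≪≫
    NatIso.mapHomologicalComplex (sheafificationNatIso (EqOpens.topology (Mu p) Y) (ModuleCat.{u} R) :
      𝟭 _ ≅ sheafified R p Y (𝟭 _)) _

open DerivedCategory in
variable (R p Y) in
/-- The connecting morphism `K ⟶ (K ⊗ I)[1]` of the first short exact sequence. -/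
noncomputable def delta₁ : sheafifiedComplex R p Y (𝟭 _) ⋙ Q ⟶
    (sheafifiedComplex R p Y (augIdeal R p Y) ⋙ Q) ⋙ shiftFunctor _ (1 : ℤ) where
  app K := triangleOfSESδ (sheafSES₁_shortExact K)
  naturality K L f := (triangleOfSESδ_naturality (sheafSES₁_shortExact K) (sheafSES₁_shortExact L)
      (sheafSES₁Map f)).symm

open DerivedCategory in
variable (R p Y) in
/-- The connecting morphism `K ⊗ I ⟶ K[1]` of the second short exact sequence. -/
noncomputable def delta₂ : sheafifiedComplex R p Y (augIdeal R p Y) ⋙ Q ⟶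
    (sheafifiedComplex R p Y (𝟭 _) ⋙ Q) ⋙ shiftFunctor _ (1 : ℤ) where
  app K := triangleOfSESδ (sheafSES₂_shortExact K)
  naturality K L f := (triangleOfSESδ_naturality (sheafSES₂_shortExact K) (sheafSES₂_shortExact L)
      (sheafSES₂Map f)).symm

open DerivedCategory in
variable (R p Y) in
/-- The class `K ⟶ K[2]` of the Yoneda extension
`0 ⟶ K ⟶ K ⊗ R[μ_p] ⟶ K ⊗ R[μ_p] ⟶ K ⟶ 0`, whose middle map is `σ - 1`: the composition of the
connecting morphisms of the two short exact sequences into which it decomposes. -/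
noncomputable def hbarQ : (Q : CochainComplex (EqSh R (Mu p) Y) ℤ ⥤ DerivedCategory _) ⟶
    Q ⋙ shiftFunctor _ (2 : ℤ) :=
  Functor.whiskerRight (sheafifiedIdIso R p Y).hom Q ≫ delta₁ R p Y ≫
    Functor.whiskerRight (delta₂ R p Y) (shiftFunctor _ (1 : ℤ)) ≫
    Functor.whiskerLeft (sheafifiedComplex R p Y (𝟭 _) ⋙ Q)
      (shiftFunctorAdd' (DerivedCategory (EqSh R (Mu p) Y)) (1 : ℤ) 1 2 rfl).inv ≫
    Functor.whiskerRight (Functor.whiskerRight (sheafifiedIdIso R p Y).inv Q)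
      (shiftFunctor _ (2 : ℤ))

variable (R p Y) in
/-- The natural transformation `ħ : Id ⟶ Σ²` of the derived category of `μ_p`-equivariant sheaves:
the action of the first Chern class of the tautological line bundle on `Bμ_p`. -/
noncomputable def hbar : 𝟭 (DerivedCategory (EqSh R (Mu p) Y)) ⟶ shiftFunctor _ (2 : ℤ) :=
  Localization.liftNatTrans DerivedCategory.Q (HomologicalComplex.quasiIso _ _)
    DerivedCategory.Q (DerivedCategory.Q ⋙ shiftFunctor _ (2 : ℤ)) _ _ (hbarQ R p Y)

open DerivedCategory.TStructure in
variable (R p Y) in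
/-- The natural transformation `ħ : Id ⟶ Σ²` of `D^b_{μ_p}(Y, R)`. -/
noncomputable def hbarBounded : 𝟭 (EqDb R (Mu p) Y) ⟶ shiftFunctor _ (2 : ℤ) where
  app K := ObjectProperty.homMk ((hbar R p Y).app K.obj ≫
    ((DerivedCategory.Bounded.ι (C := EqSh R (Mu p) Y)).commShiftIso (2 : ℤ)).inv.app K)
  naturality K L f := by
    ext
    exact (Functor.whiskerLeft (DerivedCategory.Bounded.ι (C := EqSh R (Mu p) Y)) (hbar R p Y) ≫
      ((DerivedCategory.Bounded.ι (C := EqSh R (Mu p) Y)).commShiftIso (2 : ℤ)).inv).naturality f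

variable (R p Y) in
/-- The cones of the morphisms `ħ : K ⟶ K[2]`. -/
def hbarCone : ObjectProperty (EqDb R (Mu p) Y) := fun C =>
  ∃ (K : EqDb R (Mu p) Y) (f : K⟦(2 : ℤ)⟧ ⟶ C) (g : C ⟶ K⟦(1 : ℤ)⟧),
    Pretriangulated.Triangle.mk ((hbarBounded R p Y).app K) f g ∈ distTriang (EqDb R (Mu p) Y)

instance : (hbarCone R p Y).Nonempty := by
  obtain ⟨K⟩ : Nonempty (EqDb R (Mu p) Y) := ⟨(HasZeroObject.zero (C := EqDb R (Mu p) Y)).choose⟩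
  obtain ⟨C, f, g, h⟩ := Pretriangulated.distinguished_cocone_triangle ((hbarBounded R p Y).app K)
  exact ⟨C, K, f, g, h⟩

variable (R p Y) in
/-- The localization `D^b_{μ_p}(Y, R)[ħ⁻¹]`: the Verdier quotient of `D^b_{μ_p}(Y, R)` by the thick
subcategory generated by the cones of the morphisms `ħ : K ⟶ K[2]`. -/
abbrev TateDb := (hbarCone R p Y).triangEnvelope.trW.Localization

variable (R p Y) in
/-- The localization functor. -/
noncomputable abbrev toTateDb : EqDb R (Mu p) Y ⥤ TateDb R p Y :=
  (hbarCone R p Y).triangEnvelope.trW.Q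

/-- In the localization, the morphisms `ħ : K ⟶ K[2]` are invertible. -/
lemma isIso_toTateDb_map_hbar (K : EqDb R (Mu p) Y) :
    IsIso ((toTateDb R p Y).map ((hbarBounded R p Y).app K)) := by
  obtain ⟨C, f, g, h⟩ := Pretriangulated.distinguished_cocone_triangle ((hbarBounded R p Y).app K)
  exact Localization.inverts (toTateDb R p Y) _ _
    (ObjectProperty.trW.mk _ h ((hbarCone R p Y).le_triangEnvelope _ ⟨K, f, g, h⟩))

end HbarDerived

section LeftDerived

variable (R : Type u) [CommRing R] (X : TopCat.{u}) (p : ℕ) [NeZero p]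

/-- Steenrod's construction, as a functor from the category of bounded complexes of sheaves on `X`
to the bounded derived category of `μ_p`-equivariant sheaves on `X ^ μ_p`. -/
noncomputable abbrev steenrodCD : (boundedComplex (Sh R X)).FullSubcategory ⥤
    EqDb R (Mu p) (MuPower p X) :=
  steenrodCb R X p ⋙ boundedQ _

/-- The condition that `R` has finite weak (i.e. `Tor`) dimension. -/
def HasFiniteWeakDimension : Prop :=
  ∃ d : ℕ, ∀ (M N : ModuleCat.{u} R) (n : ℕ), d < n →
    IsZero (((Tor (ModuleCat.{u} R) n).obj M).obj N)

end LeftDerived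

section Frobenius

/-- A functor between `R`-linear categories is Frobenius-linear (with respect to a prime `p`) if it
is additive on morphisms and satisfies `F (r • f) = r ^ p • F f`. -/
structure IsFrobeniusLinear (p : ℕ) (R : Type*) [CommRing R] {C D : Type*} [Category* C]
    [Category* D] [Preadditive C] [Preadditive D] [Linear R C] [Linear R D] (F : C ⥤ D) :
    Prop where
  map_add {K L : C} (f g : K ⟶ L) : F.map (f + g) = F.map f + F.map g
  map_smul {K L : C} (r : R) (f : K ⟶ L) : F.map (r • f) = r ^ p • F.map f

/-- The Frobenius twist `F^* C` of a `k`-linear category `C`, where `k` is a perfect field of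
characteristic `p`: it is the category `C` in which a scalar `c` acts on morphisms as `c ^ (1/p)`
does in `C`. -/
@[nolint unusedArguments]
def FrobTwist (_p : ℕ) (_k : Type*) (C : Type*) : Type _ := C

namespace FrobTwist

variable (p : ℕ) (k : Type*) (C : Type*) [Category* C]

instance : Category (FrobTwist p k C) := inferInstanceAs (Category C)

/-- The identity functor `F^* C ⥤ C`. -/
def untwist : FrobTwist p k C ⥤ C := 𝟭 C

variable [Preadditive C]

instance : Preadditive (FrobTwist p k C) := inferInstanceAs (Preadditive C)

/-- The action of `c` on the morphisms of `F^* C` is the action of `c ^ (1/p)` on the morphisms of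
`C`. -/
noncomputable instance [Field k] [Fact p.Prime] [CharP k p] [PerfectRing k p] [Linear k C] :
    Linear k (FrobTwist p k C) where
  homModule K L :=
    letI : Module k (K ⟶ L) := Linear.homModule (C := C) K L
    Module.compHom (K ⟶ L) ((frobeniusEquiv k p).symm : k →+* k)
  smul_comp K L M r f g :=
    Linear.smul_comp (C := C) K L M ((frobeniusEquiv k p).symm r) f g
  comp_smul K L M f r g :=
    Linear.comp_smul (C := C) K L M f ((frobeniusEquiv k p).symm r) g

lemma smul_def [Field k] [Fact p.Prime] [CharP k p] [PerfectRing k p] [Linear k C]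
    {K L : FrobTwist p k C} (c : k) (f : K ⟶ L) :
    (untwist p k C).map (c • f) = (frobeniusEquiv k p).symm c • (untwist p k C).map f :=
  rfl

instance [HasZeroObject C] : HasZeroObject (FrobTwist p k C) :=
  inferInstanceAs (HasZeroObject C)

variable [HasShift C ℤ]

instance : HasShift (FrobTwist p k C) ℤ := inferInstanceAs (HasShift C ℤ)

instance [∀ n : ℤ, (shiftFunctor C n).Additive] (n : ℤ) :
    (shiftFunctor (FrobTwist p k C) n).Additive :=
  inferInstanceAs (shiftFunctor C n).Additive

instance [HasZeroObject C] [∀ n : ℤ, (shiftFunctor C n).Additive] [Pretriangulated C] :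
    Pretriangulated (FrobTwist p k C) :=
  inferInstanceAs (Pretriangulated C)

end FrobTwist

end Frobenius

end SteenrodTate

open SteenrodTate

/-! Exactness is the heart of the matter, and it comes from one computation. Let `0 → A → B → C → 0`
be an exact sequence of complexes that splits in each degree. Writing `B` as `A ⊕ C` degree by
degree, `B^{⊠p}` becomes the sum, over the subsets `S` of `ℤ/p`, of the tensors having factors in
`A` at the places of `S` and in `C` elsewhere. The full and the empty set give `A^{⊠p}` and
`C^{⊠p}`. As `p` is prime, `μ_p` permutes the remaining subsets freely; the barycentre of a proper
subset (`exists_barycentre`) makes this canonical. Hence, if `E` is the kernel of `B^{⊠p} → C^{⊠p}`,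
the quotient `E / A^{⊠p}` is relatively projective in every degree: the augmentation `M ⊗ R[μ_p] →
M` splits (`relProj_cokernel_crossIncl`).

On an object whose augmentation splits, the first of the two extensions composing `ħ` is trivial, so
`ħ = 0`. Once `ħ` is inverted, such an object vanishes (`isZero_toTateDb_of_splitEpi`), and
induction on the length extends this to bounded complexes of relatively projective sheaves
(`isZero_tateQ_of_relProj`). So `A^{⊠p} → E` becomes invertible, and the short exact sequence `0 → E
→ B^{⊠p} → C^{⊠p} → 0` yields a triangle on `A^{⊠p}`, `B^{⊠p}`, `C^{⊠p}`, natural in the given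
sequence (`VanishesOnRelProj.splitComparison`).

Such natural triangles suffice for exactness (`SplitTriangles.exists_isTriangulated`). They are
applied to the cone sequences `0 → L → cone f → K[1] → 0`. For `f = id` the middle term is killed,
so the connecting map is an isomorphism, which up to sign is the compatibility with the shift; for
general `f`, naturality identifies the connecting map with this isomorphism followed by the shift of
the image of `f`. Additivity is never checked by hand: a triangulated functor is additive. The rule
`r ↦ r ^ p` holds already on complexes, since a scalar comes out of each of the `p` factors.
Multiplication by `p` vanishes because it is the norm `K → K ⊗ R[μ_p]` followed by the augmentation,
and the induced object `K ⊗ R[μ_p]` vanishes after localization (`nsmul_id_tateQ`).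

The derived functor is computed by a deformation, that is, a functorial quasi-isomorphism `r A → A`
with `r A` of flat stalks (`isRightKanExtension_deformationCounit`). This needs the bounded derived
category to be the localization of bounded complexes at quasi-isomorphisms, and `A ↦ A^{⊠p}` to
preserve quasi-isomorphisms between complexes with flat stalks (`quasiIso_steenrodC_map`). The
latter is checked on stalks: the stalk of `A^{⊠p}` at `y` is the tensor product of the stalks of `A`
at the coordinates of `y`, and tensor products of bounded below flat complexes respect
quasi-isomorphisms (`quasiIso_tensorMap`). The resolution is built from a functorial cover by free
sheaves; finite weak dimension lets it stop after finitely many steps (`exists_flat_resolution`).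
Over a field every stalk is flat, so the identity is a deformation and `α` is an isomorphism; over a
perfect field, `(c ^ (1/p)) ^ p = c` turns Frobenius-linearity into linearity on the twist. -/

namespace SteenrodTate

/-! ### Commutation with all shifts from commutation with the shift by one. -/

section CommShiftOfGenerator

open Functor.CommShift

variable {C D : Type*} [Category* C] [Category* D] [HasShift C ℤ] [HasShift D ℤ] (F : C ⥤ D)

/-- The pairs consisting of an integer `n` and an isomorphism by which `F` commutes with the shift
by `n`. -/
structure ShiftCommutation where
  /-- The degree of the shift. -/
  deg : ℤ
  /-- The commutation isomorphism. -/
  iso : shiftFunctor C deg ⋙ F ≅ F ⋙ shiftFunctor D deg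

namespace ShiftCommutation

variable {F}

lemma mk_isoAdd' {a b c : ℤ} (h : a + b = c) (e₁ : shiftFunctor C a ⋙ F ≅ F ⋙ shiftFunctor D a)
    (e₂ : shiftFunctor C b ⋙ F ≅ F ⋙ shiftFunctor D b) :
    (⟨a + b, isoAdd' rfl e₁ e₂⟩ : ShiftCommutation F) = ⟨c, isoAdd' h e₁ e₂⟩ := by
  subst h; rfl

noncomputable instance : Mul (ShiftCommutation F) := ⟨fun x y => ⟨x.deg + y.deg, isoAdd' rfl x.iso y.iso⟩⟩

noncomputable instance : One (ShiftCommutation F) := ⟨⟨0, isoZero F ℤ⟩⟩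

lemma mul_def (x y : ShiftCommutation F) : x * y = ⟨x.deg + y.deg, isoAdd' rfl x.iso y.iso⟩ := rfl

lemma one_def : (1 : ShiftCommutation F) = ⟨0, isoZero F ℤ⟩ := rfl

/-- The isomorphism by which `F` commutes with the shift by `-n`. -/
noncomputable def invIso {n : ℤ} (e : shiftFunctor C n ⋙ F ≅ F ⋙ shiftFunctor D n) :
    shiftFunctor C (-n) ⋙ F ≅ F ⋙ shiftFunctor D (-n) :=
  NatIso.ofComponents (fun X => (shiftFunctor D n).preimageIso
    ((e.app (X⟦-n⟧)).symm ≪≫ F.mapIso ((shiftFunctorCompIsoId C (-n) n (neg_add_cancel n)).app X) ≪≫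
      ((shiftFunctorCompIsoId D (-n) n (neg_add_cancel n)).app (F.obj X)).symm)) (by
    intro X Y f
    apply (shiftFunctor D n).map_injective
    have h1 := e.inv.naturality (f⟦-n⟧')
    dsimp at h1
    have h2 := (shiftFunctorCompIsoId C (-n) n (neg_add_cancel n)).hom.naturality f
    have h3 := (shiftFunctorCompIsoId D (-n) n (neg_add_cancel n)).inv.naturality (F.map f)
    dsimp at h2 h3
    simp only [Functor.comp_obj, Functor.comp_map, Functor.map_comp, Functor.preimageIso_hom,
      Functor.map_preimage, Iso.trans_hom, Iso.symm_hom, Iso.app_inv, Functor.mapIso_hom,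
      Iso.app_hom, Category.assoc, reassoc_of% h1]
    rw [← F.map_comp_assoc, h2, F.map_comp_assoc, h3])

lemma isoAdd'_invIso {n : ℤ} (e : shiftFunctor C n ⋙ F ≅ F ⋙ shiftFunctor D n) :
    isoAdd' (neg_add_cancel n) (invIso e) e = isoZero F ℤ := by
  ext X
  simp only [isoAdd'_hom_app, invIso, NatIso.ofComponents_hom_app, Functor.preimageIso_hom,
    Functor.map_preimage, Iso.trans_hom, Iso.symm_hom, Iso.app_inv, Functor.mapIso_hom,
      Iso.app_hom, isoZero_hom_app, shiftFunctorCompIsoId, Functor.map_comp, Category.assoc,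
      Iso.trans_inv, NatTrans.comp_app]
  rw [Iso.hom_inv_id_app_assoc, ← F.map_comp_assoc]
  rw [Iso.hom_inv_id_app]
  simp

/-- Bundling the degree with the isomorphism makes the coherence conditions of `Functor.CommShift`
into plain group identities. The family of isomorphisms extending a given one in degree `1` is then
the family of its integral powers. -/
noncomputable instance : Group (ShiftCommutation F) where
  mul_assoc x y z := by
    rw [mul_def, mul_def, mul_def, mul_def]
    dsimp only
    rw [isoAdd'_assoc x.iso y.iso z.iso rfl rfl rfl]
    exact (mk_isoAdd' (add_assoc _ _ _).symm _ _).symm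
  one_mul x := by
    rw [mul_def, one_def]
    dsimp only
    rw [mk_isoAdd' (zero_add x.deg), isoZero_isoAdd'_]
  mul_one x := by
    rw [mul_def, one_def]
    dsimp only
    rw [mk_isoAdd' (add_zero x.deg), isoAdd'_isoZero]
  inv x := ⟨-x.deg, invIso x.iso⟩
  inv_mul_cancel x := by
    rw [mul_def, one_def]
    dsimp only
    rw [mk_isoAdd' (neg_add_cancel x.deg), isoAdd'_invIso]

variable (F) in
/-- The degree, as a homomorphism. -/
noncomputable def degHom : ShiftCommutation F →* Multiplicative ℤ where
  toFun x := Multiplicative.ofAdd x.deg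
  map_one' := rfl
  map_mul' _ _ := rfl

lemma deg_zpow (x : ShiftCommutation F) (h : x.deg = 1) (n : ℤ) : (x ^ n).deg = n := by
  have := map_zpow (degHom F) x n
  have h' : degHom F x = Multiplicative.ofAdd 1 := congrArg Multiplicative.ofAdd h
  rw [h', ← ofAdd_zsmul, smul_eq_mul, mul_one] at this
  exact congrArg Multiplicative.toAdd this

end ShiftCommutation

variable {F}

/-- A functor that commutes with the shift by `1` commutes with all shifts. -/
lemma exists_commShift (e : shiftFunctor C (1 : ℤ) ⋙ F ≅ F ⋙ shiftFunctor D (1 : ℤ)) :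
    ∃ h : F.CommShift ℤ, h.commShiftIso 1 = e := by
  let x : ShiftCommutation F := ⟨1, e⟩
  have hx (n : ℤ) : (x ^ n).deg = n := x.deg_zpow rfl n
  -- The degree of `x ^ n` is only propositionally `n`. Generalizing the power allows this equality
  -- to be eliminated, so that no transport enters the chosen isomorphisms.
  have key (n : ℤ) : ∃ φ : shiftFunctor C n ⋙ F ≅ F ⋙ shiftFunctor D n, x ^ n = ⟨n, φ⟩ := by
    have := hx n
    generalize x ^ n = y at this
    obtain ⟨m, φ⟩ := y
    obtain rfl : m = n := this
    exact ⟨φ, rfl⟩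
  choose φ hφ using key
  have inj {n : ℤ} {a b : shiftFunctor C n ⋙ F ≅ F ⋙ shiftFunctor D n}
      (h : (⟨n, a⟩ : ShiftCommutation F) = ⟨n, b⟩) : a = b := by
    simpa using h
  refine ⟨⟨φ, inj ?_, fun a b => inj ?_⟩, inj ((hφ 1).symm.trans (zpow_one x))⟩
  · rw [← hφ, zpow_zero]; rfl
  · exact (hφ (a + b)).symm.trans ((zpow_add x a b).trans (congrArg₂ _ (hφ a) (hφ b)))

end CommShiftOfGenerator

/-! ### Left derived functors from functorial deformations. -/

section LeftDerivedOfDeformation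

variable {C D E : Type*} [Category* C] [Category* D] [Category* E] {L : C ⥤ D}
  {W : MorphismProperty C} [L.IsLocalization W] {F : C ⥤ E} {r : C ⥤ C} {ε : r ⟶ 𝟭 C}
  {RF : D ⥤ E} (e : L ⋙ RF ≅ r ⋙ F)

/-- The counit of the left derived functor obtained from a deformation `r`. -/
def deformationCounit (ε : r ⟶ 𝟭 C) : L ⋙ RF ⟶ F where
  app X := e.hom.app X ≫ F.map (ε.app X)
  naturality X Y f := by
    have h1 := e.hom.naturality f
    have h2 := congrArg F.map (ε.naturality f)
    simp only [Functor.comp_obj, Functor.comp_map, Functor.id_obj, Functor.id_map,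
      Functor.map_comp] at h1 h2 ⊢
    rw [reassoc_of% h1, h2, Category.assoc]

include e in
-- The maps `r ε_X` and `ε_{rX}` become equal under `L`, because `ε_X` equalizes them and is
-- inverted. Since `r ⋙ F` factors through `L`, they have the same image under `r ⋙ F`; naturality
-- of `ε` and the invertibility of `F` on `ε_{rrX}` then remove the extra `r`.
lemma map_deformation_eq (hε : ∀ X, W (ε.app X))
    (hF : ∀ X, IsIso (F.map (ε.app (r.obj X)))) (X : C) :
    F.map (r.map (ε.app X)) = F.map (ε.app (r.obj X)) := by
  have iso {X Y : C} (u v : X ⟶ Y) (h : L.map u = L.map v) : F.map (r.map u) = F.map (r.map v) := by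
    have hu := e.hom.naturality u
    have hv := e.hom.naturality v
    dsimp at hu hv
    rw [← cancel_epi (e.hom.app X), ← hu, ← hv, h]
  have hL (X : C) : L.map (r.map (ε.app X)) = L.map (ε.app (r.obj X)) := by
    have := Localization.inverts L W _ (hε X)
    rw [← cancel_mono (L.map (ε.app X)), ← L.map_comp, ← L.map_comp]
    exact congrArg L.map (ε.naturality (ε.app X))
  have h1 := congrArg F.map (ε.naturality (r.map (ε.app X)))
  have h2 := congrArg F.map (ε.naturality (ε.app (r.obj X)))
  dsimp at h1 h2
  rw [F.map_comp, F.map_comp] at h1 h2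
  have h3 := iso _ _ (hL X)
  have := hF (r.obj X)
  rw [← cancel_epi (F.map (ε.app (r.obj (r.obj X)))), ← h1, h3, h2]

/-- The value of `γ` at `L X` is determined by its value at `L (r X)` composed with the counit
there, since `L` inverts `ε_X`; `map_deformation_eq` is what identifies the counit at `r X` in this
comparison. -/
lemma deformationCounit_hom_ext (hε : ∀ X, W (ε.app X))
    (hF : ∀ X, IsIso (F.map (ε.app (r.obj X)))) {G : D ⥤ E} (γ γ' : G ⟶ RF)
    (h : ∀ X, γ.app (L.obj X) ≫ (deformationCounit e ε).app X =
      γ'.app (L.obj X) ≫ (deformationCounit e ε).app X) : γ = γ' := by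
  have hL (X : C) : IsIso (L.map (ε.app X)) := Localization.inverts L W _ (hε X)
  have key (γ : G ⟶ RF) (X : C) : G.map (L.map (ε.app X)) ≫ γ.app (L.obj X) ≫ e.hom.app X =
      γ.app (L.obj (r.obj X)) ≫ (deformationCounit e ε).app (r.obj X) := by
    have h1 := e.hom.naturality (ε.app X)
    have h2 := γ.naturality (L.map (ε.app X))
    dsimp at h1 h2
    rw [reassoc_of% h2]
    dsimp [deformationCounit]
    rw [← map_deformation_eq e hε hF X, ← h1]
  apply Localization.natTrans_ext L W
  intro X
  rw [← cancel_mono (e.hom.app X), ← cancel_epi (G.map (L.map (ε.app X)))]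
  exact (key γ X).trans ((h _).trans (key γ' X).symm)

lemma exists_deformationCounit_lift (hε : ∀ X, W (ε.app X)) {G : D ⥤ E} (β : L ⋙ G ⟶ F) :
    ∃ γ : G ⟶ RF, ∀ X, γ.app (L.obj X) ≫ (deformationCounit e ε).app X = β.app X := by
  have hL (X : C) : IsIso (L.map (ε.app X)) := Localization.inverts L W _ (hε X)
  -- The lift evaluates `β` at the deformed object `r X` and returns to `X` along the inverse of `G
  -- (L ε_X)`.
  let γ₀ : L ⋙ G ⟶ r ⋙ F :=
    { app X := inv (G.map (L.map (ε.app X))) ≫ β.app (r.obj X)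
      naturality X X' f := by
        have h1 := congrArg (fun g => G.map (L.map g)) (ε.naturality f)
        have h2 := β.naturality (r.map f)
        dsimp at h1 h2 ⊢
        rw [← cancel_epi (G.map (L.map (ε.app X)))]
        simp only [Functor.map_comp] at h1
        rw [← reassoc_of% h1, IsIso.hom_inv_id_assoc, Category.assoc, ← h2,
          IsIso.hom_inv_id_assoc] }
  let : Localization.Lifting L W (L ⋙ G) G := ⟨Iso.refl _⟩
  let : Localization.Lifting L W (r ⋙ F) RF := ⟨e⟩
  refine ⟨Localization.liftNatTrans L W (L ⋙ G) (r ⋙ F) _ _ γ₀, fun X => ?_⟩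
  have h1 := Localization.liftNatTrans_app L W (L ⋙ G) (r ⋙ F) G RF γ₀ X
  have h2 := β.naturality (ε.app X)
  rw [h1]
  change (𝟙 _ ≫ (inv (G.map (L.map (ε.app X))) ≫ β.app (r.obj X)) ≫ e.inv.app X) ≫
    (e.hom.app X ≫ F.map (ε.app X)) = _
  dsimp at h2
  rw [Category.id_comp, Category.assoc, Iso.inv_hom_id_app_assoc, Category.assoc, ← h2]
  exact IsIso.inv_hom_id_assoc _ _

lemma isRightKanExtension_deformationCounit (hε : ∀ X, W (ε.app X))
    (hF : ∀ X, IsIso (F.map (ε.app (r.obj X)))) :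
    RF.IsRightKanExtension (deformationCounit e ε) := by
  choose γ hγ using fun (G : D ⥤ E) (β : L ⋙ G ⟶ F) => exists_deformationCounit_lift e hε β
  refine ⟨⟨IsTerminal.ofUniqueHom
    (fun Y => CostructuredArrow.homMk (γ Y.left Y.hom) (NatTrans.ext (funext fun X => hγ _ _ X)))
    (fun Y m => CostructuredArrow.hom_ext _ _ (deformationCounit_hom_ext e hε hF _ _ fun X => ?_))⟩⟩
  exact (NatTrans.congr_app (CostructuredArrow.w m) X).trans (hγ Y.left Y.hom X).symm

/-- Natural isomorphisms between functors on a localization can be defined on the objects of a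
class `P` into which every object can be deformed. -/
lemma exists_natIso_of_deformation (hε : ∀ X, W (ε.app X)) (P : ObjectProperty C)
    (hP : ∀ X, P (r.obj X)) {G₁ G₂ : D ⥤ E} (τ : P.ι ⋙ L ⋙ G₁ ≅ P.ι ⋙ L ⋙ G₂) :
    ∃ e : G₁ ≅ G₂, ∀ (X : C) (hX : P X), e.hom.app (L.obj X) = τ.hom.app ⟨X, hX⟩ := by
  have hL (X : C) : IsIso (L.map (ε.app X)) := Localization.inverts L W _ (hε X)
  let q (G : D ⥤ E) : P.lift r hP ⋙ P.ι ⋙ L ⋙ G ≅ L ⋙ G :=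
    NatIso.ofComponents (fun X => asIso (G.map (L.map (ε.app X)))) (fun {X Y} f => by
      have := congrArg (fun g => G.map (L.map g)) (ε.naturality f)
      simp only [Functor.id_obj, Functor.id_map, Functor.map_comp] at this
      exact this)
  let t : L ⋙ G₁ ≅ L ⋙ G₂ := (q G₁).symm ≪≫ Functor.isoWhiskerLeft (P.lift r hP) τ ≪≫ q G₂
  let _ (G : D ⥤ E) : Localization.Lifting L W (L ⋙ G) G := ⟨Iso.refl _⟩
  refine ⟨Localization.liftNatIso L W (L ⋙ G₁) (L ⋙ G₂) G₁ G₂ t, fun X hX => ?_⟩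
  have h1 := Localization.liftNatTrans_app L W (L ⋙ G₁) (L ⋙ G₂) G₁ G₂ t.hom X
  refine h1.trans ?_
  have h3 (G : D ⥤ E) : (Localization.Lifting.iso L W (L ⋙ G) G).hom.app X = 𝟙 _ := rfl
  have h4 (G : D ⥤ E) : (Localization.Lifting.iso L W (L ⋙ G) G).inv.app X = 𝟙 _ := rfl
  rw [h3, h4]
  -- For `X` in `P`, the map `ε_X` lies in `P`, and naturality of `τ` along it shows that the
  -- extension has the prescribed value at `X` itself, and not only at `r X`.
  have h2 := τ.hom.naturality (X := (P.lift r hP).obj X) (Y := ⟨X, hX⟩) (ObjectProperty.homMk (ε.app X))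
  change 𝟙 _ ≫ ((inv (G₁.map (L.map (ε.app X))) ≫ τ.hom.app ((P.lift r hP).obj X) ≫ G₂.map (L.map (ε.app X)))) ≫ 𝟙 _ = _
  rw [Category.id_comp, Category.comp_id]
  exact (congrArg _ h2.symm).trans (IsIso.inv_hom_id_assoc _ _)

end LeftDerivedOfDeformation

end SteenrodTate

namespace SteenrodTate

/-! ### The bounded derived category as a localization of bounded complexes. -/

section BoundedLocalization

/-- The natural maps `j` and `q` descend to the localization and there relate the identity to `H`
through a third functor. At the images of `K` and `L` both legs are invertible, so `H` is injective
on morphisms between them. In the application the functors are truncations that leave `K` and `L`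
unchanged. -/
lemma eq_of_map_eq_of_zigzag {C D : Type*} [Category* C] [Category* D] (N : C ⥤ D)
    (W : MorphismProperty C) [N.IsLocalization W] {M₁ M₂ : C ⥤ C} (j : M₁ ⟶ 𝟭 C) (q : M₁ ⟶ M₂)
    (h₁ : W.IsInvertedBy (M₁ ⋙ N)) {H : D ⥤ D} (e : N ⋙ H ≅ M₂ ⋙ N) {K L : C}
    [IsIso (j.app K)] [IsIso (j.app L)] [IsIso (q.app K)] [IsIso (q.app L)]
    {u v : N.obj K ⟶ N.obj L} (h : H.map u = H.map v) : u = v := by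
  let M : D ⥤ D := Localization.lift (M₁ ⋙ N) h₁ N
  let _ : Localization.Lifting N W N (𝟭 D) := Localization.Lifting.id _ _
  let _ : Localization.Lifting N W (M₂ ⋙ N) H := ⟨e⟩
  let j' : M ⟶ 𝟭 D := Localization.liftNatTrans N W (M₁ ⋙ N) N M (𝟭 D) (Functor.whiskerRight j N)
  let q' : M ⟶ H := Localization.liftNatTrans N W (M₁ ⋙ N) (M₂ ⋙ N) M H (Functor.whiskerRight q N)
  have hj (X : C) [IsIso (j.app X)] : IsIso (j'.app (N.obj X)) := by
    dsimp only [j']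
    rw [Localization.liftNatTrans_app]
    have : IsIso ((Functor.whiskerRight j N).app X) :=
      inferInstanceAs (IsIso (N.map (j.app X)))
    infer_instance
  have hq (X : C) [IsIso (q.app X)] : IsIso (q'.app (N.obj X)) := by
    dsimp only [q']
    rw [Localization.liftNatTrans_app]
    have : IsIso ((Functor.whiskerRight q N).app X) :=
      inferInstanceAs (IsIso (N.map (q.app X)))
    infer_instance
  have hM : M.map u = M.map v := by
    rw [← cancel_mono (q'.app (N.obj L)), q'.naturality, q'.naturality, h]
  have := j'.naturality u
  rw [hM, j'.naturality v, cancel_epi] at this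
  exact this.symm

variable (C : Type*) [Category* C] [Abelian C]

/-- The quasi-isomorphisms between bounded complexes. -/
def boundedQuasiIso : MorphismProperty (boundedComplex C).FullSubcategory :=
  (HomologicalComplex.quasiIso C _).inverseImage (boundedComplex C).ι

/-- The truncation functor `K ↦ τ≥a τ≤b K`. -/
noncomputable abbrev truncFunctor (a b : ℤ) : CochainComplex C ℤ ⥤ CochainComplex C ℤ :=
  (ComplexShape.embeddingUpIntLE b).truncLEFunctor C ⋙
    (ComplexShape.embeddingUpIntGE a).truncGEFunctor C

instance (K : CochainComplex C ℤ) (a b : ℤ) : ((truncFunctor C a b).obj K).IsStrictlyGE a :=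
  inferInstanceAs (((K.truncLE b).truncGE a).IsStrictlyGE a)

instance (K : CochainComplex C ℤ) (a b : ℤ) : ((truncFunctor C a b).obj K).IsStrictlyLE b :=
  inferInstanceAs (((K.truncLE b).truncGE a).IsStrictlyLE b)

/-- The truncation functor `K ↦ τ≥a τ≤b K`, with values in bounded complexes. -/
noncomputable def truncBounded (a b : ℤ) :
    CochainComplex C ℤ ⥤ (boundedComplex C).FullSubcategory :=
  (boundedComplex C).lift (truncFunctor C a b) fun _ => ⟨a, b, inferInstance, inferInstance⟩

/-- The truncation functor `K ↦ τ≤b K` on bounded complexes. -/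
noncomputable def truncLEBounded (b : ℤ) :
    (boundedComplex C).FullSubcategory ⥤ (boundedComplex C).FullSubcategory :=
  (boundedComplex C).lift ((boundedComplex C).ι ⋙ (ComplexShape.embeddingUpIntLE b).truncLEFunctor C)
    fun ⟨K, a', _, _, _⟩ => ⟨a', b, inferInstanceAs ((K.truncLE b).IsStrictlyGE a'),
      inferInstanceAs ((K.truncLE b).IsStrictlyLE b)⟩

variable {C}

lemma quasiIso_truncLEMap {K L : CochainComplex C ℤ} (f : K ⟶ L) [QuasiIso f] (b : ℤ) :
    QuasiIso (((ComplexShape.embeddingUpIntLE b).truncLEFunctor C).map f) := by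
  change QuasiIso (CochainComplex.truncLEMap f b)
  rw [CochainComplex.quasiIso_truncLEMap_iff]
  infer_instance

lemma quasiIso_truncFunctorMap {K L : CochainComplex C ℤ} (f : K ⟶ L) [QuasiIso f] (a b : ℤ) :
    QuasiIso ((truncFunctor C a b).map f) := by
  have := quasiIso_truncLEMap f b
  change QuasiIso (CochainComplex.truncGEMap (CochainComplex.truncLEMap f b) a)
  rw [CochainComplex.quasiIso_truncGEMap_iff]
  have : QuasiIso (CochainComplex.truncLEMap f b) := this
  infer_instance

lemma exists_bounds (K L : CochainComplex C ℤ) (hK : boundedComplex C K) (hL : boundedComplex C L) :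
    ∃ a b : ℤ, K.IsStrictlyGE a ∧ K.IsStrictlyLE b ∧ L.IsStrictlyGE a ∧ L.IsStrictlyLE b := by
  obtain ⟨a, b, _, _⟩ := hK
  obtain ⟨a', b', _, _⟩ := hL
  exact ⟨min a a', max b b', K.isStrictlyGE_of_ge _ _ (min_le_left a a'),
    K.isStrictlyLE_of_le _ _ (le_max_left b b'), L.isStrictlyGE_of_ge _ _ (min_le_right a a'),
    L.isStrictlyLE_of_le _ _ (le_max_right b b')⟩

variable [HasDerivedCategory C]

lemma isIso_boundedQ_map_iff {K L : (boundedComplex C).FullSubcategory} (f : K ⟶ L) :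
    IsIso ((boundedQ C).map f) ↔ QuasiIso f.hom := by
  rw [← DerivedCategory.isIso_Q_map_iff_quasiIso]
  exact (isIso_iff_of_reflects_iso ((boundedQ C).map f) (DerivedCategory.Bounded.ι (C := C))).symm

lemma boundedQuasiIso_inverted : (boundedQuasiIso C).IsInvertedBy (boundedQ C) :=
  fun _ _ f hf => (isIso_boundedQ_map_iff f).2 hf

instance : (boundedQ C).EssSurj where
  mem_essImage := by
    rintro ⟨X, ⟨a, ha⟩, ⟨b, hb⟩⟩
    have : X.IsGE a := ha
    have : X.IsLE b := hb
    obtain ⟨K, h, h', ⟨e⟩⟩ := DerivedCategory.exists_iso_Q_obj_of_isGE_of_isLE X a b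
    exact ⟨⟨K, a, b, h, h'⟩, ⟨(DerivedCategory.Bounded.ι (C := C)).preimageIso e.symm⟩⟩

/-- The roof representing a morphism between complexes concentrated in degrees `[a, b]` may itself
be taken in `[a, b]`, hence bounded. -/
lemma boundedQ_right_fac {K L : (boundedComplex C).FullSubcategory}
    (f : (boundedQ C).obj K ⟶ (boundedQ C).obj L) :
    ∃ (K' : (boundedComplex C).FullSubcategory) (s : K' ⟶ K) (_ : boundedQuasiIso C s)
      (g : K' ⟶ L), (boundedQ C).map s ≫ f = (boundedQ C).map g := by
  obtain ⟨a, b, _, _, _, _⟩ := exists_bounds K.obj L.obj K.property L.property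
  obtain ⟨X, h, h', s, hs, g, e⟩ :=
    DerivedCategory.right_fac_of_isStrictlyLE_of_isStrictlyGE (X := K.obj) (Y := L.obj) a b f.hom
  refine ⟨⟨X, a, b, h, h'⟩, ObjectProperty.homMk s,
    (DerivedCategory.isIso_Q_map_iff_quasiIso (φ := s)).1 hs, ObjectProperty.homMk g, ?_⟩
  ext
  change DerivedCategory.Q.map s ≫ f.hom = DerivedCategory.Q.map g
  rw [e]
  exact IsIso.hom_inv_id_assoc _ _

/-- The comparison from the formal localization is full by calculus of fractions. For faithfulness,
two morphisms to be compared involve complexes in a common range `[a, b]`, and truncation to that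
range gives a functor from the derived category back to the formal localization which undoes the
comparison there. -/
instance : (boundedQ C).IsLocalization (boundedQuasiIso C) := by
  let W := boundedQuasiIso C
  let N := W.Q
  let Φ := Localization.Construction.lift (boundedQ C) boundedQuasiIso_inverted
  have eΦ : N ⋙ Φ = boundedQ C := Localization.Construction.fac _ _
  have hΦ {K L : (boundedComplex C).FullSubcategory} (f : K ⟶ L) :
      Φ.map (N.map f) = (boundedQ C).map f := by
    have := Functor.congr_hom eΦ f
    dsimp only [Functor.comp_map] at this
    rw [this]
    exact (Category.id_comp _).trans (Category.comp_id _)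
  have surj (X : W.Localization) : ∃ K, X = N.obj K :=
    ⟨_, ((Localization.Construction.objEquiv W).apply_symm_apply X).symm⟩
  have : Φ.EssSurj := ⟨fun Y => ⟨N.obj ((boundedQ C).objPreimage Y), ⟨(boundedQ C).objObjPreimageIso Y⟩⟩⟩
  have : Φ.Full := ⟨fun {X Y} f => by
    obtain ⟨K, rfl⟩ := surj X
    obtain ⟨L, rfl⟩ := surj Y
    obtain ⟨K', s, hs, g, e⟩ := boundedQ_right_fac (K := K) (L := L) f
    have := Localization.inverts N W s hs
    refine ⟨inv (N.map s) ≫ N.map g, ?_⟩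
    have h1 : IsIso (Φ.map (N.map s)) := inferInstance
    rw [← cancel_epi (Φ.map (N.map s)), Φ.map_comp, ← Functor.map_comp_assoc, IsIso.hom_inv_id,
      CategoryTheory.Functor.map_id, Category.id_comp]
    rw [hΦ, hΦ]
    exact e.symm⟩
  have : Φ.Faithful := ⟨fun {X Y} u v h => by
    obtain ⟨K, rfl⟩ := surj X
    obtain ⟨L, rfl⟩ := surj Y
    obtain ⟨a, b, _, _, _, _⟩ := exists_bounds K.obj L.obj K.property L.property
    let T := truncBounded C a b
    -- Truncation is defined on all complexes and preserves quasi-isomorphisms, so it factors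
    -- through the unbounded derived category, although its values are bounded.
    have hT : (HomologicalComplex.quasiIso C (ComplexShape.up ℤ)).IsInvertedBy (T ⋙ N) :=
      fun K L f (hf : QuasiIso f) => Localization.inverts N W (T.map f)
        (quasiIso_truncFunctorMap f a b)
    let T' := Localization.lift (T ⋙ N) hT DerivedCategory.Q
    let e : N ⋙ Φ ⋙ DerivedCategory.Bounded.ι ⋙ T' ≅ ((boundedComplex C).ι ⋙ T) ⋙ N :=
      Functor.isoWhiskerRight (eqToIso eΦ) (DerivedCategory.Bounded.ι ⋙ T') ≪≫ Functor.isoWhiskerLeft (boundedComplex C).ι (Localization.fac (T ⋙ N) hT DerivedCategory.Q)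
    let j : truncLEBounded C b ⟶ 𝟭 _ :=
      { app K := ObjectProperty.homMk (K.obj.ιTruncLE b)
        naturality _ _ f := by
          ext : 1
          exact CochainComplex.ιTruncLE_naturality f.hom b }
    let q : truncLEBounded C b ⟶ (boundedComplex C).ι ⋙ T :=
      { app K := ObjectProperty.homMk ((K.obj.truncLE b).πTruncGE a)
        naturality _ _ f := by
          ext : 1
          exact (CochainComplex.πTruncGE_naturality (CochainComplex.truncLEMap f.hom b) a).symm }
    have hj (K : (boundedComplex C).FullSubcategory) [K.obj.IsStrictlyLE b] : IsIso (j.app K) := by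
      rw [← isIso_iff_of_reflects_iso _ (boundedComplex C).ι]
      exact inferInstanceAs (IsIso (K.obj.ιTruncLE b))
    have hq (K : (boundedComplex C).FullSubcategory) [K.obj.IsStrictlyGE a] : IsIso (q.app K) := by
      rw [← isIso_iff_of_reflects_iso _ (boundedComplex C).ι]
      exact inferInstanceAs (IsIso ((K.obj.truncLE b).πTruncGE a))
    have := hj K
    have := hj L
    have := hq K
    have := hq L
    refine eq_of_map_eq_of_zigzag N W j q (fun K L f (hf : QuasiIso f.hom) => ?_) e ?_
    · exact Localization.inverts N W ((truncLEBounded C b).map f) (quasiIso_truncLEMap f.hom b)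
    · exact congrArg (DerivedCategory.Bounded.ι ⋙ T').map h⟩
  exact Functor.IsLocalization.mk boundedQuasiIso_inverted (show Φ.IsEquivalence from { })

end BoundedLocalization

end SteenrodTate

namespace SteenrodTate

/-! ### Flatness and exactness for tensor products of finite families. -/

section PiTensor

set_option linter.unusedSectionVars false

variable {R : Type u} [CommRing R]

lemma flat_piTensorProduct {ι : Type} [Finite ι] (M : ι → Type u) [∀ i, AddCommGroup (M i)]
    [∀ i, Module R (M i)] (h : ∀ i, Module.Flat R (M i)) : Module.Flat R (⨂[R] i, M i) := by
  obtain ⟨n, hn⟩ : ∃ n, Nat.card ι = n := ⟨_, rfl⟩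
  induction n generalizing ι with
  | zero =>
    have : IsEmpty ι := (Finite.card_eq_zero_iff).1 hn
    exact Module.Flat.of_linearEquiv (PiTensorProduct.isEmptyEquiv (s := M) ι)
  | succ n ih =>
    classical
    have : Nonempty ι := (Nat.card_pos_iff.1 (by lia)).1
    obtain ⟨j⟩ := this
    have hc : Nat.card (({j}ᶜ : Set ι)) = n := by
      have := Set.ncard_add_ncard_compl ({j} : Set ι)
      rw [Set.ncard_singleton, hn] at this
      rw [Nat.card_coe_set_eq]
      lia
    have := ih (ι := ({j}ᶜ : Set ι)) (fun i => M i) (fun i => h i) hc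
    have := h j
    exact Module.Flat.of_linearEquiv (PiTensorProduct.equivPiTensorComplSingletonTensor R M j)

variable {ι : Type} [Fintype ι] {M N P : ι → Type u}
  [∀ i, AddCommGroup (M i)] [∀ i, Module R (M i)] [∀ i, AddCommGroup (N i)] [∀ i, Module R (N i)]
  [∀ i, AddCommGroup (P i)] [∀ i, Module R (P i)]

lemma equivPiTensorComplSingletonTensor_map [DecidableEq ι] (j : ι) (f : ∀ i, M i →ₗ[R] N i) (x : ⨂[R] i, M i) :
    PiTensorProduct.equivPiTensorComplSingletonTensor R N j (PiTensorProduct.map f x) =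
      TensorProduct.map (PiTensorProduct.map fun i : ({j}ᶜ : Set ι) => f i) (f j)
        (PiTensorProduct.equivPiTensorComplSingletonTensor R M j x) := by
  induction x using PiTensorProduct.induction_on with
  | smul_tprod r x =>
    rw [map_smul, map_smul, map_smul, map_smul, PiTensorProduct.map_tprod,
      PiTensorProduct.equivPiTensorComplSingletonTensor_tprod,
      PiTensorProduct.equivPiTensorComplSingletonTensor_tprod, TensorProduct.map_tmul,
      PiTensorProduct.map_tprod]
    rfl
  | add x y hx hy => simp only [map_add, hx, hy]

/-- Splitting off the factor `j`, and using that the other maps are isomorphisms, both maps become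
tensorings of `f j` and `g j` with the tensor product of the other `N i`, which is flat. -/
lemma exact_piTensorProduct_map (j : ι) (f : ∀ i, M i →ₗ[R] N i) (g : ∀ i, N i →ₗ[R] P i)
    (hf : ∀ i ≠ j, Function.Bijective (f i)) (hg : ∀ i ≠ j, Function.Bijective (g i))
    (hN : ∀ i ≠ j, Module.Flat R (N i)) (h : Function.Exact (f j) (g j)) :
    Function.Exact (PiTensorProduct.map f) (PiTensorProduct.map g) := by
  classical
  let a := PiTensorProduct.congr fun i : ({j}ᶜ : Set ι) => LinearEquiv.ofBijective (f i) (hf i i.2)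
  let b := PiTensorProduct.congr fun i : ({j}ᶜ : Set ι) => LinearEquiv.ofBijective (g i) (hg i i.2)
  have hfl := flat_piTensorProduct (R := R) (fun i : ({j}ᶜ : Set ι) => N i) fun i => hN i i.2
  have ex := Module.Flat.lTensor_exact (⨂[R] i : ({j}ᶜ : Set ι), N i) h
  have ef : TensorProduct.map (PiTensorProduct.map fun i : ({j}ᶜ : Set ι) => f i) (f j) =
      LinearMap.lTensor _ (f j) ∘ₗ (LinearEquiv.rTensor (M j) a).toLinearMap := by
    refine TensorProduct.ext' fun x y => rfl
  have eg : TensorProduct.map (PiTensorProduct.map fun i : ({j}ᶜ : Set ι) => g i) (g j) =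
      (LinearEquiv.rTensor (P j) b).toLinearMap ∘ₗ LinearMap.lTensor _ (g j) := by
    refine TensorProduct.ext' fun x y => rfl
  intro y
  rw [← (PiTensorProduct.equivPiTensorComplSingletonTensor R P j).map_eq_zero_iff,
    equivPiTensorComplSingletonTensor_map, eg, LinearMap.comp_apply, LinearEquiv.coe_coe,
    LinearEquiv.map_eq_zero_iff, ex]
  constructor
  · rintro ⟨x, hx⟩
    refine ⟨(PiTensorProduct.equivPiTensorComplSingletonTensor R M j).symm
      ((LinearEquiv.rTensor (M j) a).symm x), ?_⟩
    apply (PiTensorProduct.equivPiTensorComplSingletonTensor R N j).injective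
    rw [equivPiTensorComplSingletonTensor_map, ef, LinearEquiv.apply_symm_apply, ← hx]
    exact congrArg _ ((LinearEquiv.rTensor (M j) a).apply_symm_apply x)
  · rintro ⟨x, rfl⟩
    refine ⟨LinearEquiv.rTensor (M j) a (PiTensorProduct.equivPiTensorComplSingletonTensor R M j x), ?_⟩
    rw [equivPiTensorComplSingletonTensor_map, ef]
    rfl

lemma injective_piTensorProduct_map (j : ι) (f : ∀ i, M i →ₗ[R] N i)
    (hf : ∀ i ≠ j, Function.Bijective (f i)) (hM : ∀ i ≠ j, Module.Flat R (M i))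
    (h : Function.Injective (f j)) : Function.Injective (PiTensorProduct.map f) := by
  classical
  -- Injectivity is exactness after the family that is zero at `j` and the identity elsewhere; the
  -- tensor product of this family is zero.
  have := exact_piTensorProduct_map (M := M) j (fun i => if i = j then 0 else LinearMap.id) f
    (fun i hi => by simp only [hi, if_false]; exact Function.bijective_id) hf hM (by
      simp only [if_true]
      exact fun y => ⟨fun hy => ⟨0, (h (hy.trans (map_zero _).symm)).symm⟩,
        by rintro ⟨x, rfl⟩; exact map_zero _⟩)
  have h0 : PiTensorProduct.map (fun i => if i = j then 0 else LinearMap.id : ∀ i, M i →ₗ[R] M i) = 0 := by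
    refine PiTensorProduct.ext (MultilinearMap.ext fun x => ?_)
    rw [LinearMap.compMultilinearMap_apply, PiTensorProduct.map_tprod]
    exact MultilinearMap.map_coord_zero _ j (by simp)
  rw [h0] at this
  rw [injective_iff_map_eq_zero]
  intro x hx
  obtain ⟨y, rfl⟩ := (this x).1 hx
  rfl

lemma surjective_piTensorProduct_map (f : ∀ i, M i →ₗ[R] N i)
    (h : ∀ i, Function.Surjective (f i)) : Function.Surjective (PiTensorProduct.map f) := by
  intro y
  induction y using PiTensorProduct.induction_on with
  | smul_tprod r x =>
    choose y hy using fun i => h i (x i)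
    exact ⟨r • PiTensorProduct.tprod R y, by simp [PiTensorProduct.map_tprod, hy]⟩
  | add x y hx hy =>
    obtain ⟨x, rfl⟩ := hx
    obtain ⟨y, rfl⟩ := hy
    exact ⟨x + y, map_add _ _ _⟩

end PiTensor

end SteenrodTate

namespace SteenrodTate

/-! ### Tensor products of graded maps that need not be chain maps. -/

section GradedMaps

set_option linter.unusedSectionVars false

variable {R : Type u} [CommRing R] {ι : Type} [Fintype ι] [LinearOrder ι]
  {K K' K'' : ι → CochainComplex (ModuleCat.{u} R) ℤ}

/-- The map between the degree `n` parts of tensor products of complexes induced by families of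
linear maps `(K l).X a → (K' l).X a`, which need not commute with the differentials. -/
noncomputable def tensorGraded (φ : ∀ l a, (K l).X a →ₗ[R] (K' l).X a) (n : ℤ) :
    tensorX K n →ₗ[R] tensorX K' n :=
  DirectSum.lmap fun i => PiTensorProduct.map fun l => φ l (i.1 l)

lemma tensorGraded_incl (φ : ∀ l a, (K l).X a →ₗ[R] (K' l).X a) {n : ℤ} (i : ι → ℤ)
    (hi : ∑ l, i l = n) (x : ⨂[R] l, ((K l).X (i l) : Type u)) :
    tensorGraded φ n (incl K i hi x) = incl K' i hi (PiTensorProduct.map (fun l => φ l (i l)) x) :=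
  DirectSum.lmap_lof _ _ _

lemma tensorPermX_one_eq (φ : ∀ l, K l ⟶ K' l) (n : ℤ) :
    tensorPermX (1 : Equiv.Perm ι) φ n = tensorGraded (fun l a => ((φ l).f a).hom) n := by
  refine tensorX_hom_ext fun i hi x => ?_
  refine (tensorPermX_incl (K := K) (K' := K') (1 : Equiv.Perm ι) φ i hi x).trans ?_
  rw [koszulSign_one, Units.val_one, one_smul, tensorGraded_incl, PiTensorProduct.map_tprod]
  rfl

lemma tensorGraded_comp (φ : ∀ l a, (K l).X a →ₗ[R] (K' l).X a)
    (ψ : ∀ l a, (K' l).X a →ₗ[R] (K'' l).X a) (n : ℤ) :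
    tensorGraded ψ n ∘ₗ tensorGraded φ n = tensorGraded (fun l a => ψ l a ∘ₗ φ l a) n := by
  refine tensorX_hom_ext fun i hi x => ?_
  rw [LinearMap.comp_apply, tensorGraded_incl, tensorGraded_incl, tensorGraded_incl,
    PiTensorProduct.map_tprod, PiTensorProduct.map_tprod, PiTensorProduct.map_tprod]
  rfl

lemma tensorGraded_id (n : ℤ) :
    tensorGraded (fun l a => (LinearMap.id : (K l).X a →ₗ[R] (K l).X a)) n = LinearMap.id := by
  refine tensorX_hom_ext fun i hi x => ?_
  rw [tensorGraded_incl, PiTensorProduct.map_tprod]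
  rfl

lemma tensorGraded_eq_zero (φ : ∀ l a, (K l).X a →ₗ[R] (K' l).X a) (j : ι) (h : ∀ a, φ j a = 0)
    (n : ℤ) : tensorGraded φ n = 0 := by
  refine tensorX_hom_ext fun i hi x => ?_
  rw [tensorGraded_incl, PiTensorProduct.map_tprod,
    MultilinearMap.map_coord_zero (PiTensorProduct.tprod R) j (by rw [h]; rfl), map_zero]
  rfl

variable (f : ∀ l a, (K l).X a →ₗ[R] (K' l).X a) (g : ∀ l a, (K' l).X a →ₗ[R] (K'' l).X a) (j : ι)

lemma exact_tensorGraded (hf : ∀ l ≠ j, ∀ a, Function.Bijective (f l a))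
    (hg : ∀ l ≠ j, ∀ a, Function.Bijective (g l a))
    (hK : ∀ l ≠ j, ∀ a, Module.Flat R ((K' l).X a))
    (h : ∀ a, Function.Exact (f j a) (g j a)) (n : ℤ) :
    Function.Exact (tensorGraded f n) (tensorGraded g n) := by
  have ex (i : MultiDegree ι n) := exact_piTensorProduct_map j (fun l => f l (i.1 l))
    (fun l => g l (i.1 l)) (fun l hl => hf l hl _) (fun l hl => hg l hl _)
    (fun l hl => hK l hl _) (h _)
  intro y
  change y ∈ LinearMap.ker (tensorGraded g n) ↔ y ∈ LinearMap.range (tensorGraded f n)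
  have e1 := DirectSum.ker_lmap (fun i : MultiDegree ι n => PiTensorProduct.map fun l => g l (i.1 l))
  have e2 := DirectSum.range_lmap (fun i : MultiDegree ι n => PiTensorProduct.map fun l => f l (i.1 l))
  have e3 : LinearMap.ker (tensorGraded g n) = LinearMap.range (tensorGraded f n) := by
    refine e1.trans (Eq.trans ?_ e2.symm)
    congr 2
    funext i
    exact (ex i).linearMap_ker_eq
  rw [e3]

lemma injective_tensorGraded (hf : ∀ l ≠ j, ∀ a, Function.Bijective (f l a))
    (hK : ∀ l ≠ j, ∀ a, Module.Flat R ((K l).X a)) (h : ∀ a, Function.Injective (f j a)) (n : ℤ) :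
    Function.Injective (tensorGraded f n) :=
  (DirectSum.lmap_injective _).2 fun i => injective_piTensorProduct_map j (fun l => f l (i.1 l))
    (fun l hl => hf l hl _) (fun l hl => hK l hl _) (h _)

lemma surjective_tensorGraded (h : ∀ l a, Function.Surjective (f l a)) (n : ℤ) :
    Function.Surjective (tensorGraded f n) :=
  (DirectSum.lmap_surjective _).2 fun _ => surjective_piTensorProduct_map _ fun _ => h _ _

end GradedMaps

/-! ### Acyclicity of a tensor product with one acyclic factor and the others flat. -/

section Acyclic

set_option linter.unusedSectionVars false

variable {R : Type u} [CommRing R] {ι : Type} [Fintype ι] [LinearOrder ι]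
  (K : ι → CochainComplex (ModuleCat.{u} R) ℤ)

lemma tensorD_incl' {m n : ℤ} (h : m + 1 = n) (i : ι → ℤ) (hi : ∑ l, i l = m)
    (x : ⨂[R] l, ((K l).X (i l) : Type u)) :
    tensorD K m n (incl K i hi x) =
      ∑ j, ((leftSign i j : ℤˣ) : ℤ) • incl K (i + Pi.single j 1) (sum_add_single hi h j)
        (PiTensorProduct.map (fun l => (step (K l) (i l) ((i + Pi.single j 1 : ι → ℤ) l)).hom) x) := by
  rw [tensorD, dif_pos h, incl, DirectSum.toModule_lof, LinearMap.sum_apply]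
  rfl

/-- The tensors whose components of degree at least `k` in the `j`-th factor vanish. -/
def degreeLT (j : ι) (k n : ℤ) : Submodule R (tensorX K n) where
  carrier := {z | ∀ i : MultiDegree ι n, k ≤ i.1 j → z i = 0}
  add_mem' hx hy i hi := by rw [DirectSum.add_apply, hx i hi, hy i hi, add_zero]
  zero_mem' i hi := rfl
  smul_mem' r x hx i hi := by rw [DirectSum.smul_apply, hx i hi, smul_zero]

variable {K}

lemma incl_apply_self {n : ℤ} (i : MultiDegree ι n) (x : ⨂[R] l, ((K l).X (i.1 l) : Type u)) :
    incl K i.1 i.2 x i = x := by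
  unfold incl
  exact DFinsupp.single_eq_same

lemma tensorX_zsmul_apply {n : ℤ} (r : ℤ) (x : tensorX K n) (i : MultiDegree ι n) :
    (r • x) i = r • x i :=
  map_zsmul (DirectSum.component R _ (fun i : MultiDegree ι n => ⨂[R] l, ((K l).X (i.1 l) : Type u)) i) r x

lemma incl_apply_ne {n : ℤ} (i : ι → ℤ) (hi : ∑ l, i l = n) (i' : MultiDegree ι n) (h : i ≠ i'.1)
    (x : ⨂[R] l, ((K l).X (i l) : Type u)) : incl K i hi x i' = 0 :=
  DFinsupp.single_eq_of_ne fun h' => h (congrArg Subtype.val h'.symm)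

lemma incl_mem_degreeLT {n : ℤ} (i : ι → ℤ) (hi : ∑ l, i l = n) (j : ι) (k : ℤ) (h : i j < k)
    (x : ⨂[R] l, ((K l).X (i l) : Type u)) : incl K i hi x ∈ degreeLT K j k n :=
  fun i' hi' => incl_apply_ne i hi i' (by rintro rfl; lia) x

lemma sum_incl {n : ℤ} (z : tensorX K n)
    [∀ i : MultiDegree ι n, ∀ x : ⨂[R] l, ((K l).X (i.1 l) : Type u), Decidable (x ≠ 0)] :
    ∑ i ∈ DFinsupp.support z, incl K i.1 i.2 (z i) = z := by
  convert DirectSum.sum_support_of z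
  rfl

lemma incl_map_congr {n : ℤ} {i m m' : ι → ℤ} (h : m = m') (hm : ∑ l, m l = n) (hm' : ∑ l, m' l = n)
    (x : ⨂[R] l, ((K l).X (i l) : Type u)) :
    incl K m hm (PiTensorProduct.map (fun l => (step (K l) (i l) (m l)).hom) x) =
      incl K m' hm' (PiTensorProduct.map (fun l => (step (K l) (i l) (m' l)).hom) x) := by
  subst h; rfl

/-- The leading component of the differential of a tensor. -/
lemma tensorD_apply_leading {n n' : ℤ} (h : n + 1 = n') (j : ι) (k : ℤ) (z : tensorX K n)
    (hz : z ∈ degreeLT K j (k + 1) n) (i : MultiDegree ι n) (hi : i.1 j = k) :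
    tensorD K n n' z ⟨i.1 + Pi.single j 1, sum_add_single i.2 h j⟩ =
      ((leftSign i.1 j : ℤˣ) : ℤ) • PiTensorProduct.map
        (fun l => (step (K l) (i.1 l) ((i.1 + Pi.single j 1 : ι → ℤ) l)).hom) (z i) := by
  classical
  conv_lhs => rw [← sum_incl z]
  rw [map_sum, DFinsupp.finsetSum_apply]
  -- Any other contribution to the multi-degree `i + e_j` would come, through a factor `l ≠ j`, from
  -- a component of `z` of degree `k + 1` in the factor `j`, and there are none.
  have key (i' : MultiDegree ι n) (hi' : z i' ≠ 0) (l : ι) (hl : i'.1 + Pi.single l 1 =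
      i.1 + Pi.single j 1) : l = j ∧ i' = i := by
    have h1 : i'.1 j < k + 1 := by
      by_contra hc
      exact hi' (hz i' (not_lt.1 hc))
    have h2 := congrFun hl j
    rcases eq_or_ne l j with rfl | hlj
    · exact ⟨rfl, Subtype.ext (add_right_cancel hl)⟩
    · simp [hi, hlj.symm] at h2
      lia
  rw [Finset.sum_eq_single i]
  · rw [tensorD_incl' K h, DFinsupp.finsetSum_apply, Finset.sum_eq_single j]
    · rw [tensorX_zsmul_apply]
      congr 1
      exact incl_apply_self (K := K) (⟨i.1 + Pi.single j 1, sum_add_single i.2 h j⟩ : MultiDegree ι n') _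
    · intro l _ hl
      rw [tensorX_zsmul_apply]
      erw [incl_apply_ne]
      · exact zsmul_zero _
      · intro h'
        by_cases h0 : z i = 0
        · have := congrFun h' j
          simp [hl.symm] at this
        · exact hl (key i h0 l h').1
    · simp
  · intro i' hi' hne
    rw [tensorD_incl' K h, DFinsupp.finsetSum_apply]
    refine Finset.sum_eq_zero fun l _ => ?_
    rw [tensorX_zsmul_apply]
    erw [incl_apply_ne]
    · exact zsmul_zero _
    · intro h'
      exact hne (key i' (DFinsupp.mem_support_iff.1 hi') l h').2
  · intro h0
    rw [DFinsupp.notMem_support_iff.1 h0, map_zero, map_zero]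
    rfl

variable (j : ι) (hK : ∀ l ≠ j, ∀ a, Module.Flat R ((K l).X a)) (hj : (K j).Acyclic)

include hK hj

/-- On components of a fixed multi-degree, the differential of the factor `j` is `d` tensored with
flat modules, hence exact. A preimage `w` of `x` under it is a primitive of `x` up to the
differentials of the other factors, and these leave the degree in the factor `j` at `k - 1`. -/
lemma exists_leading_primitive {m n : ℤ} (h : m + 1 = n) (k : ℤ) (i : MultiDegree ι n) (hi : i.1 j = k)
    (x : ⨂[R] l, ((K l).X (i.1 l) : Type u))
    (hx : PiTensorProduct.map (fun l => (step (K l) (i.1 l)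
      ((i.1 + Pi.single j 1 : ι → ℤ) l)).hom) x = 0) :
    ∃ w : tensorX K m, incl K i.1 i.2 x - tensorD K m n w ∈ degreeLT K j k n := by
  let i' : ι → ℤ := i.1 - Pi.single j 1
  have hi' : ∑ l, i' l = m := by
    simp [i', Finset.sum_sub_distrib, i.2, ← h]
  have e : i' + Pi.single j 1 = i.1 := sub_add_cancel _ _
  have bij (a b : ℤ) (hab : a = b) (l : ι) : Function.Bijective (step (K l) a b).hom := by
    subst hab
    rw [step_self]
    exact Function.bijective_id
  have ex := exact_piTensorProduct_map (R := R) j (fun l => (step (K l) (i' l) (i.1 l)).hom)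
    (fun l => (step (K l) (i.1 l) ((i.1 + Pi.single j 1 : ι → ℤ) l)).hom)
    (fun l hl => bij _ _ (by simp [i', hl]) l) (fun l hl => bij _ _ (by simp [hl]) l)
    (fun l hl => hK l hl _) (by
      have h1 : i' j = i.1 j - 1 := by simp [i']
      have h2 : (i.1 + Pi.single j 1 : ι → ℤ) j = i.1 j + 1 := by simp
      rw [h1, h2, step_succ]
      have h3 : step (K j) (i.1 j - 1) (i.1 j) = (K j).d (i.1 j - 1) (i.1 j) := by
        simp [step]
      rw [h3]
      have := hj (i.1 j)
      rw [HomologicalComplex.exactAt_iff' _ (i.1 j - 1) (i.1 j) (i.1 j + 1) (by simp) (by simp)] at this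
      exact (ShortComplex.ShortExact.moduleCat_exact_iff_function_exact _).1 this)
  obtain ⟨w, hw⟩ := (ex x).1 hx
  refine ⟨((leftSign i' j : ℤˣ) : ℤ) • incl K i' hi' w, ?_⟩
  rw [map_zsmul, tensorD_incl' K h, ← Finset.add_sum_erase _ _ (Finset.mem_univ j), smul_add,
    smul_smul, Int.units_coe_mul_self, one_smul, incl_map_congr e _ i.2, hw, sub_add_cancel_left]
  refine neg_mem ?_
  have (y : tensorX K n) (hy : y ∈ degreeLT K j k n) (r : ℤ) : r • y ∈ degreeLT K j k n :=
    zsmul_mem hy r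
  refine this _ (sum_mem fun l hl => this _ (incl_mem_degreeLT _ _ _ _ ?_ _) _) _
  have : l ≠ j := Finset.ne_of_mem_erase hl
  simp [i', this.symm, hi]

lemma exists_primitive_mod {m n n' : ℤ} (h : m + 1 = n) (h' : n + 1 = n') (k : ℤ) (z : tensorX K n)
    (hz : z ∈ degreeLT K j (k + 1) n) (hd : tensorD K n n' z = 0) :
    ∃ w : tensorX K m, z - tensorD K m n w ∈ degreeLT K j k n := by
  classical
  have (i : MultiDegree ι n) : ∃ w : tensorX K m,
      incl K i.1 i.2 (z i) - tensorD K m n w ∈ degreeLT K j k n := by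
    rcases lt_trichotomy (i.1 j) k with hi | hi | hi
    · exact ⟨0, by simpa using incl_mem_degreeLT i.1 i.2 j k hi (z i)⟩
    · refine exists_leading_primitive j hK hj h k i hi _ ?_
      have := tensorD_apply_leading h' j k z hz i hi
      rw [hd] at this
      have h2 := congrArg (fun y => ((leftSign i.1 j : ℤˣ) : ℤ) • y) this
      simp only [smul_smul, Int.units_coe_mul_self, one_smul] at h2
      exact h2.symm.trans (zsmul_zero _)
    · refine ⟨0, ?_⟩
      rw [hz i hi]
      simp
  choose w hw using this
  refine ⟨∑ i ∈ DFinsupp.support z, w i, ?_⟩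
  conv => enter [2, 1]; rw [← sum_incl z]
  rw [map_sum, ← Finset.sum_sub_distrib]
  exact sum_mem fun i _ => hw i

/-- A cycle has finite support, so its degrees in the factor `j` are bounded above. Subtracting
boundaries lowers this bound one unit at a time, until it drops to the degree `a` below which the
factor `j` vanishes and nothing remains. -/
lemma acyclic_tensorComplex (a : ℤ) [(K j).IsStrictlyGE a] : (tensorComplex K).Acyclic := by
  classical
  intro n
  rw [HomologicalComplex.exactAt_iff' _ (n - 1) n (n + 1) (by simp) (by simp),
    ShortComplex.moduleCat_exact_iff]
  have key (N : ℕ) : ∀ z : tensorX K n, z ∈ degreeLT K j (a + N) n → tensorD K n (n + 1) z = 0 →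
      ∃ w : tensorX K (n - 1), tensorD K (n - 1) n w = z := by
    induction N with
    | zero =>
      intro z hz _
      refine ⟨0, ?_⟩
      rw [map_zero]
      refine (DFinsupp.ext fun i => ?_)
      by_cases hi : a ≤ i.1 j
      · exact (hz i (by simpa using hi)).symm
      · have h0 : IsZero ((K j).X (i.1 j)) := (K j).isZero_of_isStrictlyGE a _ (not_le.1 hi)
        have : Subsingleton ((K j).X (i.1 j)) := ModuleCat.isZero_iff_subsingleton.1 h0
        have : Subsingleton (⨂[R] l, ((K l).X (i.1 l) : Type u)) := by
          refine subsingleton_of_forall_eq 0 fun x => ?_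
          induction x using PiTensorProduct.induction_on with
          | smul_tprod r x =>
            rw [MultilinearMap.map_coord_zero (PiTensorProduct.tprod R) j (Subsingleton.elim _ _),
              smul_zero]
          | add x y hx hy => rw [hx, hy, add_zero]
        exact Subsingleton.elim _ _
    | succ N ih =>
      intro z hz hd
      obtain ⟨w, hw⟩ := exists_primitive_mod j hK hj (sub_add_cancel n 1) rfl (a + N) z
        (by rwa [add_assoc, ← Nat.cast_succ]) hd
      obtain ⟨w', hw'⟩ := ih _ hw (by
        rw [map_sub, hd, ← LinearMap.comp_apply, tensorD_comp_tensorD, LinearMap.zero_apply,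
          sub_zero])
      exact ⟨w' + w, by rw [map_add, hw', sub_add_cancel]⟩
  intro (z : tensorX K n) hz
  obtain ⟨N, hN⟩ : ∃ N : ℕ, z ∈ degreeLT K j (a + N) n := by
    obtain ⟨b, hb⟩ : ∃ b : ℤ, ∀ i ∈ DFinsupp.support z, i.1 j < b := by
      obtain ⟨b, hb⟩ := ((DFinsupp.support z).image fun i => i.1 j).exists_le
      exact ⟨b + 1, fun i hi => Int.lt_add_one_of_le (hb _ (Finset.mem_image_of_mem _ hi))⟩
    refine ⟨(b - a).toNat, fun i hi => ?_⟩
    by_contra hc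
    have := hb i (DFinsupp.mem_support_iff.2 hc)
    lia
  obtain ⟨w, hw⟩ := key N z hN hz
  exact ⟨w, hw⟩

end Acyclic

end SteenrodTate

namespace SteenrodTate

/-! ### Tensor products of quasi-isomorphisms. -/

section QuasiIso

variable {C : Type*} [Category* C] [Abelian C]

lemma quasiIso_of_shortExact_of_acyclic {S : ShortComplex (CochainComplex C ℤ)} (hS : S.ShortExact)
    (h : S.X₃.Acyclic) : QuasiIso S.f where
  quasiIsoAt i := by
    rw [quasiIsoAt_iff_isIso_homologyMap]
    have hz (n : ℤ) : IsZero (S.X₃.homology n) :=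
      (HomologicalComplex.exactAt_iff_isZero_homology _ _).1 (h n)
    have : Mono (HomologicalComplex.homologyMap S.f i) :=
      (hS.homology_exact₁ (i - 1) i (by simp)).mono_g ((hz _).eq_of_src _ _)
    have : Epi (HomologicalComplex.homologyMap S.f i) :=
      (hS.homology_exact₂ i).epi_f ((hz _).eq_of_tgt _ _)
    exact isIso_of_mono_of_epi _

instance mono_mappingCone_inr {K L : CochainComplex C ℤ} (f : K ⟶ L) :
    Mono (CochainComplex.mappingCone.inr f) where
  right_cancellation g h e := by
    ext n
    have := HomologicalComplex.congr_hom e n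
    have h2 := congrArg (fun x => x ≫ (CochainComplex.mappingCone.snd f).v n n (add_zero n)) this
    simpa using h2

lemma acyclic_mappingCone_id (K : CochainComplex C ℤ) :
    (CochainComplex.mappingCone (𝟙 K)).Acyclic := by
  intro n
  rw [HomologicalComplex.exactAt_iff_isZero_homology, IsZero.iff_id_eq_zero,
    ← HomologicalComplex.homologyMap_id]
  rw [(CochainComplex.mappingCone.homotopyToZeroOfId K).homologyMap_eq n]
  simp

lemma isStrictlyGE_of_epi {K L : CochainComplex C ℤ} (f : K ⟶ L) [Epi f] (a : ℤ)
    [K.IsStrictlyGE a] : L.IsStrictlyGE a := by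
  rw [CochainComplex.isStrictlyGE_iff]
  intro i hi
  exact (K.isZero_of_isStrictlyGE a i hi).of_epi (f.f i)

end QuasiIso

section TensorQuasiIso

variable {R : Type u} [CommRing R] {ι : Type} [Fintype ι] [LinearOrder ι]
  {K K' K'' : ι → CochainComplex (ModuleCat.{u} R) ℤ}

/-- The chain map between tensor products of complexes induced by chain maps of the factors. -/
noncomputable abbrev tensorMap (φ : ∀ l, K l ⟶ K' l) : tensorComplex K ⟶ tensorComplex K' :=
  tensorPerm (1 : Equiv.Perm ι) (K := K) (K' := K') φ

lemma tensorMap_f_hom (φ : ∀ l, K l ⟶ K' l) (n : ℤ) :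
    ((tensorMap φ).f n).hom = tensorGraded (fun l a => ((φ l).f a).hom) n :=
  tensorPermX_one_eq φ n

lemma tensorMap_comp (φ : ∀ l, K l ⟶ K' l) (ψ : ∀ l, K' l ⟶ K'' l) :
    tensorMap φ ≫ tensorMap ψ = tensorMap fun l => φ l ≫ ψ l :=
  (tensorPerm_mul 1 1 1 (mul_one 1).symm φ ψ (fun l => φ l ≫ ψ l) fun l =>
    (Category.id_comp (φ l ≫ ψ l)).symm).symm

lemma tensorMap_id : tensorMap (fun l => 𝟙 (K l)) = 𝟙 _ :=
  tensorPerm_one _ rfl _ fun _ => rfl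

lemma bijective_f_hom_of_isIso {K L : CochainComplex (ModuleCat.{u} R) ℤ} (f : K ⟶ L) [IsIso f]
    (a : ℤ) : Function.Bijective (f.f a).hom :=
  ConcreteCategory.bijective_of_isIso (f.f a)

lemma flat_of_isIso {K L : CochainComplex (ModuleCat.{u} R) ℤ} (f : K ⟶ L) [IsIso f] (a : ℤ)
    (h : Module.Flat R (K.X a)) : Module.Flat R (L.X a) :=
  Module.Flat.of_linearEquiv (LinearEquiv.ofBijective _ (bijective_f_hom_of_isIso f a)).symm

lemma tensorMap_comp_eq_zero (f : ∀ l, K l ⟶ K' l) (g : ∀ l, K' l ⟶ K'' l) (j : ι)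
    (h : f j ≫ g j = 0) : tensorMap f ≫ tensorMap g = 0 := by
  rw [tensorMap_comp]
  ext n : 2
  rw [tensorMap_f_hom]
  refine tensorGraded_eq_zero _ j (fun a => ?_) n
  rw [h]
  rfl

lemma shortExact_tensorMap (f : ∀ l, K l ⟶ K' l) (g : ∀ l, K' l ⟶ K'' l) (j : ι)
    (hf : ∀ l ≠ j, IsIso (f l)) (hg : ∀ l ≠ j, IsIso (g l))
    (hK : ∀ l ≠ j, ∀ a, Module.Flat R ((K' l).X a)) (w : f j ≫ g j = 0)
    (h : (ShortComplex.mk (f j) (g j) w).ShortExact) :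
    (ShortComplex.mk (tensorMap f) (tensorMap g) (tensorMap_comp_eq_zero f g j w)).ShortExact := by
  have hd (a : ℤ) := h.map_of_exact (HomologicalComplex.eval _ _ a)
  have bf (l) (hl : l ≠ j) (a : ℤ) : Function.Bijective ((f l).f a).hom :=
    have := hf l hl
    bijective_f_hom_of_isIso (f l) a
  have bg (l) (hl : l ≠ j) (a : ℤ) : Function.Bijective ((g l).f a).hom :=
    have := hg l hl
    bijective_f_hom_of_isIso (g l) a
  refine HomologicalComplex.shortExact_of_degreewise_shortExact _ fun n => ?_
  refine ModuleCat.shortComplex_shortExact _ ?_ ?_ ?_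
  · change Function.Exact ((tensorMap f).f n).hom ((tensorMap g).f n).hom
    rw [tensorMap_f_hom, tensorMap_f_hom]
    exact exact_tensorGraded _ _ j bf bg hK (fun a =>
      (ShortComplex.ShortExact.moduleCat_exact_iff_function_exact _).1 (hd a).exact) n
  · change Function.Injective ((tensorMap f).f n).hom
    rw [tensorMap_f_hom]
    exact injective_tensorGraded _ j bf (fun l hl a =>
      have := hK l hl a
      Module.Flat.of_linearEquiv (LinearEquiv.ofBijective _ (bf l hl a))) (fun a => (hd a).moduleCat_injective_f) n
  · change Function.Surjective ((tensorMap g).f n).hom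
    rw [tensorMap_f_hom]
    refine surjective_tensorGraded _ (fun l a => ?_) n
    by_cases hl : l = j
    · subst hl
      exact (hd a).moduleCat_surjective_g
    · exact (bg l hl a).surjective

/-- The cokernel of `φ j` is acyclic. Tensoring the sequence `K j → K' j → coker` with flat factors
keeps it exact, and the tensor product containing the cokernel is acyclic. -/
lemma quasiIso_tensorMap_of_mono (φ : ∀ l, K l ⟶ K' l) (j : ι) (hφ : ∀ l ≠ j, IsIso (φ l))
    (hK : ∀ l ≠ j, ∀ a, Module.Flat R ((K' l).X a)) [QuasiIso (φ j)] [Mono (φ j)] (a : ℤ)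
    [(K' j).IsStrictlyGE a] : QuasiIso (tensorMap φ) := by
  have (l : ι) : ∃ (L : CochainComplex (ModuleCat.{u} R) ℤ) (g : K' l ⟶ L), (l ≠ j → IsIso g) ∧
      (l = j → ∃ w, (ShortComplex.mk (φ l) g w).ShortExact) := by
    by_cases hl : l = j
    · subst hl
      exact ⟨_, cokernel.π (φ l), fun h => (h rfl).elim, fun _ => ⟨cokernel.condition _,
        { exact := ShortComplex.exact_cokernel _ }⟩⟩
    · exact ⟨_, 𝟙 _, fun _ => inferInstance, fun h => (hl h).elim⟩
  choose L g hg hw using this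
  obtain ⟨w, hw⟩ := hw j rfl
  have : Epi (g j) := hw.epi_g
  have : (L j).IsStrictlyGE a := isStrictlyGE_of_epi (g j) a
  exact quasiIso_of_shortExact_of_acyclic (shortExact_tensorMap φ g j hφ hg hK w hw)
    (acyclic_tensorComplex j (fun l hl b => have := hg l hl; flat_of_isIso (g l) b (hK l hl b))
      (hw.acyclic_X₃ inferInstance) a)

lemma quasiIso_biprod_inl {C : Type*} [Category* C] [Abelian C] (K L : CochainComplex C ℤ)
    (h : L.Acyclic) : QuasiIso (biprod.inl : K ⟶ K ⊞ L) :=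
  quasiIso_of_shortExact_of_acyclic (S := ShortComplex.mk (biprod.inl : K ⟶ K ⊞ L) biprod.snd
    (by simp)) (ShortComplex.Splitting.ofHasBinaryBiproduct K L).shortExact h

lemma isStrictlyGE_biprod {C : Type*} [Category* C] [Abelian C] (K L : CochainComplex C ℤ) (a : ℤ)
    [K.IsStrictlyGE a] [L.IsStrictlyGE a] : (K ⊞ L).IsStrictlyGE a := by
  rw [CochainComplex.isStrictlyGE_iff]
  intro i hi
  have := ((ShortComplex.Splitting.ofHasBinaryBiproduct K L).shortExact.map_of_exact
    (HomologicalComplex.eval _ _ i)).exact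
  exact this.isZero_of_both_zeros ((K.isZero_of_isStrictlyGE a i hi).eq_of_src _ _)
    ((L.isZero_of_isStrictlyGE a i hi).eq_of_tgt _ _)

lemma isStrictlyGE_mappingCone {C : Type*} [Category* C] [Abelian C] {K L : CochainComplex C ℤ}
    (f : K ⟶ L) (a b : ℤ) (h : b + 1 ≤ a) (h' : b ≤ a) [K.IsStrictlyGE a] [L.IsStrictlyGE a] :
    (CochainComplex.mappingCone f).IsStrictlyGE b := by
  rw [CochainComplex.isStrictlyGE_iff]
  intro i hi
  rw [CochainComplex.mappingCone.isZero_X_iff]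
  exact ⟨K.isZero_of_isStrictlyGE a _ (by lia), L.isZero_of_isStrictlyGE a _ (by lia)⟩

lemma quasiIso_tensorMap_of_isIso (φ : ∀ l, K l ⟶ K' l) (j : ι) (hφ : ∀ l ≠ j, IsIso (φ l))
    (hK : ∀ l ≠ j, ∀ a, Module.Flat R ((K l).X a)) [QuasiIso (φ j)] (a : ℤ)
    [(K j).IsStrictlyGE a] [(K' j).IsStrictlyGE a] : QuasiIso (tensorMap φ) := by
  -- To reduce to a monomorphism, `φ j` is factored as `K → K' ⊞ cone (id_K) → K'`. Nothing is added
  -- in the other factors. The cone begins one degree earlier, hence the bound `a - 1`.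
  have (l : ι) : ∃ (E : CochainComplex (ModuleCat.{u} R) ℤ) (ε : K l ⟶ E), (l ≠ j → IsZero E) ∧
      (l = j → Mono ε ∧ E.Acyclic ∧ E.IsStrictlyGE (a - 1)) := by
    by_cases hl : l = j
    · subst hl
      exact ⟨_, CochainComplex.mappingCone.inr (𝟙 (K l)), fun h => (h rfl).elim, fun _ =>
        ⟨inferInstance, acyclic_mappingCone_id _, isStrictlyGE_mappingCone _ a _ (by lia) (by lia)⟩⟩
    · exact ⟨_, (0 : K l ⟶ (HasZeroObject.zero' (CochainComplex (ModuleCat.{u} R) ℤ)).zero),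
        fun _ => isZero_zero _, fun h => (hl h).elim⟩
  choose E ε hE hj using this
  obtain ⟨_, hac, _⟩ := hj j rfl
  have isoinl (l) (hl : l ≠ j) : IsIso (biprod.inl : K' l ⟶ K' l ⊞ E l) :=
    ⟨biprod.fst, by simp, by
      refine biprod.hom_ext' _ _ ?_ ?_
      · simp
      · exact (hE l hl).eq_of_src _ _⟩
  have isofst (l) (hl : l ≠ j) : IsIso (biprod.fst : K' l ⊞ E l ⟶ K' l) := by
    have := isoinl l hl
    exact IsIso.of_isIso_fac_left (biprod.inl_fst (X := K' l) (Y := E l))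
  have isolift (l) (hl : l ≠ j) : IsIso (biprod.lift (φ l) (ε l)) := by
    have := isofst l hl
    have := hφ l hl
    exact IsIso.of_isIso_fac_right (biprod.lift_fst (φ l) (ε l))
  have hK' (l) (hl : l ≠ j) (b : ℤ) : Module.Flat R ((K' l ⊞ E l : CochainComplex _ ℤ).X b) :=
    have := isolift l hl
    flat_of_isIso (biprod.lift (φ l) (ε l)) b (hK l hl b)
  have q1 := quasiIso_biprod_inl (K' j) (E j) hac
  have q2 : QuasiIso (biprod.fst : K' j ⊞ E j ⟶ K' j) := by
    have : QuasiIso ((biprod.inl : K' j ⟶ K' j ⊞ E j) ≫ biprod.fst) := by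
      rw [biprod.inl_fst]; infer_instance
    exact quasiIso_of_comp_left biprod.inl _
  have q3 : QuasiIso (biprod.lift (φ j) (ε j)) := by
    have : QuasiIso (biprod.lift (φ j) (ε j) ≫ biprod.fst) := by
      rw [biprod.lift_fst]; infer_instance
    exact quasiIso_of_comp_right _ biprod.fst
  have : Mono (biprod.lift (φ j) (ε j)) := by
    have : Mono (biprod.lift (φ j) (ε j) ≫ biprod.snd) := by
      rw [biprod.lift_snd]; infer_instance
    exact mono_of_mono _ biprod.snd
  have : (K' j).IsStrictlyGE (a - 1) := (K' j).isStrictlyGE_of_ge _ a (by lia)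
  have := isStrictlyGE_biprod (K' j) (E j) (a - 1)
  have t1 : QuasiIso (tensorMap fun l => biprod.lift (φ l) (ε l)) :=
    quasiIso_tensorMap_of_mono _ j isolift hK' (a - 1)
  have t2 : QuasiIso (tensorMap fun l => (biprod.inl : K' l ⟶ K' l ⊞ E l)) :=
    quasiIso_tensorMap_of_mono _ j isoinl hK' (a - 1)
  -- The projection is not a monomorphism, but it is a left inverse of the inclusion, to which the
  -- monomorphism case applies.
  have t3 : QuasiIso (tensorMap fun l => (biprod.fst : K' l ⊞ E l ⟶ K' l)) := by
    have : QuasiIso ((tensorMap fun l => (biprod.inl : K' l ⟶ K' l ⊞ E l)) ≫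
        tensorMap fun l => (biprod.fst : K' l ⊞ E l ⟶ K' l)) := by
      rw [tensorMap_comp]
      simp only [biprod.inl_fst]
      rw [tensorMap_id]
      infer_instance
    exact quasiIso_of_comp_left (tensorMap fun l => (biprod.inl : K' l ⟶ K' l ⊞ E l)) _
  have e : tensorMap φ = (tensorMap fun l => biprod.lift (φ l) (ε l)) ≫
      tensorMap fun l => (biprod.fst : K' l ⊞ E l ⟶ K' l) := by
    rw [tensorMap_comp]
    simp only [biprod.lift_fst]
  rw [e]
  infer_instance

/-- The tensor product of quasi-isomorphisms between bounded below complexes of flat modules is a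
quasi-isomorphism. -/
lemma quasiIso_tensorMap (φ : ∀ l, K l ⟶ K' l) (hφ : ∀ l, QuasiIso (φ l))
    (hK : ∀ l a, Module.Flat R ((K l).X a)) (hK' : ∀ l a, Module.Flat R ((K' l).X a)) (a : ℤ)
    (ha : ∀ l, (K l).IsStrictlyGE a) (ha' : ∀ l, (K' l).IsStrictlyGE a) :
    QuasiIso (tensorMap φ) := by
  classical
  -- Induction on a set `s` of factors outside which every `φ l` is an isomorphism.
  suffices H : ∀ (s : Finset ι) (K K' : ι → CochainComplex (ModuleCat.{u} R) ℤ)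
      (φ : ∀ l, K l ⟶ K' l) (_ : ∀ l, QuasiIso (φ l)) (_ : ∀ l ∉ s, IsIso (φ l))
      (_ : ∀ l a, Module.Flat R ((K l).X a)) (_ : ∀ l a, Module.Flat R ((K' l).X a))
      (_ : ∀ l, (K l).IsStrictlyGE a) (_ : ∀ l, (K' l).IsStrictlyGE a), QuasiIso (tensorMap φ) from
    H Finset.univ K K' φ hφ (fun l hl => (hl (Finset.mem_univ l)).elim) hK hK' ha ha'
  clear hφ hK hK' ha ha' φ
  intro s
  induction s using Finset.induction_on with
  | empty =>
    intro K K' φ _ hφ _ _ _ _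
    have hi (l) : IsIso (φ l) := hφ l (Finset.notMem_empty l)
    have : IsIso (tensorMap φ) := ⟨tensorMap fun l => inv (φ l), by
      rw [tensorMap_comp]; simp only [IsIso.hom_inv_id, tensorMap_id], by
      rw [tensorMap_comp]; simp only [IsIso.inv_hom_id, tensorMap_id]⟩
    infer_instance
  | insert j s hj ih =>
    intro K K' φ hφ hs hK hK' ha ha'
    -- The family is factored as `α` followed by `β`, where `α` changes only the factor `j`, and `β`
    -- is an isomorphism outside `s`.
    have (l : ι) : ∃ (L : CochainComplex (ModuleCat.{u} R) ℤ) (α : K l ⟶ L) (β : L ⟶ K' l),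
        α ≫ β = φ l ∧ (l ≠ j → IsIso α) ∧ (l ∉ s → IsIso β) ∧ QuasiIso α ∧ QuasiIso β ∧
        (∀ a, Module.Flat R (L.X a)) ∧ L.IsStrictlyGE a := by
      by_cases hl : l = j
      · exact ⟨K' l, φ l, 𝟙 _, Category.comp_id _, fun h => (h hl).elim, fun _ => inferInstance,
          hφ l, inferInstance, hK' l, ha' l⟩
      · refine ⟨K l, 𝟙 _, φ l, Category.id_comp _, fun _ => inferInstance, fun h => hs l ?_,
          inferInstance, hφ l, hK l, ha l⟩
        simp [hl, h]
    choose L α β hαβ hα hβ qα qβ hL hLa using this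
    have e : tensorMap φ = tensorMap α ≫ tensorMap β := by
      rw [tensorMap_comp]
      congr 1
      funext l
      exact (hαβ l).symm
    have h1 : QuasiIso (tensorMap β) := ih _ _ β qβ hβ hL hK' hLa ha'
    have h2 : QuasiIso (tensorMap α) :=
      quasiIso_tensorMap_of_isIso α j hα (fun l _ b => hK l b) a
    rw [e]
    infer_instance

end TensorQuasiIso

end SteenrodTate

namespace SteenrodTate

/-! ### Points of the equivariant site. -/

section Points

variable {G : Type} {Y : Type u} [Group G] [TopologicalSpace Y] [MulAction G Y]
  [ContinuousConstSMul G Y]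

namespace EqOpens

/-- The inclusion of an open set into a larger one. -/
def homOfLE {U V : EqOpens G Y} (h : U.opens ≤ V.opens) : U ⟶ V :=
  ⟨1, fun y hy => by rw [one_smul]; exact h hy⟩

/-- The translation `g⁻¹ U ⟶ U`. -/
def preimage (U : EqOpens G Y) (g : G) : EqOpens G Y :=
  ⟨⟨(fun y => g • y) ⁻¹' U.opens, U.opens.isOpen.preimage (continuous_const_smul g)⟩⟩

/-- The functor which sends `U` to the set of all `g` such that `g • y ∈ U`. -/
def fiber (y : Y) : EqOpens G Y ⥤ Type u where
  obj U := ULift.{u} {g : G // g • y ∈ U.opens}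
  map {U V} h := ↾fun (g : ULift.{u} {g : G // g • y ∈ U.opens}) =>
    ULift.up ⟨h.g * g.down.1, by rw [mul_smul]; exact h.mapsTo _ g.down.2⟩
  map_id U := by
    ext ⟨g, hg⟩
    simp
  map_comp h h' := by
    ext ⟨g, hg⟩
    simp [mul_assoc]

/-- The point of the site of equivariant open sets which is attached to a point of the space. -/
def point (y : Y) : GrothendieckTopology.Point.{u} (topology G Y) where
  fiber := fiber y
  isCofiltered :=
    { nonempty := ⟨⟨⟨⊤⟩, ⟨⟨1, trivial⟩⟩⟩⟩
      cone_objs := by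
        rintro ⟨U, ⟨⟨g, hg⟩⟩⟩ ⟨V, ⟨⟨h, hh⟩⟩⟩
        refine ⟨⟨⟨(U.preimage g).opens ⊓ (V.preimage h).opens⟩, ⟨⟨1, ?_⟩⟩⟩,
          ⟨⟨g, fun x hx => hx.1⟩, ?_⟩, ⟨⟨h, fun x hx => hx.2⟩, ?_⟩, ⟨⟩⟩
        · rw [one_smul]; exact ⟨hg, hh⟩
        · exact congrArg ULift.up (Subtype.ext (mul_one _))
        · exact congrArg ULift.up (Subtype.ext (mul_one _))
      cone_maps := by
        rintro ⟨U, ⟨⟨g, hg⟩⟩⟩ ⟨V, ⟨⟨h, hh⟩⟩⟩ ⟨f, hf⟩ ⟨f', hf'⟩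
        refine ⟨_, 𝟙 _, ?_⟩
        have e : f.g * g = f'.g * g :=
          (congrArg (fun x => x.down.1) hf).trans (congrArg (fun x => x.down.1) hf').symm
        have : f = f' := Hom.ext (mul_right_cancel e)
        subst this
        rfl }
  initiallySmall := initiallySmall_of_essentiallySmall _
  jointly_surjective := by
    rintro U R hR ⟨⟨g, hg⟩⟩
    obtain ⟨V, f, z, hf, hz, e⟩ := hR _ hg
    refine ⟨V, f, hf, ⟨⟨f.g⁻¹ * g, ?_⟩⟩, ?_⟩
    · rwa [mul_smul, ← e, inv_smul_smul]
    · exact congrArg ULift.up (Subtype.ext (mul_inv_cancel_left _ _))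

variable (G Y) in
/-- The family of all points attached to the points of the space. -/
def points : ObjectProperty (GrothendieckTopology.Point.{u} (topology G Y)) :=
  ObjectProperty.ofObj point

/-- A lift to `S` of the element `1` of the fibre at `y` consists of `f : V ⟶ U` in `S` and `g` with
`g • y ∈ V` and `f.g * g = 1`; so `y` is the translate by `f.g` of a point of `V`, as the topology
demands. -/
lemma isConservativeFamilyOfPoints_points : (points G Y).IsConservativeFamilyOfPoints :=
  .mk' (fun U S hS y hy => by
    obtain ⟨V, f, hf, ⟨⟨g, hg⟩⟩, e⟩ := hS ⟨_, ⟨y⟩⟩ (ULift.up ⟨1, by rwa [one_smul]⟩)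
    refine ⟨V, f, g • y, hf, hg, ?_⟩
    have : f.g * g = 1 := congrArg (fun x => x.down.1) e
    rw [smul_smul, this, one_smul])

end EqOpens

end Points

/-! ### Detecting quasi-isomorphisms on stalks. -/

section QuasiIso

variable {C : Type u} [Category.{u} C] {J : GrothendieckTopology C} {R : Type u} [CommRing R]

lemma quasiIso_mapHomologicalComplex_map_iff {A B : Type*} [Category* A] [Category* B] [Abelian A] [Abelian B]
    (F : A ⥤ B) [F.Additive] [PreservesFiniteLimits F] [PreservesFiniteColimits F]
    {K L : CochainComplex A ℤ} (f : K ⟶ L) :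
    QuasiIso ((F.mapHomologicalComplex _).map f) ↔
      ∀ i, IsIso (F.map (HomologicalComplex.homologyMap f i)) := by
  have key (i : ℤ) : QuasiIsoAt ((F.mapHomologicalComplex _).map f) i ↔
      IsIso (F.map (HomologicalComplex.homologyMap f i)) := by
    rw [quasiIsoAt_iff_isIso_homologyMap]
    exact ((MorphismProperty.isomorphisms _).arrow_mk_iso_iff
      (Arrow.isoMk ((K.sc i).mapHomologyIso F) ((L.sc i).mapHomologyIso F)
        (ShortComplex.mapHomologyIso_hom_naturality
          ((HomologicalComplex.shortComplexFunctor A _ i).map f) F).symm))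
  exact ⟨fun h i => (key i).1 (h.quasiIsoAt i), fun h => ⟨fun i => (key i).2 (h i)⟩⟩

instance [HasSheafify J (ModuleCat.{u} R)] (Φ : GrothendieckTopology.Point.{u} J) :
    (Φ.presheafFiber (A := ModuleCat.{u} R)).Additive where
  map_add {P Q f g} := by
    refine Φ.presheafFiber_hom_ext fun X x => ?_
    rw [Φ.toPresheafFiber_naturality, Preadditive.comp_add, Φ.toPresheafFiber_naturality,
      Φ.toPresheafFiber_naturality]
    exact Preadditive.add_comp _ _ _ _ _ _

instance (Φ : GrothendieckTopology.Point.{u} J) :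
    (Φ.sheafFiber (A := ModuleCat.{u} R)).Additive :=
  Functor.additive_of_preserves_binary_products _

end QuasiIso

end SteenrodTate

namespace SteenrodTate

section Conservative

variable {C : Type u} [Category.{u} C] {J : GrothendieckTopology C} {R : Type u} [CommRing R]

/-- Sheafification and the fibre functors are exact, so they commute with homology; moreover a
sheafification has the same stalks as the presheaf, so the test can be made before sheafifying. -/
lemma quasiIso_presheafToSheaf_map [HasSheafify J (ModuleCat.{u} R)]
    [J.HasSheafCompose (forget (ModuleCat.{u} R))]
    {P : ObjectProperty (GrothendieckTopology.Point.{u} J)} (hP : P.IsConservativeFamilyOfPoints)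
    {K L : CochainComplex (Cᵒᵖ ⥤ ModuleCat.{u} R) ℤ} (f : K ⟶ L)
    (h : ∀ Φ, P Φ → QuasiIso ((Φ.presheafFiber.mapHomologicalComplex _).map f)) :
    QuasiIso (((presheafToSheaf J (ModuleCat.{u} R)).mapHomologicalComplex _).map f) := by
  rw [quasiIso_mapHomologicalComplex_map_iff]
  intro i
  rw [(hP.jointlyReflectIsomorphisms (ModuleCat.{u} R)).isIso_iff]
  rintro ⟨Φ, hΦ⟩
  have := (quasiIso_mapHomologicalComplex_map_iff Φ.presheafFiber f).1 (h Φ hΦ) i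
  exact ((MorphismProperty.isomorphisms (ModuleCat.{u} R)).arrow_mk_iso_iff
      (((Functor.mapArrowFunctor _ _).mapIso
        (Φ.presheafToSheafCompSheafFiberIso (ModuleCat.{u} R))).app
          (Arrow.mk (HomologicalComplex.homologyMap f i)))).2 this

end Conservative

/-! ### Multilinear maps out of filtered colimits. -/

section Multilinear

/-- The value on a tuple of germs is computed on any representative. Lifting two tuples at a common
stage is exactly what additivity in one variable needs, since the two tuples then differ in that
variable only. -/
lemma exists_multilinearMap_of_germs {R : Type*} [CommRing R] {ι : Type*} [DecidableEq ι] {I : Type*}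
    {N : I → ι → Type*} {M : ι → Type*} {T : Type*} [∀ U l, AddCommGroup (N U l)]
    [∀ U l, Module R (N U l)] [∀ l, AddCommGroup (M l)] [∀ l, Module R (M l)] [AddCommGroup T]
    [Module R T] (γ : ∀ U l, N U l →ₗ[R] M l) (μ : ∀ U, MultilinearMap R (N U) T)
    (h2 : ∀ x x' : ∀ l, M l, ∃ U, ∃ s s' : ∀ l, N U l, (∀ l, γ U l (s l) = x l) ∧
      ∀ l, γ U l (s' l) = x' l)
    (hμ : ∀ U U' s s', (∀ l, γ U l (s l) = γ U' l (s' l)) → μ U s = μ U' s') :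
    ∃ m : MultilinearMap R M T, ∀ U s, m (fun l => γ U l (s l)) = μ U s := by
  choose V t _ ht _ using fun x => h2 x x
  have key (U) (s : ∀ l, N U l) (x : ∀ l, M l) (hx : ∀ l, γ U l (s l) = x l) :
      μ (V x) (t x) = μ U s := hμ _ _ _ _ fun l => (ht x l).trans (hx l).symm
  have upd {U} (s : ∀ l, N U l) (x : ∀ l, M l) (j) (a : N U j) (b : M j)
      (hs : ∀ l ≠ j, γ U l (s l) = x l) (hb : γ U j a = b) (l) :
      γ U l (Function.update s j a l) = Function.update x j b l := by
    rcases eq_or_ne l j with rfl | hl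
    · simpa using hb
    · simpa [hl] using hs l hl
  refine ⟨MultilinearMap.mk' (fun x => μ (V x) (t x)) ?_ ?_, fun U s => key U s _ fun _ => rfl⟩
  · intro x j a b
    obtain ⟨U, s, s', hs, hs'⟩ := h2 (Function.update x j a) (Function.update x j b)
    have e (l) (hl : l ≠ j) : γ U l (s l) = x l := by simpa [hl] using hs l
    have ea : γ U j (s j) = a := by simpa using hs j
    have eb : γ U j (s' j) = b := by simpa using hs' j
    rw [key U _ _ (upd s x j (s j + s' j) (a + b) e (by rw [map_add, ea, eb])),
      key U _ _ (upd s x j (s j) a e ea), key U _ _ (upd s x j (s' j) b e eb),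
      MultilinearMap.map_update_add]
  · intro x j r a
    obtain ⟨U, s, s', hs, hs'⟩ := h2 (Function.update x j a) (Function.update x j a)
    have e (l) (hl : l ≠ j) : γ U l (s l) = x l := by simpa [hl] using hs l
    have ea : γ U j (s j) = a := by simpa using hs j
    rw [key U _ _ (upd s x j (r • s j) (r • a) e (by rw [map_smul, ea])),
      key U _ _ (upd s x j (s j) a e ea), MultilinearMap.map_update_smul]

end Multilinear

/-! ### The comparison map for the stalks of an external tensor power. -/

section Stalks

variable {R : Type u} [CommRing R] {X : TopCat.{u}} {p : ℕ} [NeZero p]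

lemma tensorPerm_eq_tensorMap {ι : Type} [Fintype ι] [LinearOrder ι]
    {K K' : ι → CochainComplex (ModuleCat.{u} R) ℤ} (e : Equiv.Perm ι) (he : e = 1)
    (φ : ∀ l, K (e l) ⟶ K' l) (ψ : ∀ l, K l ⟶ K' l)
    (h : ∀ l, φ l = eqToHom (by rw [he]; rfl) ≫ ψ l) : tensorPerm e φ = tensorMap ψ := by
  subst he
  congr 1
  funext l
  rw [h]
  exact Category.id_comp _

/-- The point of the site of open sets attached to a point `x` of `X`. -/
abbrev pt (x : X) : GrothendieckTopology.Point.{u} (Opens.grothendieckTopology X) :=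
  Opens.pointGrothendieckTopology x

/-- The stalk functor on complexes of sheaves. -/
noncomputable abbrev stalkComplex (x : X) :
    CochainComplex (Sh R X) ℤ ⥤ CochainComplex (ModuleCat.{u} R) ℤ :=
  ((pt x).sheafFiber (A := ModuleCat.{u} R)).mapHomologicalComplex _

/-- The map from sections to the stalk. -/
noncomputable def germ (x : X) (U : Opens X) (hx : x ∈ U) :
    (sectionsComplex (R := R) X).obj (op U) ⟶ stalkComplex x :=
  NatTrans.mapHomologicalComplex
    (Functor.whiskerLeft (sheafToPresheaf _ _) ((pt x).toPresheafFiberNatTrans U ⟨⟨hx⟩⟩)) _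

lemma map_germ (x : X) {U V : Opens X} (h : V ≤ U) (hx : x ∈ V) :
    (sectionsComplex (R := R) X).map (homOfLE h).op ≫ germ x V hx = germ x U (h hx) := by
  ext A n : 3
  exact (pt x).toPresheafFiber_w (homOfLE h) ⟨⟨hx⟩⟩ (A.X n).obj

lemma eqToHom_germ (x : X) {U V : Opens X} (h : U = V) (hx : x ∈ V)
    (A : CochainComplex (Sh R X) ℤ) :
    eqToHom (by rw [h]) ≫ (germ x V hx).app A = (germ x U (h ▸ hx)).app A := by
  subst h
  exact Category.id_comp _

lemma proj_mono {U V : EqOpens (Mu p) (MuPower p X)} (h : V.opens ≤ U.opens) (l : Fin p) :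
    proj V l ≤ proj U l := Set.image_mono h

/-- The coordinates of a point of `X ^ μ_p`. -/
def coord (y : MuPower p X) (l : Fin p) : X := y l

lemma mem_proj {y : MuPower p X} {U : EqOpens (Mu p) (MuPower p X)} (h : y ∈ U.opens) (l : Fin p) :
    coord y l ∈ proj U l := ⟨y, h, rfl⟩

lemma mem_proj_rotation {y : MuPower p X} {U : EqOpens (Mu p) (MuPower p X)} (g : Mu p)
    (h : g • y ∈ U.opens) (l : Fin p) : coord y l ∈ proj U (rotation g l) := by
  refine ⟨g • y, h, ?_⟩
  change coord y (l + -g.toAdd + g.toAdd) = coord y l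
  rw [neg_add_cancel_right]

lemma tensorPresheaf_map_homOfLE (A : CochainComplex (Sh R X) ℤ)
    {U V : EqOpens (Mu p) (MuPower p X)} (h : V.opens ≤ U.opens) :
    (tensorPresheaf p A).map (EqOpens.homOfLE h).op =
      tensorMap fun l => ((sectionsComplex X).map (homOfLE (proj_mono h l)).op).app A := by
  refine tensorPerm_eq_tensorMap _ rotation_one _ _ fun l => ?_
  have e : proj U (rotation (1 : Mu p) l) = proj U l := by rw [rotation_one]; rfl
  rw [← sectionsComplex_map_eq A (congrArg op e) (eqToHom (congrArg op e)), ← NatTrans.comp_app,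
    ← Functor.map_comp]
  rfl

/-- The complex of presheaves `U ↦ ⨂ l, A (pr l (U))`. -/
noncomputable abbrev tensorPsh (p : ℕ) [NeZero p] (A : CochainComplex (Sh R X) ℤ) :
    CochainComplex (EqPsh R p (MuPower p X)) ℤ :=
  (complexOfFunctor _ _).obj (tensorPresheaf p A)

/-- The map from sections over `U` of the external tensor power to the tensor product of stalks. -/
noncomputable def tensorGerm (y : MuPower p X) (A : CochainComplex (Sh R X) ℤ)
    (U : EqOpens (Mu p) (MuPower p X)) (g : Mu p) (hg : g • y ∈ U.opens) :
    (tensorPresheaf p A).obj (op U) ⟶ tensorComplex fun l => (stalkComplex (coord y l)).obj A :=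
  tensorPerm (rotation g) fun l =>
    (germ (coord y l) (proj U (rotation g l)) (mem_proj_rotation g hg l)).app A

lemma tensorGerm_one (y : MuPower p X) (A : CochainComplex (Sh R X) ℤ)
    (U : EqOpens (Mu p) (MuPower p X)) (hg : (1 : Mu p) • y ∈ U.opens) (h : y ∈ U.opens) :
    tensorGerm y A U 1 hg = tensorMap fun l => (germ (coord y l) (proj U l) (mem_proj h l)).app A := by
  refine tensorPerm_eq_tensorMap _ rotation_one _ _ fun l => ?_
  exact (eqToHom_germ (coord y l) (by rw [rotation_one]; rfl) (mem_proj h l) A).symm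

lemma map_tensorGerm (y : MuPower p X) (A : CochainComplex (Sh R X) ℤ)
    {U V : EqOpens (Mu p) (MuPower p X)} (f : U ⟶ V) (g : Mu p) (hg : g • y ∈ U.opens) :
    (tensorPresheaf p A).map f.op ≫ tensorGerm y A U g hg = tensorGerm y A V (f.g * g)
      (by rw [mul_smul]; exact f.mapsTo _ hg) := by
  refine (tensorPerm_mul _ _ _ (rotation_mul f.g g) _ _ _ fun l => ?_).symm
  have e : proj V (rotation (f.g * g) l) = proj V (rotation f.g (rotation g l)) := by
    rw [rotation_mul]; rfl
  have hm : coord y l ∈ proj V (rotation f.g (rotation g l)) :=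
    proj_le f _ (mem_proj_rotation g hg l)
  refine (eqToHom_germ (coord y l) e hm A).symm.trans ?_
  congr 1
  exact (congr_app (map_germ (R := R) (coord y l) (proj_le f (rotation g l))
    (mem_proj_rotation g hg l)) A).symm

/-- The comparison map from the stalk of the external tensor power to the tensor product of
stalks. -/
noncomputable def tensorStalkMap (y : MuPower p X) (A : CochainComplex (Sh R X) ℤ) :
    (((EqOpens.point y).presheafFiber (A := ModuleCat.{u} R)).mapHomologicalComplex _).obj
      (tensorPsh p A) ⟶ tensorComplex fun l => (stalkComplex (coord y l)).obj A where
  f n := (EqOpens.point y).presheafFiberDesc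
    (fun U g => (tensorGerm y A U g.down.1 g.down.2).f n)
    (fun U V f g => HomologicalComplex.congr_hom (map_tensorGerm y A f g.down.1 g.down.2) n)
  comm' m n _ := by
    refine (EqOpens.point y).presheafFiber_hom_ext fun U g => ?_
    have e (n : ℤ) := (EqOpens.point y).toPresheafFiber_presheafFiberDesc (P := (tensorPsh p A).X n)
      (fun U g => (tensorGerm y A U g.down.1 g.down.2).f n)
      (fun U V f g => HomologicalComplex.congr_hom (map_tensorGerm y A f g.down.1 g.down.2) n) U g
    refine ((Category.assoc _ _ _).symm.trans (congrArg (· ≫ _) (e m))).trans ?_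
    refine Eq.trans ?_ ((EqOpens.point y).toPresheafFiber_naturality_assoc
      ((tensorPsh p A).d m n) _ _ _).symm
    exact ((tensorGerm y A U g.down.1 g.down.2).comm m n).trans (congrArg (_ ≫ ·) (e n)).symm

lemma toPresheafFiber_tensorStalkMap (y : MuPower p X) (A : CochainComplex (Sh R X) ℤ) (n : ℤ)
    (U : EqOpens (Mu p) (MuPower p X)) (g : (EqOpens.point y).fiber.obj U) :
    (EqOpens.point y).toPresheafFiber U g ((tensorPsh p A).X n) ≫ (tensorStalkMap y A).f n =
      (tensorGerm y A U g.down.1 g.down.2).f n :=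
  (EqOpens.point y).toPresheafFiber_presheafFiberDesc (P := (tensorPsh p A).X n)
    (fun U g => (tensorGerm y A U g.down.1 g.down.2).f n)
    (fun _ _ f g => HomologicalComplex.congr_hom (map_tensorGerm y A f g.down.1 g.down.2) n) U g

lemma tensorStalkMap_naturality (y : MuPower p X) {A B : CochainComplex (Sh R X) ℤ} (f : A ⟶ B) :
    (((EqOpens.point y).presheafFiber (A := ModuleCat.{u} R)).mapHomologicalComplex _).map
      ((complexOfFunctor _ _).map ((tensorPresheafFunctor R X p).map f)) ≫ tensorStalkMap y B =
    tensorStalkMap y A ≫ tensorMap fun l => (stalkComplex (coord y l)).map f := by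
  ext n : 1
  refine (EqOpens.point y).presheafFiber_hom_ext fun U g => ?_
  refine ((EqOpens.point y).toPresheafFiber_naturality_assoc
    (((complexOfFunctor _ _).map ((tensorPresheafFunctor R X p).map f)).f n) _ _ _).trans ?_
  refine (congrArg (_ ≫ ·) (toPresheafFiber_tensorStalkMap y B n U g)).trans ?_
  refine Eq.trans ?_ ((Category.assoc _ _ _).symm.trans
    (congrArg (· ≫ _) (toPresheafFiber_tensorStalkMap y A n U g))).symm
  have e : tensorGerm y A U g.down.1 g.down.2 ≫ (tensorMap fun l => (stalkComplex (coord y l)).map f) =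
      ((tensorPresheafFunctor R X p).map f).app (op U) ≫ tensorGerm y B U g.down.1 g.down.2 :=
    tensorPerm_comp_of_one (rotation g.down.1) _ _ _ _ fun l =>
      ((germ (coord y l) _ _).naturality f).symm
  exact (HomologicalComplex.congr_hom e n).symm

end Stalks

end SteenrodTate

namespace SteenrodTate

/-! ### The stalk of an external tensor power is the tensor product of the stalks. -/

section StalkIso

lemma map_map_apply {R : Type u} [CommRing R] {X : TopCat.{u}} (P : (Opens X)ᵒᵖ ⥤ ModuleCat.{u} R) {U V W : Opens X} (f : U ⟶ V) (g : V ⟶ W)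
    (h : U ⟶ W) (t : P.obj (op W)) : P.map h.op t = P.map f.op (P.map g.op t) := by
  rw [← ConcreteCategory.comp_apply, ← Functor.map_comp]
  rfl

variable {R : Type u} [CommRing R] {X : TopCat.{u}} {p : ℕ} [NeZero p]

/-- The open neighbourhood `{x ∈ U | x l ∈ W l}`. -/
def boxInter (U : EqOpens (Mu p) (MuPower p X)) (W : Fin p → Opens X) :
    EqOpens (Mu p) (MuPower p X) where
  opens := ⟨U.opens ∩ {x | ∀ l, x l ∈ W l}, U.opens.isOpen.inter (by
    have e : {x : MuPower p X | ∀ l, x l ∈ W l} =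
        ⋂ l, (fun x : MuPower p X => x l) ⁻¹' (W l) := Set.ext fun x => by simp
    rw [e]
    exact isOpen_iInter_of_finite fun l => (W l).isOpen.preimage (continuous_apply l))⟩

lemma boxInter_le (U : EqOpens (Mu p) (MuPower p X)) (W : Fin p → Opens X) :
    (boxInter U W).opens ≤ U.opens := fun _ hx => hx.1

lemma proj_boxInter_le (U : EqOpens (Mu p) (MuPower p X)) (W : Fin p → Opens X) (l : Fin p) :
    proj (boxInter U W) l ≤ W l := by
  rintro _ ⟨x, hx, rfl⟩
  exact hx.2 l

/-- The stalk functor on equivariant presheaves. -/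
noncomputable abbrev eqStalk (y : MuPower p X) : EqPsh R p (MuPower p X) ⥤ ModuleCat.{u} R :=
  (EqOpens.point y).presheafFiber

/-- The element `1` of the fibre of a neighbourhood. -/
def fiberOne {y : MuPower p X} {U : EqOpens (Mu p) (MuPower p X)} (h : y ∈ U.opens) :
    (EqOpens.point y).fiber.obj U :=
  ULift.up ⟨1, by rwa [one_smul]⟩

variable (y : MuPower p X) (A : CochainComplex (Sh R X) ℤ) (n : ℤ)

/-- The map from sections near `y` to the stalk at `y`. -/
noncomputable def toStalk (U : EqOpens (Mu p) (MuPower p X)) (h : y ∈ U.opens) :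
    tensorX (fun l => ((sectionsComplex X).obj (op (proj U l))).obj A) n →ₗ[R]
      (eqStalk y).obj ((tensorPsh p A).X n) :=
  ((EqOpens.point y).toPresheafFiber U (fiberOne h) ((tensorPsh p A).X n)).hom

/-- Restriction of sections of the external tensor power. -/
noncomputable def restr {U V : EqOpens (Mu p) (MuPower p X)} (h : V.opens ≤ U.opens) (l : Fin p) :
    ((sectionsComplex X).obj (op (proj U l))).obj A ⟶ ((sectionsComplex X).obj (op (proj V l))).obj A :=
  ((sectionsComplex X).map (homOfLE (proj_mono h l)).op).app A

lemma toStalk_restrict {U V : EqOpens (Mu p) (MuPower p X)} (h : V.opens ≤ U.opens)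
    (hV : y ∈ V.opens)
    (z : tensorX (fun l => ((sectionsComplex X).obj (op (proj U l))).obj A) n) :
    toStalk y A n V hV (tensorGraded (fun l a => ((restr A h l).f a).hom) n z) =
      toStalk y A n U (h hV) z := by
  have e := (EqOpens.point y).toPresheafFiber_w (EqOpens.homOfLE h) (fiberOne hV) ((tensorPsh p A).X n)
  have e1 : (EqOpens.point y).fiber.map (EqOpens.homOfLE h) (fiberOne hV) = fiberOne (h hV) :=
    congrArg ULift.up (Subtype.ext (mul_one _))
  rw [e1] at e
  have e2 : (((tensorPsh p A).X n).map (EqOpens.homOfLE h).op).hom =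
      tensorGraded (fun l a => ((restr A h l).f a).hom) n := by
    rw [← tensorMap_f_hom]
    exact congrArg (fun f : (tensorPresheaf p A).obj (op U) ⟶ (tensorPresheaf p A).obj (op V) =>
      (f.f n).hom) (tensorPresheaf_map_homOfLE A h)
  rw [← e2]
  exact ConcreteCategory.congr_hom e z

lemma tensorStalkMap_toStalk (U : EqOpens (Mu p) (MuPower p X)) (h : y ∈ U.opens)
    (z : tensorX (fun l => ((sectionsComplex X).obj (op (proj U l))).obj A) n) :
    ((tensorStalkMap y A).f n).hom (toStalk y A n U h z) =
      tensorGraded (fun l a => (((germ (coord y l) (proj U l) (mem_proj h l)).app A).f a).hom) n z := by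
  have e := ConcreteCategory.congr_hom (toPresheafFiber_tensorStalkMap y A n U (fiberOne h)) z
  have e2 : ((tensorGerm y A U 1 (by rwa [one_smul])).f n).hom =
      tensorGraded (fun l a => (((germ (coord y l) (proj U l) (mem_proj h l)).app A).f a).hom) n := by
    rw [← tensorMap_f_hom, tensorGerm_one y A U _ h]
    rfl
  rw [← e2]
  exact e

/-- An element of the fibre attached to a group element `g` with `g • y ∈ U` is pulled back to the
neighbourhood `g⁻¹ U` of `y`, where the group element becomes `1`. -/
lemma exists_toStalk_eq (t : (eqStalk y).obj ((tensorPsh p A).X n)) :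
    ∃ (U : EqOpens (Mu p) (MuPower p X)) (h : y ∈ U.opens)
      (z : tensorX (fun l => ((sectionsComplex X).obj (op (proj U l))).obj A) n),
      toStalk y A n U h z = t := by
  obtain ⟨U, ⟨⟨g, hg⟩⟩, z, rfl⟩ := (EqOpens.point y).toPresheafFiber_jointly_surjective t
  let f : U.preimage g ⟶ U := ⟨g, fun x hx => hx⟩
  have h : y ∈ (U.preimage g).opens := hg
  have e := (EqOpens.point y).toPresheafFiber_w f (fiberOne h) ((tensorPsh p A).X n)
  have e1 : (EqOpens.point y).fiber.map f (fiberOne h) = ⟨⟨g, hg⟩⟩ :=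
    congrArg ULift.up (Subtype.ext (mul_one _))
  rw [e1] at e
  exact ⟨_, h, (((tensorPsh p A).X n).map f.op) z, ConcreteCategory.congr_hom e z⟩

/-- For each coordinate the two sections agree on some neighbourhood `W l`. There are finitely many
coordinates, so the box of the `W l` is open, and over its intersection with `U` and `U'` the two
tensors coincide. -/
lemma eq_of_germ_eq (i : Fin p → ℤ) (hi : ∑ l, i l = n) (U U' : EqOpens (Mu p) (MuPower p X))
    (hU : y ∈ U.opens) (hU' : y ∈ U'.opens)
    (s : ∀ l, (((sectionsComplex X).obj (op (proj U l))).obj A).X (i l))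
    (s' : ∀ l, (((sectionsComplex X).obj (op (proj U' l))).obj A).X (i l))
    (h : ∀ l, ((germ (coord y l) (proj U l) (mem_proj hU l)).app A).f (i l) (s l) =
      ((germ (coord y l) (proj U' l) (mem_proj hU' l)).app A).f (i l) (s' l)) :
    toStalk y A n U hU (incl _ i hi (PiTensorProduct.tprod R s)) =
      toStalk y A n U' hU' (incl _ i hi (PiTensorProduct.tprod R s')) := by
  have hW (l : Fin p) : ∃ (W : Opens X) (_ : coord y l ∈ W) (h₁ : W ≤ proj U l) (h₂ : W ≤ proj U' l),
      (A.X (i l)).obj.map (homOfLE h₁).op (s l) = (A.X (i l)).obj.map (homOfLE h₂).op (s' l) := by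
    have hm : coord y l ∈ proj U l ⊓ proj U' l := ⟨mem_proj hU l, mem_proj hU' l⟩
    have e₁ := (pt (coord y l)).toPresheafFiber_w (homOfLE (inf_le_left : proj U l ⊓ proj U' l ≤ _))
      ⟨⟨hm⟩⟩ (A.X (i l)).obj
    have e₂ := (pt (coord y l)).toPresheafFiber_w (homOfLE (inf_le_right : proj U l ⊓ proj U' l ≤ _))
      ⟨⟨hm⟩⟩ (A.X (i l)).obj
    have e := ((ConcreteCategory.congr_hom e₁ (s l)).trans (h l)).trans
      (ConcreteCategory.congr_hom e₂ (s' l)).symm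
    obtain ⟨W, f, ⟨⟨hy⟩⟩, _, h'⟩ := ((pt (coord y l)).toPresheafFiber_eq_iff'
      (proj U l ⊓ proj U' l) ⟨⟨hm⟩⟩ ((A.X (i l)).obj.map (homOfLE inf_le_left).op (s l))
      ((A.X (i l)).obj.map (homOfLE inf_le_right).op (s' l))).1 e
    refine ⟨W, hy, f.le.trans inf_le_left, f.le.trans inf_le_right, ?_⟩
    exact (map_map_apply _ _ _ _ (s l)).trans (h'.trans (map_map_apply _ _ _ _ (s' l)).symm)
  choose W hyW h₁ h₂ hs using hW
  have hV : y ∈ (boxInter U W).opens := ⟨hU, hyW⟩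
  let V : EqOpens (Mu p) (MuPower p X) := ⟨(boxInter U W).opens ⊓ U'.opens⟩
  have k₁ : V.opens ≤ U.opens := inf_le_left.trans (boxInter_le U W)
  have k₂ : V.opens ≤ U'.opens := inf_le_right
  have kW (l) : proj V l ≤ W l := (proj_mono (V := V) (U := boxInter U W) inf_le_left l).trans
    (proj_boxInter_le U W l)
  rw [← toStalk_restrict y A n k₁ ⟨hV, hU'⟩, ← toStalk_restrict y A n k₂ ⟨hV, hU'⟩,
    tensorGraded_incl, tensorGraded_incl, PiTensorProduct.map_tprod, PiTensorProduct.map_tprod]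
  congr 4
  funext l
  exact (map_map_apply _ (homOfLE (kW l)) (homOfLE (h₁ l)) _ (s l)).trans
    ((congrArg _ (hs l)).trans (map_map_apply _ (homOfLE (kW l)) (homOfLE (h₂ l)) _ (s' l)).symm)

lemma exists_sections (i : Fin p → ℤ)
    (x x' : ∀ l, ((stalkComplex (coord y l)).obj A).X (i l)) :
    ∃ (U : EqOpens (Mu p) (MuPower p X)) (hU : y ∈ U.opens)
      (s s' : ∀ l, (((sectionsComplex X).obj (op (proj U l))).obj A).X (i l)),
      (∀ l, ((germ (coord y l) (proj U l) (mem_proj hU l)).app A).f (i l) (s l) = x l) ∧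
      ∀ l, ((germ (coord y l) (proj U l) (mem_proj hU l)).app A).f (i l) (s' l) = x' l := by
  have hW (l : Fin p) : ∃ (W : Opens X) (hW : coord y l ∈ W) (t t' : (A.X (i l)).obj.obj (op W)),
      ((germ (coord y l) W hW).app A).f (i l) t = x l ∧
      ((germ (coord y l) W hW).app A).f (i l) t' = x' l := by
    obtain ⟨W, ⟨⟨hW⟩⟩, t, t', h, h'⟩ :=
      (pt (coord y l)).toPresheafFiber_jointly_surjective₂ (x l) (x' l)
    exact ⟨W, hW, t, t', h, h'⟩
  choose W hyW t t' ht ht' using hW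
  have hU : y ∈ (boxInter (⟨⊤⟩ : EqOpens (Mu p) (MuPower p X)) W).opens := ⟨trivial, hyW⟩
  have e (l) (t : (A.X (i l)).obj.obj (op (W l))) :
      ((germ (coord y l) (proj (boxInter ⟨⊤⟩ W) l) (mem_proj hU l)).app A).f (i l)
        ((A.X (i l)).obj.map (homOfLE (proj_boxInter_le ⟨⊤⟩ W l)).op t) =
      ((germ (coord y l) (W l) (hyW l)).app A).f (i l) t :=
    ConcreteCategory.congr_hom ((pt (coord y l)).toPresheafFiber_w
      (homOfLE (proj_boxInter_le ⟨⊤⟩ W l)) ⟨⟨mem_proj hU l⟩⟩ (A.X (i l)).obj) t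
  exact ⟨_, hU, fun l => (A.X (i l)).obj.map (homOfLE (proj_boxInter_le ⟨⊤⟩ W l)).op (t l),
    fun l => (A.X (i l)).obj.map (homOfLE (proj_boxInter_le ⟨⊤⟩ W l)).op (t' l),
    fun l => (e l _).trans (ht l), fun l => (e l _).trans (ht' l)⟩

/-- A left inverse of the comparison map: in each multi-degree, germs are lifted to sections over a
common box, and the class of the tensor of these sections is multilinear in the germs and
independent of the lifts. -/
lemma exists_stalk_inverse : ∃ Θ : tensorX (fun l => (stalkComplex (coord y l)).obj A) n →ₗ[R]
      (eqStalk y).obj ((tensorPsh p A).X n),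
    ∀ (U : EqOpens (Mu p) (MuPower p X)) (h : y ∈ U.opens) (z),
      Θ (tensorGraded (fun l a => (((germ (coord y l) (proj U l) (mem_proj h l)).app A).f a).hom) n z) =
        toStalk y A n U h z := by
  have (i : MultiDegree (Fin p) n) := exists_multilinearMap_of_germs (R := R)
    (I := {U : EqOpens (Mu p) (MuPower p X) // y ∈ U.opens})
    (N := fun U l => (((sectionsComplex X).obj (op (proj U.1 l))).obj A).X (i.1 l))
    (M := fun l => ((stalkComplex (coord y l)).obj A).X (i.1 l))
    (T := (eqStalk y).obj ((tensorPsh p A).X n))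
    (fun U l => (((germ (coord y l) (proj U.1 l) (mem_proj U.2 l)).app A).f (i.1 l)).hom)
    (fun U => (toStalk y A n U.1 U.2 ∘ₗ incl _ i.1 i.2).compMultilinearMap (PiTensorProduct.tprod R))
    (fun x x' => by
      obtain ⟨U, hU, s, s', h, h'⟩ := exists_sections y A i.1 x x'
      exact ⟨⟨U, hU⟩, s, s', h, h'⟩)
    (fun U U' s s' h => eq_of_germ_eq y A n i.1 i.2 U.1 U'.1 U.2 U'.2 s s' h)
  choose m hm using this
  let Θ : tensorX (fun l => (stalkComplex (coord y l)).obj A) n →ₗ[R]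
    (eqStalk y).obj ((tensorPsh p A).X n) :=
      DirectSum.toModule R _ _ fun i => PiTensorProduct.lift (m i)
  refine ⟨Θ, fun U h z => ?_⟩
  have H : Θ ∘ₗ tensorGraded (fun l a =>
      (((germ (coord y l) (proj U l) (mem_proj h l)).app A).f a).hom) n = toStalk y A n U h := by
    refine tensorX_hom_ext fun i hi s => ?_
    rw [LinearMap.comp_apply, tensorGraded_incl, PiTensorProduct.map_tprod, incl,
      DirectSum.toModule_lof, PiTensorProduct.lift.tprod]
    exact hm ⟨i, hi⟩ ⟨U, h⟩ s
  exact LinearMap.congr_fun H z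

/-- Injectivity follows from `exists_stalk_inverse`, as every element of the stalk comes from a
section near `y`. For surjectivity, the range contains every pure tensor, since finitely many germs
are defined over one box. -/
instance : IsIso ((tensorStalkMap y A).f n) := by
  rw [ConcreteCategory.isIso_iff_bijective]
  let Φ : (eqStalk y).obj ((tensorPsh p A).X n) →ₗ[R]
    tensorX (fun l => (stalkComplex (coord y l)).obj A) n := ((tensorStalkMap y A).f n).hom
  change Function.Bijective Φ
  constructor
  · rw [injective_iff_map_eq_zero]
    intro t ht
    obtain ⟨U, h, z, rfl⟩ := exists_toStalk_eq y A n t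
    obtain ⟨Θ, hΘ⟩ := exists_stalk_inverse y A n
    rw [← hΘ]
    have := (tensorStalkMap_toStalk y A n U h z).symm.trans ht
    exact (congrArg Θ this).trans (map_zero Θ)
  · intro t
    have h0 : (LinearMap.range Φ).mkQ = 0 := by
      refine tensorX_hom_ext fun i hi x => ?_
      rw [LinearMap.zero_apply, Submodule.mkQ_apply, Submodule.Quotient.mk_eq_zero]
      obtain ⟨U, hU, s, _, h, _⟩ := exists_sections y A i x x
      refine ⟨toStalk y A n U hU (incl _ i hi (PiTensorProduct.tprod R s)), ?_⟩
      refine (tensorStalkMap_toStalk y A n U hU _).trans ?_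
      rw [tensorGraded_incl, PiTensorProduct.map_tprod]
      exact congrArg (fun z => incl _ i hi (PiTensorProduct.tprod R z)) (funext h)
    exact (Submodule.Quotient.mk_eq_zero _).1 (LinearMap.congr_fun h0 t)

instance : IsIso (tensorStalkMap y A) := HomologicalComplex.Hom.isIso_of_components _

end StalkIso

/-! ### Steenrod's construction on complexes with flat stalks. -/

section SteenrodQuasiIso

variable {R : Type u} [CommRing R] {X : TopCat.{u}} {p : ℕ} [NeZero p]

/-- A complex of sheaves with flat stalks. -/
def HasFlatStalks (A : CochainComplex (Sh R X) ℤ) : Prop :=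
  ∀ (x : X) (n : ℤ), Module.Flat R (((stalkComplex x).obj A).X n)

lemma isStrictlyGE_stalkComplex (A : CochainComplex (Sh R X) ℤ) (x : X) (a : ℤ) [A.IsStrictlyGE a] :
    ((stalkComplex x).obj A).IsStrictlyGE a := by
  rw [CochainComplex.isStrictlyGE_iff]
  intro i hi
  exact Functor.map_isZero ((pt x).sheafFiber (A := ModuleCat.{u} R)) (A.isZero_of_isStrictlyGE a i hi)

/-- Steenrod's construction preserves quasi-isomorphisms between bounded below complexes with flat
stalks. -/
lemma quasiIso_steenrodC_map {A B : CochainComplex (Sh R X) ℤ} (f : A ⟶ B) [QuasiIso f]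
    (hA : HasFlatStalks A) (hB : HasFlatStalks B) (a : ℤ) [A.IsStrictlyGE a] [B.IsStrictlyGE a] :
    QuasiIso ((steenrodC R X p).map f) := by
  refine quasiIso_presheafToSheaf_map EqOpens.isConservativeFamilyOfPoints_points
    ((complexOfFunctor _ _).map ((tensorPresheafFunctor R X p).map f)) ?_
  rintro _ ⟨y⟩
  have h : QuasiIso (tensorMap fun l => (stalkComplex (coord y l)).map f) :=
    quasiIso_tensorMap _ (fun l => HomologicalComplex.quasiIso_map_of_preservesHomology _ _)
      (fun l n => hA _ n) (fun l n => hB _ n) a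
      (fun l => isStrictlyGE_stalkComplex A _ a) (fun l => isStrictlyGE_stalkComplex B _ a)
  have e := tensorStalkMap_naturality y f
  have h2 : QuasiIso (tensorStalkMap y A ≫ tensorMap fun l => (stalkComplex (coord y l)).map f) :=
    inferInstance
  exact (quasiIso_iff_comp_right _ (tensorStalkMap y B)).1 (e.symm ▸ h2)

end SteenrodQuasiIso

end SteenrodTate

namespace SteenrodTate

/-! ### Dimension shifting for `Tor` by diagram chases. -/

section TorDimension

variable {R : Type u} [CommRing R]

/-- The complex `M ⊗ P` is exact in degree `n + 1`. -/
def TensorExactAt (M : Type u) [AddCommGroup M] [Module R M] (P : ChainComplex (ModuleCat.{u} R) ℕ)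
    (n : ℕ) : Prop :=
  Function.Exact ((P.d (n + 2) (n + 1)).hom.lTensor M) ((P.d (n + 1) n).hom.lTensor M)

/-- `Tor (n + 1) M N` vanishes for all `N`. -/
def TorVanishes (n : ℕ) (M : Type u) [AddCommGroup M] [Module R M] : Prop :=
  ∀ (N : ModuleCat.{u} R) (P : ProjectiveResolution N), TensorExactAt M P.complex n

/-- The index is shifted: vanishing at `d` refers to `Tor` in degree `d + 1`, computed by resolving
the second variable. -/
lemma torVanishes_of_isZero {d : ℕ} (h : ∀ (M N : ModuleCat.{u} R) (n : ℕ), d < n →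
    IsZero (((Tor (ModuleCat.{u} R) n).obj M).obj N)) (M : ModuleCat.{u} R) :
    TorVanishes (R := R) d M := by
  intro N P
  have h1 := (h M N (d + 1) (Nat.lt_succ_self d)).of_iso
    (P.isoLeftDerivedObj ((MonoidalCategory.tensoringLeft _).obj M) (d + 1)).symm
  have h2 := (HomologicalComplex.exactAt_iff_isZero_homology _ _).2 h1
  rw [HomologicalComplex.exactAt_iff' _ (d + 2) (d + 1) d (by simp) (by simp)] at h2
  rw [ShortComplex.moduleCat_exact_iff_range_eq_ker] at h2
  exact LinearMap.exact_iff.2 h2.symm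

section

variable {K F M : Type u} [AddCommGroup K] [Module R K] [AddCommGroup F] [Module R F]
  [AddCommGroup M] [Module R M] {i : K →ₗ[R] F} {q : F →ₗ[R] M}

lemma lTensor_rTensor_apply {M M' N N' : Type u} [AddCommGroup M] [Module R M] [AddCommGroup M']
    [Module R M'] [AddCommGroup N] [Module R N] [AddCommGroup N'] [Module R N']
    (f : M →ₗ[R] M') (g : N →ₗ[R] N') (x : M ⊗[R] N) :
    g.lTensor M' (f.rTensor N x) = f.rTensor N' (g.lTensor M x) := by
  rw [← LinearMap.comp_apply, ← LinearMap.comp_apply, LinearMap.lTensor_comp_rTensor,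
    LinearMap.rTensor_comp_lTensor]

lemma exact_d {N : ModuleCat.{u} R} (P : ProjectiveResolution N) (n : ℕ) :
    Function.Exact (P.complex.d (n + 2) (n + 1)).hom (P.complex.d (n + 1) n).hom := by
  have h := P.exact_succ n
  rw [ShortComplex.moduleCat_exact_iff_range_eq_ker] at h
  exact LinearMap.exact_iff.2 h.symm

lemma flat_X {N : ModuleCat.{u} R} (P : ProjectiveResolution N) (n : ℕ) :
    Module.Flat R (P.complex.X n) := by
  have : Module.Projective R (P.complex.X n) :=
    (IsProjective.iff_projective (P.complex.X n)).2 (P.projective n)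
  infer_instance

/-- The lift of an element of `F ⊗ P` along the differential to a boundary from `K ⊗ P`. -/
lemma exists_d_eq_of_rTensor_eq (hi : Function.Injective i) (hiq : Function.Exact i q)
    (hq : Function.Surjective q) {N : ModuleCat.{u} R} (P : ProjectiveResolution N) {n : ℕ}
    (hM : TensorExactAt M P.complex n) (k : K ⊗[R] P.complex.X n) (g : F ⊗[R] P.complex.X (n + 1))
    (h : (P.complex.d (n + 1) n).hom.lTensor F g = i.rTensor _ k) :
    ∃ k' : K ⊗[R] P.complex.X (n + 1), (P.complex.d (n + 1) n).hom.lTensor K k' = k := by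
  have := flat_X P n
  have h0 : (P.complex.d (n + 1) n).hom.lTensor M (q.rTensor _ g) = 0 := by
    rw [lTensor_rTensor_apply, h]
    exact (rTensor_exact _ hiq hq).apply_apply_eq_zero k
  obtain ⟨z, hz⟩ := (hM _).1 h0
  obtain ⟨z, rfl⟩ := LinearMap.rTensor_surjective _ hq z
  have h1 : q.rTensor _ (g - (P.complex.d (n + 2) (n + 1)).hom.lTensor F z) = 0 := by
    rw [map_sub, ← hz, lTensor_rTensor_apply, sub_self]
  obtain ⟨k', hk'⟩ := (rTensor_exact _ hiq hq _).1 h1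
  refine ⟨k', Module.Flat.rTensor_preserves_injective_linearMap i hi ?_⟩
  rw [← lTensor_rTensor_apply, hk', map_sub, h, ← LinearMap.comp_apply, ← LinearMap.lTensor_comp,
    ← ModuleCat.hom_comp, HomologicalComplex.d_comp_d, ModuleCat.hom_zero, LinearMap.lTensor_zero,
    LinearMap.zero_apply, sub_zero]

/-- Dimension shifting: with `F` flat, a cycle of `K ⊗ P` bounds in `F ⊗ P`, and the obstruction to
its bounding in `K ⊗ P` is a class one degree higher in `M ⊗ P`. -/
lemma TorVanishes.of_exact (hi : Function.Injective i) (hiq : Function.Exact i q)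
    (hq : Function.Surjective q) [Module.Flat R F] {n : ℕ} (hM : TorVanishes (R := R) (n + 1) M) :
    TorVanishes (R := R) n K := by
  intro N P k
  refine ⟨fun hk => ?_, ?_⟩
  · have h0 : (P.complex.d (n + 1) n).hom.lTensor F (i.rTensor _ k) = 0 := by
      rw [lTensor_rTensor_apply, hk, map_zero]
    obtain ⟨g, hg⟩ := (Module.Flat.lTensor_exact F (exact_d P n) _).1 h0
    exact exists_d_eq_of_rTensor_eq hi hiq hq P (hM N P) k g hg
  · rintro ⟨k, rfl⟩
    rw [← LinearMap.comp_apply, ← LinearMap.lTensor_comp, ← ModuleCat.hom_comp,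
      HomologicalComplex.d_comp_d, ModuleCat.hom_zero, LinearMap.lTensor_zero,
      LinearMap.zero_apply]

/-- The kernel of `K ⊗ N → F ⊗ N` is a quotient of `Tor₁(M, N)`. The chase lifts an element of this
kernel to `K ⊗ P₀`, where it is a boundary. -/
lemma injective_rTensor_of_torVanishes (hi : Function.Injective i) (hiq : Function.Exact i q)
    (hq : Function.Surjective q) [Module.Flat R F] (hM : TorVanishes (R := R) 0 M)
    (N : ModuleCat.{u} R) : Function.Injective (i.rTensor N) := by
  obtain ⟨P⟩ := (inferInstance : HasProjectiveResolution N).out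
  have hπ : Function.Surjective (P.π.f 0).hom := (ModuleCat.epi_iff_surjective _).1 inferInstance
  have hex : Function.Exact (P.complex.d 1 0).hom (P.π.f 0).hom := by
    have h := P.exact₀
    rw [ShortComplex.moduleCat_exact_iff_range_eq_ker] at h
    exact LinearMap.exact_iff.2 h.symm
  rw [injective_iff_map_eq_zero]
  intro k hk
  obtain ⟨k, rfl⟩ := LinearMap.lTensor_surjective K hπ k
  have h1 : (P.π.f 0).hom.lTensor F (i.rTensor _ k) = 0 := by
    rw [lTensor_rTensor_apply]; exact hk
  obtain ⟨g, hg⟩ := (lTensor_exact F hex hπ _).1 h1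
  obtain ⟨k', rfl⟩ := exists_d_eq_of_rTensor_eq hi hiq hq P (hM N P) k g hg
  exact (lTensor_exact K hex hπ).apply_apply_eq_zero k'

end

/-- Let `M` be the quotient of a free module `F` by `K`, and `A → B` injective. An element of `M ⊗
A` dying in `M ⊗ B` lifts to `F ⊗ A` and comes from some `k` in `K ⊗ B`. The image of `k` in `K ⊗
(B/A)` is zero, because `K ⊗ (B/A)` injects into `F ⊗ (B/A)`; hence `k` comes from `K ⊗ A`. -/
lemma flat_of_torVanishes {M : Type u} [AddCommGroup M] [Module R M]
    (hM : TorVanishes (R := R) 0 M) : Module.Flat R M := by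
  let q : (M →₀ R) →ₗ[R] M := Finsupp.linearCombination R id
  have hq : Function.Surjective q := fun m => ⟨Finsupp.single m 1, by simp [q]⟩
  obtain ⟨K, _, _, i, hi, hiq⟩ : ∃ (K : Type u) (_ : AddCommGroup K) (_ : Module R K)
      (i : K →ₗ[R] (M →₀ R)), Function.Injective i ∧ Function.Exact i q :=
    ⟨LinearMap.ker q, inferInstance, inferInstance, (LinearMap.ker q).subtype,
      Subtype.val_injective, LinearMap.exact_subtype_ker_map q⟩
  rw [Module.Flat.iff_lTensor_preserves_injective_linearMap]
  intro A B _ _ _ _ j hj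
  have hj' : Function.Exact j (LinearMap.range j).mkQ := LinearMap.exact_map_mkQ_range j
  have hs : Function.Surjective (LinearMap.range j).mkQ := Submodule.mkQ_surjective _
  rw [injective_iff_map_eq_zero]
  intro x hx
  obtain ⟨y, rfl⟩ := LinearMap.rTensor_surjective A hq x
  rw [lTensor_rTensor_apply] at hx
  obtain ⟨k, hk⟩ := (rTensor_exact B hiq hq _).1 hx
  have h1 : (LinearMap.range j).mkQ.lTensor _ k = 0 := by
    refine injective_rTensor_of_torVanishes hi hiq hq hM (ModuleCat.of R (B ⧸ LinearMap.range j)) ?_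
    rw [← lTensor_rTensor_apply, hk, map_zero]
    exact (lTensor_exact (M →₀ R) hj' hs).apply_apply_eq_zero y
  obtain ⟨k', rfl⟩ := (lTensor_exact _ hj' hs _).1 h1
  have h2 : y = i.rTensor A k' := by
    refine Module.Flat.lTensor_preserves_injective_linearMap j hj ?_
    rw [← hk, lTensor_rTensor_apply]
  rw [h2]
  exact (rTensor_exact A hiq hq).apply_apply_eq_zero k'

end TorDimension

/-! ### A functorial flat cover of modules that preserves zero maps. -/

section ReducedFree

variable (R : Type u) [CommRing R]

/-- The sum of the coefficients. -/
noncomputable def coeffSum (M : Type u) : (M →₀ R) →ₗ[R] R := Finsupp.linearCombination R fun _ => 1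

lemma coeffSum_lmapDomain {M N : Type u} (f : M → N) (s : M →₀ R) :
    coeffSum R N (Finsupp.lmapDomain R R f s) = coeffSum R M s := by
  simp [coeffSum, Finsupp.linearCombination_mapDomain, Function.comp_def]

/-- The formal linear combinations of elements of a module whose coefficients have sum zero, as a
functor. -/
noncomputable def reducedFree : ModuleCat.{u} R ⥤ ModuleCat.{u} R where
  obj M := ModuleCat.of R (LinearMap.ker (coeffSum R M))
  map f := ModuleCat.ofHom ((Finsupp.lmapDomain R R f).restrict fun s hs => by
    rw [LinearMap.mem_ker] at hs ⊢
    rw [coeffSum_lmapDomain, hs])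
  map_id M := by
    ext s
    exact DFunLike.congr_fun (Finsupp.mapDomain_id (v := s.1)) _
  map_comp f g := by
    ext s
    exact DFunLike.congr_fun (Finsupp.mapDomain_comp (f := f.hom) (g := g.hom) (v := s.1)) _

/-- This is the purpose of the condition on the coefficients: the plain free module functor does not
send zero maps to zero, and so could not be applied degreewise to a complex. Under a zero map all
coefficients collect at `0`, with sum zero. -/
instance : (reducedFree R).PreservesZeroMorphisms where
  map_zero M N := by
    ext ⟨s, hs⟩
    refine Subtype.ext ?_
    change Finsupp.mapDomain (fun _ => (0 : N)) s = 0
    have h : Finsupp.mapDomain (fun _ => (0 : N)) s = Finsupp.single 0 (coeffSum R M s) := by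
      simp [Finsupp.mapDomain, coeffSum, Finsupp.linearCombination_apply, Finsupp.single_sum]
    rw [h, LinearMap.mem_ker.1 hs, Finsupp.single_zero]

/-- The evaluation of formal linear combinations. -/
noncomputable def reducedFreeEval : reducedFree R ⟶ 𝟭 _ where
  app M := ModuleCat.ofHom (Finsupp.linearCombination R (id : M → M) ∘ₗ Submodule.subtype _)
  naturality M N f := by
    ext ⟨s, hs⟩
    change Finsupp.linearCombination R id (Finsupp.mapDomain f s) =
      f (Finsupp.linearCombination R id s)
    rw [Finsupp.linearCombination_mapDomain]
    exact (Finsupp.apply_linearCombination R f.hom id s).symm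

lemma reducedFreeEval_surjective (M : ModuleCat.{u} R) :
    Function.Surjective ((reducedFreeEval R).app M) := fun m =>
  ⟨⟨Finsupp.single m 1 - Finsupp.single 0 1, by simp [coeffSum]⟩, by
    change Finsupp.linearCombination R id (Finsupp.single m 1 - Finsupp.single 0 1) = m
    simp⟩

/-- A retract of the free module, by subtracting the sum of the coefficients at the basis element
`0`. -/
instance (M : ModuleCat.{u} R) : Module.Flat R ((reducedFree R).obj M) := by
  let r : (M →₀ R) →ₗ[R] LinearMap.ker (coeffSum R M) :=
    LinearMap.codRestrict _ (LinearMap.id - Finsupp.lsingle 0 ∘ₗ coeffSum R M)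
      (fun s => by simp [coeffSum])
  exact Module.Flat.of_retract (LinearMap.ker (coeffSum R M)).subtype r (by
    ext1 ⟨s, hs⟩
    refine Subtype.ext ?_
    change s - Finsupp.single 0 (coeffSum R M s) = s
    rw [LinearMap.mem_ker.1 hs, Finsupp.single_zero, sub_zero])

end ReducedFree

/-! ### Flatness of stalks of presheaves of flat modules. -/

section FlatFiber

variable {C : Type u} [Category.{u} C] {J : GrothendieckTopology C} {R : Type u} [CommRing R]
  (Φ : GrothendieckTopology.Point.{u} J)

lemma exists_toPresheafFiber_eq {P : Cᵒᵖ ⥤ ModuleCat.{u} R} {l : ℕ}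
    (x : Fin l → (Φ.presheafFiber (A := ModuleCat.{u} R)).obj P) :
    ∃ (U : C) (u : Φ.fiber.obj U) (s : Fin l → P.obj (op U)),
      ∀ i, Φ.toPresheafFiber U u P (s i) = x i := by
  classical
  choose U u s hs using fun i => Φ.toPresheafFiber_jointly_surjective (x i)
  have := Φ.isCofiltered
  obtain ⟨⟨V, v⟩, hV⟩ := IsCofiltered.inf_objs_exists
    (Finset.univ.image fun i => Φ.fiber.elementsMk (U i) (u i))
  let f (i : Fin l) : Φ.fiber.elementsMk V v ⟶ Φ.fiber.elementsMk (U i) (u i) := Nonempty.some (hV (Finset.mem_image_of_mem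
    (fun i => Φ.fiber.elementsMk (U i) (u i)) (Finset.mem_univ i)))
  refine ⟨V, v, fun i => P.map (f i).1.op (s i), fun i => ?_⟩
  have h := ConcreteCategory.congr_hom (Φ.toPresheafFiber_w (f i).1 v P) (s i)
  refine h.trans ?_
  rw [← hs]
  congr 3
  exact (f i).2

/-- By the equational criterion: a linear relation between finitely many germs already holds between
sections over some neighbourhood, is trivialized there by flatness, and the trivialization passes to
the stalk. -/
lemma flat_presheafFiber (P : Cᵒᵖ ⥤ ModuleCat.{u} R) (hP : ∀ U, Module.Flat R (P.obj U)) :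
    Module.Flat R ((Φ.presheafFiber (A := ModuleCat.{u} R)).obj P) := by
  rw [Module.Flat.iff_forall_isTrivialRelation]
  intro l f x h
  obtain ⟨U, u, s, hs⟩ := exists_toPresheafFiber_eq Φ x
  have h0 : Φ.toPresheafFiber U u P (∑ i, f i • s i) = Φ.toPresheafFiber U u P 0 := by
    rw [map_sum, map_zero, ← h]
    exact Finset.sum_congr rfl fun i _ => (map_smul _ _ _).trans (congrArg (f i • ·) (hs i))
  obtain ⟨V, g, v, hv, h1⟩ := (Φ.toPresheafFiber_eq_iff' U u _ _).1 h0
  have h2 : ∑ i, f i • P.map g.op (s i) = 0 := by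
    rw [map_zero, map_sum] at h1
    exact (Finset.sum_congr rfl fun i _ => (map_smul _ _ _).symm).trans h1
  obtain ⟨k, a, y, hy, ha⟩ := Module.Flat.isTrivialRelation_of_sum_smul_eq_zero h2
  refine ⟨k, a, fun j => Φ.toPresheafFiber V v P (y j), fun i => ?_, ha⟩
  rw [← hs, ← hv]
  have e := ConcreteCategory.congr_hom (Φ.toPresheafFiber_w g v P) (s i)
  refine e.symm.trans ?_
  have e2 : Φ.toPresheafFiber V v P (P.map g.op (s i)) =
      Φ.toPresheafFiber V v P (∑ j, a i j • y j) := congrArg _ (hy i)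
  refine e2.trans ?_
  rw [map_sum]
  exact Finset.sum_congr rfl fun j _ => map_smul _ _ _

end FlatFiber

end SteenrodTate

namespace SteenrodTate

/-! ### Functorial mapping cones. -/

section Cone

variable {A : Type*} [Category* A] [Abelian A]

open CochainComplex

lemma quasiIso_mappingCone_map {K₁ L₁ K₂ L₂ : CochainComplex A ℤ} (φ₁ : K₁ ⟶ L₁) (φ₂ : K₂ ⟶ L₂)
    (a : K₁ ⟶ K₂) (b : L₁ ⟶ L₂) (comm : φ₁ ≫ b = a ≫ φ₂) [QuasiIso a] [QuasiIso b] :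
    QuasiIso (mappingCone.map φ₁ φ₂ a b comm) := by
  let _ : HasDerivedCategory A := HasDerivedCategory.standard A
  rw [← DerivedCategory.isIso_Q_map_iff_quasiIso]
  exact Pretriangulated.isIso₃_of_isIso₁₂
    (DerivedCategory.Q.mapTriangle.map (mappingCone.triangleMap φ₁ φ₂ a b comm))
    (DerivedCategory.mappingCone_triangle_distinguished φ₁)
    (DerivedCategory.mappingCone_triangle_distinguished φ₂)
    (inferInstanceAs (IsIso (DerivedCategory.Q.map a)))
    (inferInstanceAs (IsIso (DerivedCategory.Q.map b)))

/-- The mapping cone of a natural map between functors with values in complexes. -/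
noncomputable def coneFunctor {D : Type*} [Category* D] {F G : D ⥤ CochainComplex A ℤ}
    (φ : F ⟶ G) : D ⥤ CochainComplex A ℤ where
  obj K := mappingCone (φ.app K)
  map f := mappingCone.map _ _ (F.map f) (G.map f) (φ.naturality f).symm
  map_id K := by
    simp only [CategoryTheory.Functor.map_id]
    exact mappingCone.map_id _
  map_comp f g := by
    simp only [Functor.map_comp]
    exact mappingCone.map_comp _ _ _ _ _ _ _ _ _

/-- The map from the mapping cone of `φ` given by a natural map `ψ` with `φ ≫ ψ = 0`. -/
noncomputable def coneFunctorDesc {D : Type*} [Category* D] {F G H : D ⥤ CochainComplex A ℤ}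
    (φ : F ⟶ G) (ψ : G ⟶ H) (h : ∀ K, φ.app K ≫ ψ.app K = 0) : coneFunctor φ ⟶ H where
  app K := mappingCone.desc (φ.app K) 0 (ψ.app K) (by simp [h])
  naturality K L f := by
    change mappingCone.map (φ.app K) (φ.app L) (F.map f) (G.map f) (φ.naturality f).symm ≫ _ =
      mappingCone.desc (φ.app K) 0 (ψ.app K) (by simp [h]) ≫ H.map f
    ext n
    have hn' := HomologicalComplex.congr_hom (ψ.naturality f) n
    rw [mappingCone.ext_from_iff _ (n + 1) n rfl]
    rw [HomologicalComplex.comp_f, HomologicalComplex.comp_f] at hn'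
    simp [mappingCone.map, hn', HomologicalComplex.comp_f]

lemma delta_zero_eq_ofHom (S : ShortComplex (CochainComplex A ℤ)) {K : CochainComplex A ℤ}
    (f : K ⟶ S.X₁) : HomComplex.δ (-1) 0 (0 : HomComplex.Cochain K S.X₃ (-1)) =
      HomComplex.Cochain.ofHom ((f ≫ S.f) ≫ S.g) := by
  simp

/-- The map factors through the cone of `S.f`: replacing `K` by `S.X₁` changes the cone by a
quasi-isomorphism, and the cone of `S.f` is quasi-isomorphic to `S.X₃`. -/
lemma quasiIso_desc_of_shortExact {S : ShortComplex (CochainComplex A ℤ)} (hS : S.ShortExact)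
    {K : CochainComplex A ℤ} (f : K ⟶ S.X₁) (hf : QuasiIso f) (h) :
    QuasiIso (mappingCone.desc (f ≫ S.f) 0 S.g h) := by
  have := mappingCone.quasiIso_descShortComplex hS
  have h1 := quasiIso_mappingCone_map (f ≫ S.f) S.f f (𝟙 _) (by simp)
  have e : mappingCone.desc (f ≫ S.f) 0 S.g h =
      mappingCone.map (f ≫ S.f) S.f f (𝟙 _) (by simp) ≫ mappingCone.descShortComplex S := by
    ext n
    simp [mappingCone.map, mappingCone.descShortComplex, mappingCone.ext_from_iff _ (n + 1) n rfl]
  rw [e]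
  infer_instance

lemma boundedComplex_mappingCone {K L : CochainComplex A ℤ} (f : K ⟶ L) (hK : boundedComplex A K)
    (hL : boundedComplex A L) : boundedComplex A (mappingCone f) := by
  obtain ⟨a, b, _, _, _, _⟩ := exists_bounds K L hK hL
  refine ⟨a - 1, b, isStrictlyGE_mappingCone f a _ (by lia) (by lia), ?_⟩
  rw [isStrictlyLE_iff]
  intro i hi
  rw [mappingCone.isZero_X_iff]
  exact ⟨K.isZero_of_isStrictlyLE b _ (by lia), L.isZero_of_isStrictlyLE b _ hi⟩

lemma boundedComplex_mapHomologicalComplex {B : Type*} [Category* B] [Abelian B] (F : A ⥤ B)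
    [F.PreservesZeroMorphisms] {K : CochainComplex A ℤ} (hK : boundedComplex A K) :
    boundedComplex B ((F.mapHomologicalComplex _).obj K) := by
  obtain ⟨a, b, _, _⟩ := hK
  refine ⟨a, b, ?_, ?_⟩
  · rw [isStrictlyGE_iff]
    exact fun i hi => F.map_isZero (K.isZero_of_isStrictlyGE a i hi)
  · rw [isStrictlyLE_iff]
    exact fun i hi => F.map_isZero (K.isZero_of_isStrictlyLE b i hi)

end Cone

/-! ### Finite resolutions as iterated cones. -/

section Cover

/-- A functorial epimorphism `P X ⟶ X` in an abelian category, together with its kernel, where the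
functor `P` need not be additive. -/
structure FunctorialCover (A : Type*) [Category* A] [Abelian A] where
  /-- The covering functor. -/
  P : A ⥤ A
  /-- The functor of kernels. -/
  K : A ⥤ A
  preservesZeroP : P.PreservesZeroMorphisms
  preservesZeroK : K.PreservesZeroMorphisms
  /-- The inclusion of the kernel. -/
  ι : K ⟶ P
  /-- The covering map. -/
  ev : P ⟶ 𝟭 A
  w (X : A) : ι.app X ≫ ev.app X = 0
  shortExact (X : A) : (ShortComplex.mk (ι.app X) (ev.app X) (w X)).ShortExact

namespace FunctorialCover

variable {A : Type*} [Category* A] [Abelian A]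

/-- The functorial cover attached to a natural epimorphism. -/
noncomputable def ofEpi (P : A ⥤ A) [hP : P.PreservesZeroMorphisms] (ev : P ⟶ 𝟭 A)
    [hev : ∀ X, Epi (ev.app X)] : FunctorialCover A where
  P := P
  K :=
    { obj X := kernel (ev.app X)
      map f := kernel.map _ _ (P.map f) f (ev.naturality f).symm }
  preservesZeroP := hP
  preservesZeroK := ⟨fun X Y => by
    rw [← cancel_mono (kernel.ι _)]
    simp⟩
  ι := { app X := kernel.ι (ev.app X) }
  ev := ev
  w X := kernel.condition _
  shortExact X := ⟨ShortComplex.exact_kernel _⟩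

variable (c : FunctorialCover A)

instance : c.P.PreservesZeroMorphisms := c.preservesZeroP
instance : c.K.PreservesZeroMorphisms := c.preservesZeroK

/-- The covering map of complexes. -/
noncomputable def evComplex :
    c.P.mapHomologicalComplex (ComplexShape.up ℤ) ⟶ 𝟭 (CochainComplex A ℤ) where
  app C :=
    { f n := c.ev.app (C.X n)
      comm' i j _ := (c.ev.naturality (C.d i j)).symm }
  naturality C D f := by
    ext n
    exact c.ev.naturality (f.f n)

/-- The short exact sequence of complexes attached to a cover. -/
noncomputable def shortComplex (C : CochainComplex A ℤ) : ShortComplex (CochainComplex A ℤ) :=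
  ShortComplex.mk ((NatTrans.mapHomologicalComplex c.ι _).app C) (c.evComplex.app C) (by
    ext n
    exact c.w _)

lemma shortComplex_shortExact (C : CochainComplex A ℤ) : (c.shortComplex C).ShortExact :=
  HomologicalComplex.shortExact_of_degreewise_shortExact _ fun n => c.shortExact (C.X n)

/-- The map from a resolution of the kernel to the cover. -/
noncomputable def resolutionMap (r : CochainComplex A ℤ ⥤ CochainComplex A ℤ) (ε : r ⟶ 𝟭 _) :
    c.K.mapHomologicalComplex _ ⋙ r ⟶ c.P.mapHomologicalComplex (ComplexShape.up ℤ) :=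
  Functor.whiskerLeft _ ε ≫ NatTrans.mapHomologicalComplex c.ι _

/-- The partial resolutions `K^d C ⟶ P K^(d-1) C ⟶ ... ⟶ P C` of a complex `C` as iterated mapping
cones, with the map to `C`. -/
noncomputable def resolution : ℕ → Σ r : CochainComplex A ℤ ⥤ CochainComplex A ℤ, r ⟶ 𝟭 _
  | 0 => ⟨𝟭 _, 𝟙 _⟩
  | d + 1 =>
    ⟨coneFunctor (c.resolutionMap _ (resolution d).2),
      coneFunctorDesc (c.resolutionMap _ (resolution d).2) c.evComplex fun C => by
      refine (Category.assoc _ _ _).trans ?_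
      exact (congrArg (_ ≫ ·) (c.shortComplex C).zero).trans comp_zero⟩

lemma quasiIso_resolution (d : ℕ) (C : CochainComplex A ℤ) :
    QuasiIso ((c.resolution d).2.app C) := by
  induction d generalizing C with
  | zero => exact inferInstanceAs (QuasiIso (𝟙 C))
  | succ d ih =>
    exact quasiIso_desc_of_shortExact (c.shortComplex_shortExact C)
      ((c.resolution d).2.app ((c.K.mapHomologicalComplex _).obj C)) (ih _)
      (delta_zero_eq_ofHom (c.shortComplex C) _)

lemma boundedComplex_resolution (d : ℕ) (C : CochainComplex A ℤ) (hC : boundedComplex A C) :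
    boundedComplex A ((c.resolution d).1.obj C) := by
  induction d generalizing C with
  | zero => exact hC
  | succ d ih =>
    exact boundedComplex_mappingCone ((c.resolutionMap _ (c.resolution d).2).app C)
      (ih _ (boundedComplex_mapHomologicalComplex c.K hC))
      (boundedComplex_mapHomologicalComplex c.P hC)

/-- The iterates of the functor of kernels. -/
def iterK : ℕ → A → A
  | 0, X => X
  | d + 1, X => iterK d (c.K.obj X)

/-- Each term of the iterated cone is assembled by direct sums from values of `P` and one value of
the `d`-th iterated kernel; so the iterated kernels of the terms of `C` are the only objects for
which `Q` must be assumed. -/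
lemma resolution_X_mem (Q : ObjectProperty A) [Q.IsClosedUnderIsomorphisms]
    (hQ : ∀ X Y, Q X → Q Y → Q (X ⊞ Y)) (hP : ∀ X, Q (c.P.obj X)) (d : ℕ)
    (C : CochainComplex A ℤ) (h : ∀ n, Q (c.iterK d (C.X n))) (n : ℤ) :
    Q (((c.resolution d).1.obj C).X n) := by
  induction d generalizing C n with
  | zero => exact h n
  | succ d ih =>
    refine Q.prop_of_iso (HomologicalComplex.homotopyCofiber.XIsoBiprod ((c.resolutionMap _
      (c.resolution d).2).app C) n (n + 1) rfl).symm ?_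
    exact hQ _ _ (ih ((c.K.mapHomologicalComplex _).obj C) h _) (hP _)

end FunctorialCover

end Cover

end SteenrodTate

namespace SteenrodTate

/-! ### Functorial bounded resolutions by sheaves with flat stalks. -/

section FlatResolution

lemma flat_of_add_eq_id {R : Type*} [CommRing R] {M N L : Type*} [AddCommGroup M] [Module R M]
    [AddCommGroup N] [Module R N] [AddCommGroup L] [Module R L] [Module.Flat R M] [Module.Flat R N]
    (i₁ : M →ₗ[R] L) (p₁ : L →ₗ[R] M) (i₂ : N →ₗ[R] L) (p₂ : L →ₗ[R] N)
    (h : i₁ ∘ₗ p₁ + i₂ ∘ₗ p₂ = LinearMap.id) : Module.Flat R L := by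
  have : Module.Flat R (M × N) := by
    rw [Module.Flat.iff_rTensor_preserves_injective_linearMap]
    intro A B _ _ _ _ j hj
    have e (x) : TensorProduct.prodRight R R B M N (j.rTensor _ x) =
        Prod.map (j.rTensor M) (j.rTensor N) (TensorProduct.prodRight R R A M N x) := by
      induction x with
      | zero =>
        rw [map_zero, map_zero, map_zero]
        exact Prod.ext (map_zero _).symm (map_zero _).symm
      | add x y hx hy => 
        rw [map_add, map_add, map_add, hx, hy]
        exact Prod.ext (map_add _ _ _).symm (map_add _ _ _).symm
      | tmul a x => simp
    have : Function.Injective (Prod.map (j.rTensor M) (j.rTensor N) ∘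
        TensorProduct.prodRight R R A M N) :=
      ((Module.Flat.rTensor_preserves_injective_linearMap j hj).prodMap
        (Module.Flat.rTensor_preserves_injective_linearMap j hj)).comp (LinearEquiv.injective _)
    refine fun x y hxy => this ?_
    rw [Function.comp_apply, Function.comp_apply, ← e, ← e, hxy]
  exact Module.Flat.of_retract (p₁.prod p₂) (i₁.coprod i₂) (by rw [← h]; ext; simp)

variable {R : Type u} [CommRing R] {X : TopCat.{u}}

/-- The sheaf associated to the presheaf of formal linear combinations of sections. -/
noncomputable def freeSheaf (R : Type u) [CommRing R] (X : TopCat.{u}) : Sh R X ⥤ Sh R X :=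
  sheafToPresheaf _ _ ⋙ (Functor.whiskeringRight _ _ _).obj (reducedFree R) ⋙ presheafToSheaf _ _

instance : (freeSheaf R X).PreservesZeroMorphisms where
  map_zero F G := by
    have h : ((Functor.whiskeringRight _ _ _).obj (reducedFree R)).map
        ((sheafToPresheaf _ _).map (0 : F ⟶ G)) = 0 := by
      ext U : 2
      exact (reducedFree R).map_zero _ _
    refine (congrArg (presheafToSheaf _ _).map h).trans ?_
    exact (presheafToSheaf (Opens.grothendieckTopology X) (ModuleCat.{u} R)).map_zero _ _

/-- The evaluation of formal linear combinations of sections. -/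
noncomputable def freeSheafEval (R : Type u) [CommRing R] (X : TopCat.{u}) : freeSheaf R X ⟶ 𝟭 _ :=
  Functor.whiskerLeft (sheafToPresheaf _ _)
    (Functor.whiskerRight ((Functor.whiskeringRight _ _ _).map (reducedFreeEval R))
      (presheafToSheaf _ _)) ≫
    (sheafificationNatIso (Opens.grothendieckTopology X) (ModuleCat.{u} R)).inv

instance (F : Sh R X) : Epi ((freeSheafEval R X).app F) := by
  have (U : (Opens X)ᵒᵖ) : Epi ((((Functor.whiskeringRight (Opens X)ᵒᵖ _ _).map
      (reducedFreeEval R)).app F.obj).app U) :=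
    (ModuleCat.epi_iff_surjective _).2 (reducedFreeEval_surjective R _)
  have : Epi (((Functor.whiskeringRight (Opens X)ᵒᵖ _ _).map (reducedFreeEval R)).app F.obj) :=
    NatTrans.epi_of_epi_app _
  have h1 : Epi ((presheafToSheaf (Opens.grothendieckTopology X) (ModuleCat.{u} R)).map
    (((Functor.whiskeringRight (Opens X)ᵒᵖ _ _).map (reducedFreeEval R)).app F.obj)) :=
    inferInstance
  have h2 : Epi ((sheafificationNatIso (Opens.grothendieckTopology X)
    (ModuleCat.{u} R)).inv.app F) := inferInstance
  exact @epi_comp _ _ _ _ _ _ h1 _ h2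

/-- The cover of sheaves by free sheaves. -/
noncomputable def sheafCover (R : Type u) [CommRing R] (X : TopCat.{u}) :
    FunctorialCover (Sh R X) :=
  FunctorialCover.ofEpi (freeSheaf R X) (freeSheafEval R X)

/-- A sheaf with flat stalks. -/
def FlatSheaf (R : Type u) [CommRing R] (X : TopCat.{u}) : ObjectProperty (Sh R X) := fun F =>
  ∀ x : X, Module.Flat R (((pt x).sheafFiber (A := ModuleCat.{u} R)).obj F)

instance : (FlatSheaf R X).IsClosedUnderIsomorphisms where
  of_iso e h x :=
    have := h x
    Module.Flat.of_linearEquiv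
      (((pt x).sheafFiber (A := ModuleCat.{u} R)).mapIso e).symm.toLinearEquiv

lemma flatSheaf_biprod (F G : Sh R X) (hF : FlatSheaf R X F) (hG : FlatSheaf R X G) :
    FlatSheaf R X (F ⊞ G) := fun x => by
  have := hF x
  have := hG x
  let Φ := (pt x).sheafFiber (A := ModuleCat.{u} R)
  refine flat_of_add_eq_id (Φ.map biprod.inl).hom (Φ.map biprod.fst).hom (Φ.map biprod.inr).hom
    (Φ.map biprod.snd).hom ?_
  rw [← ModuleCat.hom_comp, ← ModuleCat.hom_comp, ← ModuleCat.hom_add, ← Functor.map_comp,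
    ← Functor.map_comp, ← Functor.map_add, biprod.total, CategoryTheory.Functor.map_id]
  rfl

lemma flatSheaf_freeSheaf (F : Sh R X) : FlatSheaf R X ((freeSheaf R X).obj F) := fun x => by
  have h := flat_presheafFiber (pt x) (F.obj ⋙ reducedFree R)
    fun U => inferInstanceAs (Module.Flat R ((reducedFree R).obj (F.obj.obj U)))
  exact Module.Flat.of_linearEquiv (((pt x).presheafToSheafCompSheafFiberIso
    (ModuleCat.{u} R)).app (F.obj ⋙ reducedFree R)).toLinearEquiv

/-- The cover sequence stays exact on stalks and its middle term is flat there, so dimension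
shifting applies. -/
lemma torVanishes_cover (d : ℕ) (F : Sh R X) (x : X)
    (h : TorVanishes (R := R) (d + 1) (((pt x).sheafFiber (A := ModuleCat.{u} R)).obj F)) :
    TorVanishes (R := R) d (((pt x).sheafFiber (A := ModuleCat.{u} R)).obj
      ((sheafCover R X).K.obj F)) := by
  have hS := ((sheafCover R X).shortExact F).map_of_exact
    ((pt x).sheafFiber (A := ModuleCat.{u} R))
  have h1 : Function.Injective (((pt x).sheafFiber (A := ModuleCat.{u} R)).map
      ((sheafCover R X).ι.app F)).hom := (ModuleCat.mono_iff_injective _).1 hS.mono_f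
  have h2 : Function.Surjective (((pt x).sheafFiber (A := ModuleCat.{u} R)).map
      ((sheafCover R X).ev.app F)).hom := (ModuleCat.epi_iff_surjective _).1 hS.epi_g
  have h3 : Function.Exact (((pt x).sheafFiber (A := ModuleCat.{u} R)).map
      ((sheafCover R X).ι.app F)).hom (((pt x).sheafFiber (A := ModuleCat.{u} R)).map
      ((sheafCover R X).ev.app F)).hom :=
    LinearMap.exact_iff.2 (((ShortComplex.moduleCat_exact_iff_range_eq_ker _).1 hS.exact).symm)
  have : Module.Flat R (((pt x).sheafFiber (A := ModuleCat.{u} R)).obj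
      ((sheafCover R X).P.obj F)) := flatSheaf_freeSheaf F x
  exact TorVanishes.of_exact h1 h3 h2 h

/-- Each kernel lowers the degree in which `Tor` is known to vanish by one. After `d` kernels it is
`Tor₁` that vanishes, which is flatness. -/
lemma flatSheaf_iterK (d : ℕ) (F : Sh R X)
    (h : ∀ x : X, TorVanishes (R := R) d (((pt x).sheafFiber (A := ModuleCat.{u} R)).obj F)) :
    FlatSheaf R X ((sheafCover R X).iterK d F) := by
  induction d generalizing F with
  | zero => exact fun x => flat_of_torVanishes (h x)
  | succ d ih => exact ih _ fun x => torVanishes_cover d F x (h x)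

lemma hasFlatStalks_iff (A : CochainComplex (Sh R X) ℤ) :
    HasFlatStalks A ↔ ∀ n, FlatSheaf R X (A.X n) :=
  ⟨fun h n x => h x n, fun h x n => h n x⟩

variable (R X) in
/-- Over a ring of finite weak dimension, bounded complexes have functorial bounded resolutions with
flat stalks. -/
lemma exists_flat_resolution (hR : HasFiniteWeakDimension R) :
    ∃ (r : (boundedComplex (Sh R X)).FullSubcategory ⥤ (boundedComplex (Sh R X)).FullSubcategory)
      (ε : r ⟶ 𝟭 _), (∀ A, boundedQuasiIso _ (ε.app A)) ∧ ∀ A, HasFlatStalks (r.obj A).obj := by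
  obtain ⟨d, hd⟩ := hR
  let c := sheafCover R X
  refine ⟨(boundedComplex (Sh R X)).lift ((boundedComplex (Sh R X)).ι ⋙ (c.resolution d).1)
    fun A => c.boundedComplex_resolution d A.obj A.property,
    { app A := ObjectProperty.homMk ((c.resolution d).2.app A.obj)
      naturality A B f := by
        ext : 1
        exact (c.resolution d).2.naturality f.hom }, fun A => c.quasiIso_resolution d A.obj,
    fun A => ?_⟩
  exact (hasFlatStalks_iff _).2 (c.resolution_X_mem (FlatSheaf R X) flatSheaf_biprod
    flatSheaf_freeSheaf d A.obj fun n => flatSheaf_iterK d _ fun x => torVanishes_of_isZero hd _)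

end FlatResolution

end SteenrodTate

namespace SteenrodTate

/-! ### Triangles of short exact sequences of bounded complexes. -/

section BoundedTriangles

variable {C : Type*} [Category* C] [Abelian C] [HasDerivedCategory C]

open DerivedCategory

/-- A bounded complex as an object of the category of bounded complexes. -/
abbrev bdd (K : CochainComplex C ℤ) (h : boundedComplex C K) : (boundedComplex C).FullSubcategory :=
  ⟨K, h⟩

/-- The connecting morphism of a short exact sequence of bounded complexes. -/
noncomputable def boundedδ {S : ShortComplex (CochainComplex C ℤ)} (hS : S.ShortExact)
    (h₁ : boundedComplex C S.X₁) (h₃ : boundedComplex C S.X₃) :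
    (boundedQ C).obj (bdd S.X₃ h₃) ⟶ ((boundedQ C).obj (bdd S.X₁ h₁))⟦(1 : ℤ)⟧ :=
  ObjectProperty.homMk (triangleOfSESδ hS ≫
    ((Bounded.ι (C := C)).commShiftIso (1 : ℤ)).inv.app ((boundedQ C).obj (bdd S.X₁ h₁)))

lemma boundedδ_distinguished {S : ShortComplex (CochainComplex C ℤ)} (hS : S.ShortExact)
    (h₁ : boundedComplex C S.X₁) (h₂ : boundedComplex C S.X₂) (h₃ : boundedComplex C S.X₃) :
    Pretriangulated.Triangle.mk
      ((boundedQ C).map (ObjectProperty.homMk S.f : bdd S.X₁ h₁ ⟶ bdd S.X₂ h₂))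
      ((boundedQ C).map (ObjectProperty.homMk S.g : bdd S.X₂ h₂ ⟶ bdd S.X₃ h₃))
      (boundedδ hS h₁ h₃) ∈ distTriang (Bounded C) := by
  rw [← (Bounded.ι (C := C)).map_distinguished_iff]
  refine Pretriangulated.isomorphic_distinguished _ (triangleOfSES_distinguished hS) _
    (Pretriangulated.Triangle.isoMk _ _ (Iso.refl _) (Iso.refl _) (Iso.refl _) ?_ ?_ ?_)
  · exact (Category.comp_id _).trans (Category.id_comp _).symm
  · exact (Category.comp_id _).trans (Category.id_comp _).symm
  · have h : (triangleOfSESδ hS ≫ ((Bounded.ι (C := C)).commShiftIso (1 : ℤ)).inv.app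
        ((boundedQ C).obj (bdd S.X₁ h₁))) ≫ ((Bounded.ι (C := C)).commShiftIso (1 : ℤ)).hom.app
        ((boundedQ C).obj (bdd S.X₁ h₁)) = triangleOfSESδ hS :=
      (Category.assoc _ _ _).trans ((congrArg (triangleOfSESδ hS ≫ ·)
        (Iso.inv_hom_id_app ((Bounded.ι (C := C)).commShiftIso (1 : ℤ))
          ((boundedQ C).obj (bdd S.X₁ h₁)))).trans (Category.comp_id _))
    exact (congrArg (_ ≫ ·) (CategoryTheory.Functor.map_id _ _)).trans ((Category.comp_id _).trans
      (h.trans (Category.id_comp _).symm))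

lemma boundedδ_naturality {S S' : ShortComplex (CochainComplex C ℤ)} (hS : S.ShortExact)
    (hS' : S'.ShortExact) (f : S ⟶ S') (h₁ : boundedComplex C S.X₁) (h₃ : boundedComplex C S.X₃)
    (h₁' : boundedComplex C S'.X₁) (h₃' : boundedComplex C S'.X₃) :
    boundedδ hS h₁ h₃ ≫
      ((boundedQ C).map (ObjectProperty.homMk f.τ₁ : bdd S.X₁ h₁ ⟶ bdd S'.X₁ h₁'))⟦(1 : ℤ)⟧' =
    (boundedQ C).map (ObjectProperty.homMk f.τ₃ : bdd S.X₃ h₃ ⟶ bdd S'.X₃ h₃') ≫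
      boundedδ hS' h₁' h₃' := by
  ext
  change (triangleOfSESδ hS ≫ _) ≫ (Bounded.ι (C := C)).map _ = Q.map f.τ₃ ≫ triangleOfSESδ hS' ≫ _
  exact (Category.assoc _ _ _).trans ((congrArg (triangleOfSESδ hS ≫ ·)
    (((Bounded.ι (C := C)).commShiftIso (1 : ℤ)).inv.naturality ((boundedQ C).map
      (ObjectProperty.homMk f.τ₁ : bdd S.X₁ h₁ ⟶ bdd S'.X₁ h₁'))).symm).trans
    ((Category.assoc _ _ _).symm.trans ((congrArg (· ≫ _)
      (triangleOfSESδ_naturality hS hS' f)).trans (Category.assoc _ _ _))))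

end BoundedTriangles

/-! ### Vanishing after inverting `ħ`. -/

section TateVanishing

variable {R : Type u} [CommRing R] {p : ℕ} [NeZero p] {Y : Type u} [TopologicalSpace Y]
  [MulAction (Mu p) Y] [ContinuousConstSMul (Mu p) Y]

lemma hbar_app_Q (K : CochainComplex (EqSh R (Mu p) Y) ℤ) :
    (hbar R p Y).app (DerivedCategory.Q.obj K) = (hbarQ R p Y).app K := by
  refine (Localization.liftNatTrans_app ..).trans ?_
  exact (Category.id_comp _).trans (Category.comp_id _)

/-- Steenrod's category `D^b_{μ_p}(Y, R)[ħ⁻¹]` as a target of the category of bounded complexes. -/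
noncomputable abbrev tateQ (R : Type u) [CommRing R] (p : ℕ) [NeZero p] (Y : Type u)
    [TopologicalSpace Y] [MulAction (Mu p) Y] [ContinuousConstSMul (Mu p) Y] :
    (boundedComplex (EqSh R (Mu p) Y)).FullSubcategory ⥤ TateDb R p Y :=
  boundedQ _ ⋙ toTateDb R p Y

/-- A splitting of the augmentation kills the connecting morphism `K ⟶ (K ⊗ I)[1]`, the first factor
of `ħ`. So `ħ` is zero on `K`; as it becomes an isomorphism in the quotient, `K` becomes zero. -/
lemma isZero_toTateDb_of_splitEpi (K : CochainComplex (EqSh R (Mu p) Y) ℤ)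
    (hK : boundedComplex _ K) (h : IsSplitEpi ((sheafifiedMap (augMap R p Y)).app K)) :
    IsZero ((tateQ R p Y).obj (bdd K hK)) := by
  have hd : DerivedCategory.triangleOfSESδ (sheafSES₁_shortExact K) = 0 := by
    have := Pretriangulated.comp_distTriang_mor_zero₂₃ _
      (DerivedCategory.triangleOfSES_distinguished (sheafSES₁_shortExact K))
    have h2 : IsSplitEpi (DerivedCategory.Q.map (sheafSES₁ K).g) :=
      inferInstanceAs (IsSplitEpi (DerivedCategory.Q.map ((sheafifiedMap (augMap R p Y)).app K)))
    rw [← cancel_epi (DerivedCategory.Q.map (sheafSES₁ K).g), comp_zero]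
    exact this
  have h1 : (hbarQ R p Y).app K = 0 := by
    change _ ≫ DerivedCategory.triangleOfSESδ (sheafSES₁_shortExact K) ≫ _ = 0
    exact (congrArg (_ ≫ ·) ((congrArg (· ≫ _) hd).trans zero_comp)).trans comp_zero
  have h2 : (hbarBounded R p Y).app ((boundedQ (EqSh R (Mu p) Y)).obj (bdd K hK)) = 0 := by
    ext
    change (hbar R p Y).app (DerivedCategory.Q.obj K) ≫ _ = 0
    exact (congrArg (· ≫ _) ((hbar_app_Q K).trans h1)).trans zero_comp
  have h3 := isIso_toTateDb_map_hbar ((boundedQ (EqSh R (Mu p) Y)).obj (bdd K hK))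
  rw [h2, Functor.map_zero] at h3
  exact (IsZero.iff_id_eq_zero _).2 (isIsoZeroEquiv _ _ h3).1

end TateVanishing

end SteenrodTate

namespace SteenrodTate

/-! ### Relatively projective sheaves. -/

section RelativelyProjective

variable {R : Type u} [CommRing R] {p : ℕ} [NeZero p] {Y : Type u} [TopologicalSpace Y]
  [MulAction (Mu p) Y] [ContinuousConstSMul (Mu p) Y]

/-- The sheafified augmentation `F ⊗ R[μ_p] ⟶ F`. -/
noncomputable abbrev sheafAug (R : Type u) [CommRing R] (p : ℕ) [NeZero p] (Y : Type u)
    [TopologicalSpace Y] [MulAction (Mu p) Y] [ContinuousConstSMul (Mu p) Y] :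
    sheafified R p Y (regular R p Y) ⟶ sheafified R p Y (𝟭 _) :=
  Functor.whiskerLeft (sheafToPresheaf _ _) (Functor.whiskerRight (augMap R p Y)
    (presheafToSheaf (EqOpens.topology (Mu p) Y) (ModuleCat.{u} R)))

/-- An equivariant sheaf is relatively projective if the augmentation `F ⊗ R[μ_p] ⟶ F` is a split
epimorphism. -/
def RelProj (R : Type u) [CommRing R] (p : ℕ) [NeZero p] (Y : Type u)
    [TopologicalSpace Y] [MulAction (Mu p) Y] [ContinuousConstSMul (Mu p) Y] :
    ObjectProperty (EqSh R (Mu p) Y) := fun F => IsSplitEpi ((sheafAug R p Y).app F)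

instance : (RelProj R p Y).IsClosedUnderIsomorphisms where
  of_iso {F G} e h := by
    have : IsSplitEpi ((sheafAug R p Y).app F) := h
    refine IsSplitEpi.mk' ⟨(sheafified R p Y (𝟭 _)).map e.inv ≫ section_ ((sheafAug R p Y).app F) ≫
      (sheafified R p Y (regular R p Y)).map e.hom, ?_⟩
    rw [Category.assoc, Category.assoc, (sheafAug R p Y).naturality, IsSplitEpi.id_assoc,
      ← Functor.map_comp, e.inv_hom_id, CategoryTheory.Functor.map_id]

lemma relProj_of_isZero {F : EqSh R (Mu p) Y} (h : IsZero F) : RelProj R p Y F :=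
  IsSplitEpi.mk' ⟨0, ((sheafified R p Y (𝟭 _)).map_isZero h).eq_of_tgt _ _⟩

/-- The section over the presheaf is carried to its sheafification along the unit, which
sheafification turns into an isomorphism. -/
lemma relProj_presheafToSheaf {P : EqPsh R p Y} (s : P ⟶ (regular R p Y).obj P)
    (hs : s ≫ (augMap R p Y).app P = 𝟙 P) :
    RelProj R p Y ((presheafToSheaf (EqOpens.topology (Mu p) Y) (ModuleCat.{u} R)).obj P) := by
  let a := presheafToSheaf (EqOpens.topology (Mu p) Y) (ModuleCat.{u} R)
  let η := (sheafificationAdjunction (EqOpens.topology (Mu p) Y) (ModuleCat.{u} R)).unit.app P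
  have hη : IsIso (a.map η) := inferInstance
  refine IsSplitEpi.mk' ⟨inv (a.map η) ≫ a.map s ≫ a.map ((regular R p Y).map η), ?_⟩
  change (inv (a.map η) ≫ a.map s ≫ a.map ((regular R p Y).map η)) ≫
    a.map ((augMap R p Y).app _) = _
  rw [Category.assoc, Category.assoc, ← Functor.map_comp, (augMap R p Y).naturality,
    ← Functor.map_comp, reassoc_of% hs]
  exact IsIso.inv_hom_id _

lemma isSplitEpi_sheafifiedMap_presheafToSheaf {P : CochainComplex (EqPsh R p Y) ℤ}
    (s : P ⟶ ((regular R p Y).mapHomologicalComplex _).obj P)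
    (hs : ∀ n, s.f n ≫ (augMap R p Y).app (P.X n) = 𝟙 _) :
    IsSplitEpi ((sheafifiedMap (augMap R p Y)).app
      (((presheafToSheaf (EqOpens.topology (Mu p) Y)
        (ModuleCat.{u} R)).mapHomologicalComplex _).obj P)) := by
  let a := presheafToSheaf (EqOpens.topology (Mu p) Y) (ModuleCat.{u} R)
  let η (n : ℤ) : P.X n ⟶ (a.obj (P.X n)).obj :=
    (sheafificationAdjunction (EqOpens.topology (Mu p) Y) (ModuleCat.{u} R)).unit.app (P.X n)
  have hη (n : ℤ) : IsIso (a.map (η n)) :=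
    inferInstanceAs (IsIso ((presheafToSheaf (EqOpens.topology (Mu p) Y) (ModuleCat.{u} R)).map
      ((sheafificationAdjunction (EqOpens.topology (Mu p) Y) (ModuleCat.{u} R)).unit.app (P.X n))))
  let t (n : ℤ) : P.X n ⟶ (regular R p Y).obj (P.X n) := s.f n
  have ht (i j : ℤ) : t i ≫ (regular R p Y).map (P.d i j) = P.d i j ≫ t j := s.comm i j
  have hs' (n : ℤ) : t n ≫ (augMap R p Y).app (P.X n) = 𝟙 _ := hs n
  have nat (i j : ℤ) : η i ≫ (a.map (P.d i j)).hom = P.d i j ≫ η j :=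
    ((sheafificationAdjunction (EqOpens.topology (Mu p) Y)
      (ModuleCat.{u} R)).unit.naturality (P.d i j)).symm
  let σ (n : ℤ) : a.obj (a.obj (P.X n)).obj ⟶ a.obj ((regular R p Y).obj (a.obj (P.X n)).obj) :=
    inv (a.map (η n)) ≫ a.map (t n) ≫ a.map ((regular R p Y).map (η n))
  refine IsSplitEpi.mk' ⟨
    { f n := σ n
      comm' i j _ := ?_ }, ?_⟩
  · have e1 : a.map (t i) ≫ a.map ((regular R p Y).map (η i)) ≫
        a.map ((regular R p Y).map (a.map (P.d i j)).hom) =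
        a.map (P.d i j) ≫ a.map (t j) ≫ a.map ((regular R p Y).map (η j)) := by
      rw [← a.map_comp, ← a.map_comp, ← a.map_comp, ← a.map_comp, ← (regular R p Y).map_comp, nat,
        (regular R p Y).map_comp, reassoc_of% (ht i j)]
    have e2 : a.map (a.map (P.d i j)).hom ≫ inv (a.map (η j)) = inv (a.map (η i)) ≫ a.map (P.d i j) := by
      rw [IsIso.comp_inv_eq, Category.assoc, IsIso.eq_inv_comp, ← a.map_comp, ← a.map_comp, nat]
    change (inv (a.map (η i)) ≫ a.map (t i) ≫ a.map ((regular R p Y).map (η i))) ≫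
        a.map ((regular R p Y).map (a.map (P.d i j)).hom) = a.map (a.map (P.d i j)).hom ≫
      inv (a.map (η j)) ≫ a.map (t j) ≫ a.map ((regular R p Y).map (η j))
    rw [reassoc_of% e2, Category.assoc, Category.assoc, e1]
  · ext n : 1
    change (inv (a.map (η n)) ≫ a.map (t n) ≫ a.map ((regular R p Y).map (η n))) ≫
      a.map ((augMap R p Y).app _) = _
    rw [Category.assoc, Category.assoc, ← Functor.map_comp, (augMap R p Y).naturality,
      ← Functor.map_comp, reassoc_of% (hs' n)]
    exact IsIso.inv_hom_id _

lemma isSplitEpi_of_d_eq_zero (K : CochainComplex (EqSh R (Mu p) Y) ℤ) (hd : ∀ i j, K.d i j = 0)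
    (h : ∀ n, RelProj R p Y (K.X n)) : IsSplitEpi ((sheafifiedMap (augMap R p Y)).app K) := by
  have h' (n : ℤ) : IsSplitEpi ((sheafAug R p Y).app (K.X n)) := h n
  refine IsSplitEpi.mk' ⟨
    { f n := (h' n).exists_splitEpi.some.section_
      comm' i j _ := ?_ }, ?_⟩
  · change _ ≫ (sheafified R p Y (regular R p Y)).map (K.d i j) =
      (sheafified R p Y (𝟭 _)).map (K.d i j) ≫ _
    rw [hd, Functor.map_zero, Functor.map_zero, comp_zero, zero_comp]
  · ext n : 1
    exact (h' n).exists_splitEpi.some.id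

/-- The degreewise sections need not commute with the differentials, so the augmentation of the
whole complex may fail to split. The complex is therefore peeled off term by term: for complexes
with zero differential any choice of sections is a chain map, and the quotient is closed under
extensions of zero objects. -/
lemma isZero_tateQ_of_relProj_of_bounds (n : ℕ) (a : ℤ) (K : CochainComplex (EqSh R (Mu p) Y) ℤ)
    (hK : boundedComplex _ K) [K.IsStrictlyGE a] [K.IsStrictlyLE (a + n)]
    (h : ∀ n, RelProj R p Y (K.X n)) : IsZero ((tateQ R p Y).obj (bdd K hK)) := by
  induction n generalizing a K with
  | zero =>
    refine isZero_toTateDb_of_splitEpi K hK (isSplitEpi_of_d_eq_zero K (fun i j => ?_) h)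
    by_cases hij : (ComplexShape.up ℤ).Rel i j
    · have hij : i + 1 = j := hij
      by_cases hi : i < a
      · exact (K.isZero_of_isStrictlyGE a i hi).eq_of_src _ _
      · exact (K.isZero_of_isStrictlyLE (a + (0 : ℕ)) j (by simp; lia)).eq_of_tgt _ _
    · exact K.shape _ _ hij
  | succ n ih =>
    let S : CochainComplex (EqSh R (Mu p) Y) ℤ :=
      (HomologicalComplex.single _ (ComplexShape.up ℤ) a).obj (K.X a)
    let f : K ⟶ S := HomologicalComplex.mkHomToSingle (𝟙 (K.X a)) (fun i hi =>
      (K.isZero_of_isStrictlyGE a i (by have : i + 1 = a := hi; lia)).eq_of_src _ _)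
    have hfa : IsIso (f.f a) := by
      have : f.f a = _ := HomologicalComplex.mkHomToSingle_f _ _
      rw [this]
      infer_instance
    have hS (i : ℤ) (hi : i ≠ a) : IsZero (S.X i) :=
      HomologicalComplex.isZero_single_obj_X _ _ _ _ hi
    have : Epi f := HomologicalComplex.epi_of_epi_f _ fun i => by
      by_cases hi : i = a
      · subst hi; infer_instance
      · exact ⟨fun _ _ _ => (hS i hi).eq_of_src _ _⟩
    -- The map to the lowest term is an isomorphism in degree `a`, so its kernel is the brutal
    -- truncation to degrees above `a`, and is one term shorter.
    let T := ShortComplex.mk (kernel.ι f) f (kernel.condition f)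
    have hT : T.ShortExact := ⟨ShortComplex.exact_kernel f⟩
    have hTi (i : ℤ) := hT.map_of_exact (HomologicalComplex.eval _ _ i)
    have hiso (i : ℤ) (hi : i ≠ a) : IsIso ((kernel.ι f).f i) := by
      have h1 : Mono ((kernel.ι f).f i) := (hTi i).mono_f
      have h2 : Epi ((kernel.ι f).f i) := (hTi i).exact.epi_f ((hS i hi).eq_of_tgt _ _)
      exact isIso_of_mono_of_epi _
    have hza : IsZero ((kernel f).X a) := by
      have h1 : Mono ((kernel.ι f).f a) := (hTi a).mono_f
      have h0 : (kernel.ι f).f a = 0 := by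
        rw [← cancel_mono (f.f a), zero_comp]
        exact (T.map (HomologicalComplex.eval _ _ a)).zero
      rw [IsZero.iff_id_eq_zero, ← cancel_mono ((kernel.ι f).f a), h0, comp_zero, comp_zero]
    have hGE : (kernel f).IsStrictlyGE (a + 1) := by
      rw [CochainComplex.isStrictlyGE_iff]
      intro i hi
      rcases (Int.lt_add_one_iff.1 hi).lt_or_eq with hi | rfl
      · have := hiso i hi.ne
        exact (K.isZero_of_isStrictlyGE a i hi).of_iso (asIso ((kernel.ι f).f i))
      · exact hza
    have hLE : (kernel f).IsStrictlyLE (a + 1 + n) := by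
      rw [CochainComplex.isStrictlyLE_iff]
      intro i hi
      have := hiso i (by lia)
      exact (K.isZero_of_isStrictlyLE (a + (n + 1 : ℕ)) i (by push_cast; lia)).of_iso
        (asIso ((kernel.ι f).f i))
    have hker : boundedComplex _ (kernel f) := ⟨_, _, hGE, hLE⟩
    have hSb : boundedComplex _ S := by
      refine ⟨a, a, ?_, ?_⟩
      · rw [CochainComplex.isStrictlyGE_iff]
        exact fun i hi => hS i hi.ne
      · rw [CochainComplex.isStrictlyLE_iff]
        exact fun i hi => hS i hi.ne'
    have z1 := ih (a + 1) (kernel f) hker fun i => by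
      by_cases hi : i = a
      · subst hi; exact relProj_of_isZero hza
      · have := hiso i hi
        exact (RelProj R p Y).prop_of_iso (asIso ((kernel.ι f).f i)).symm (h i)
    have z3 : IsZero ((tateQ R p Y).obj (bdd S hSb)) := by
      refine isZero_toTateDb_of_splitEpi S hSb (isSplitEpi_of_d_eq_zero S
        (fun i j => HomologicalComplex.single_obj_d ..) fun i => ?_)
      by_cases hi : i = a
      · subst hi
        exact (RelProj R p Y).prop_of_iso (asIso (f.f i)) (h i)
      · exact relProj_of_isZero (hS i hi)
    exact Pretriangulated.Triangle.isZero₂_of_isZero₁₃ _ ((toTateDb R p Y).map_distinguished _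
      (boundedδ_distinguished hT hker hK hSb)) z1 z3

lemma isZero_tateQ_of_relProj (K : CochainComplex (EqSh R (Mu p) Y) ℤ)
    (hK : boundedComplex _ K) (h : ∀ n, RelProj R p Y (K.X n)) :
    IsZero ((tateQ R p Y).obj (bdd K hK)) := by
  obtain ⟨a, b, ha, hb⟩ := id hK
  have : K.IsStrictlyLE (a + (b - a).toNat) := K.isStrictlyLE_of_le b _ (by lia)
  exact isZero_tateQ_of_relProj_of_bounds (b - a).toNat a K hK h

end RelativelyProjective

end SteenrodTate

namespace SteenrodTate

/-! ### Induced objects vanish, and `p` annihilates the quotient. -/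

section Torsion

variable {R : Type u} [CommRing R] {p : ℕ} [NeZero p] {Y : Type u} [TopologicalSpace Y]
  [MulAction (Mu p) Y] [ContinuousConstSMul (Mu p) Y]

/-- The splitting of the augmentation `F ⊗ R[μ_p] ⊗ R[μ_p] ⟶ F ⊗ R[μ_p]`. -/
def regularSection (R : Type u) [CommRing R] (p : ℕ) [NeZero p] (Y : Type u) [TopologicalSpace Y]
    [MulAction (Mu p) Y] [ContinuousConstSMul (Mu p) Y] :
    regular R p Y ⟶ regular R p Y ⋙ regular R p Y where
  app F :=
    { app U := ModuleCat.ofHom (LinearMap.pi fun j =>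
        LinearMap.single R (fun _ : Fin p => F.obj U) j ∘ₗ LinearMap.proj j)
      naturality U V f := by
        refine ModuleCat.hom_ext (LinearMap.ext fun (v : Fin p → F.obj U) => funext fun j =>
          funext fun k => ?_)
        change (Pi.single j (F.map f (v (j + f.unop.g.toAdd))) : Fin p → F.obj V) k =
          F.map f ((Pi.single (j + f.unop.g.toAdd) (v (j + f.unop.g.toAdd)) : Fin p → F.obj U)
            (k + f.unop.g.toAdd))
        by_cases h : k = j
        · subst h; simp
        · rw [Pi.single_eq_of_ne h, Pi.single_eq_of_ne (by simpa using h), map_zero] }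
  naturality F G τ := by
    ext U : 2
    refine ModuleCat.hom_ext (LinearMap.ext fun (v : Fin p → F.obj U) => funext fun j =>
      funext fun k => ?_)
    change (Pi.single j (τ.app U (v (j + 0))) : Fin p → G.obj U) k =
      τ.app U ((Pi.single (j + 0) (v (j + 0)) : Fin p → F.obj U) (k + 0))
    rw [add_zero, add_zero]
    by_cases h : k = j
    · subst h; simp
    · rw [Pi.single_eq_of_ne h, Pi.single_eq_of_ne h, map_zero]

lemma regularSection_augMap (F : EqPsh R p Y) :
    (regularSection R p Y).app F ≫ (augMap R p Y).app ((regular R p Y).obj F) = 𝟙 _ := by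
  ext U : 2
  refine ModuleCat.hom_ext (LinearMap.ext fun (v : Fin p → F.obj U) => ?_)
  change ∑ j, (Pi.single j (v j) : Fin p → F.obj U) = v
  exact Finset.univ_sum_single v

lemma normMap_augMap (F : EqPsh R p Y) :
    (normMap R p Y).app F ≫ (augMap R p Y).app F = p • 𝟙 F := by
  ext U : 2
  refine ModuleCat.hom_ext (LinearMap.ext fun (v : F.obj U) => ?_)
  have h : ∑ _j : Fin p, v = p • v := by simp
  refine h.trans ?_
  simp

/-- On induced objects the diagonal section of the augmentation is natural, hence compatible with
the differentials, and no dévissage is needed. -/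
lemma isZero_tateQ_regular (K : CochainComplex (EqSh R (Mu p) Y) ℤ)
    (hK' : boundedComplex _ ((sheafifiedComplex R p Y (regular R p Y)).obj K)) :
    IsZero ((tateQ R p Y).obj (bdd _ hK')) :=
  isZero_toTateDb_of_splitEpi _ hK' (isSplitEpi_sheafifiedMap_presheafToSheaf
    (P := ((regular R p Y).mapHomologicalComplex _).obj
      (((sheafToPresheaf _ _).mapHomologicalComplex _).obj K))
    ((NatTrans.mapHomologicalComplex (regularSection R p Y) _).app
      (((sheafToPresheaf _ _).mapHomologicalComplex _).obj K))
    fun _ => regularSection_augMap _)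

instance {C : Type*} [Category* C] [Abelian C] [HasDerivedCategory C] : (boundedQ C).Additive where
  map_add {K L f g} := by
    ext
    exact DerivedCategory.Q.map_add (f := f.hom) (g := g.hom)

/-- The norm followed by the augmentation is multiplication by `p`, so this multiplication factors
through the induced object, which is zero in the quotient. -/
lemma nsmul_id_tateQ (K : (boundedComplex (EqSh R (Mu p) Y)).FullSubcategory) :
    p • 𝟙 ((tateQ R p Y).obj K) = 0 := by
  let T (F : EqPsh R p Y ⥤ EqPsh R p Y) [F.Additive] :
      (boundedComplex (EqSh R (Mu p) Y)).FullSubcategory :=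
    bdd ((sheafifiedComplex R p Y F).obj K.obj)
      (boundedComplex_mapHomologicalComplex _ K.property)
  let f₁ : K ⟶ T (𝟭 _) := ObjectProperty.homMk ((sheafifiedIdIso R p Y).hom.app K.obj)
  let f₂ : T (𝟭 _) ⟶ T (regular R p Y) :=
    ObjectProperty.homMk ((sheafifiedMap (normMap R p Y)).app K.obj)
  let f₃ : T (regular R p Y) ⟶ T (𝟭 _) :=
    ObjectProperty.homMk ((sheafifiedMap (augMap R p Y)).app K.obj)
  let f₄ : T (𝟭 _) ⟶ K := ObjectProperty.homMk ((sheafifiedIdIso R p Y).inv.app K.obj)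
  have h23 : f₂ ≫ f₃ = p • 𝟙 _ := by
    ext n : 2
    change (presheafToSheaf _ _).map ((normMap R p Y).app _) ≫
      (presheafToSheaf _ _).map ((augMap R p Y).app _) = _
    rw [← Functor.map_comp, normMap_augMap, Functor.map_nsmul]
    exact congrArg (p • ·) (CategoryTheory.Functor.map_id _ _)
  have h14 : f₁ ≫ f₄ = 𝟙 K := by
    ext1
    exact (sheafifiedIdIso R p Y).hom_inv_id_app K.obj
  have h : f₁ ≫ f₂ ≫ f₃ ≫ f₄ = p • 𝟙 K := by
    rw [← Category.assoc f₂, h23, Preadditive.nsmul_comp, Preadditive.comp_nsmul, Category.id_comp, h14]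
  have h' := congrArg (tateQ R p Y).map h
  rw [Functor.map_nsmul, CategoryTheory.Functor.map_id, Functor.map_comp, Functor.map_comp,
    (isZero_tateQ_regular K.obj _).eq_of_tgt ((tateQ R p Y).map f₂) 0, zero_comp,
    comp_zero] at h'
  exact h'.symm

lemma smul_eq_zero_of_tateDb {K L : TateDb R p Y} (f : K ⟶ L) : (p : R) • f = 0 := by
  have : (tateQ R p Y).EssSurj := inferInstance
  let e := (tateQ R p Y).objObjPreimageIso K
  have h : p • 𝟙 K = 0 := by
    rw [← e.inv_hom_id, ← Preadditive.comp_nsmul, ← Category.id_comp e.hom, ← Preadditive.nsmul_comp,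
      nsmul_id_tateQ, zero_comp, comp_zero]
  rw [Nat.cast_smul_eq_nsmul, ← Category.id_comp f, ← Preadditive.nsmul_comp, h, zero_comp]

end Torsion

end SteenrodTate

namespace SteenrodTate

/-! ### Barycentres of proper subsets of `ℤ/p`. -/

section Combinatorics

/-- A subset of `ℤ/p` that is neither empty nor everything, given by its indicator function. -/
def IsProperSubset {p : ℕ} (S : Fin p → Bool) : Prop := (∃ l, S l = true) ∧ ∃ l, S l = false

lemma isProperSubset_comp {p : ℕ} (S : Fin p → Bool) (e : Equiv.Perm (Fin p)) :
    IsProperSubset (S ∘ e) ↔ IsProperSubset S :=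
  and_congr (e.surjective.exists (p := fun l => S l = true)).symm
    (e.surjective.exists (p := fun l => S l = false)).symm

/-- A proper subset of `ℤ/p` has a barycentre, which is equivariant under translation. -/
lemma exists_barycentre (p : ℕ) [Fact p.Prime] : ∃ c : (Fin p → Bool) → Fin p,
    ∀ (S : Fin p → Bool) (_ : IsProperSubset S) (j : Fin p),
      c (S ∘ Equiv.addRight j) = c S - j := by
  -- For `p = n + 1`, `Fin p` is definitionally `ZMod p`, which is a field because `p` is prime; the
  -- barycentre requires division.
  obtain ⟨n, rfl⟩ := Nat.exists_eq_succ_of_ne_zero (Fact.out : p.Prime).ne_zero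
  let c (S : ZMod (n + 1) → Bool) : ZMod (n + 1) :=
    (∑ l, if S l then l else 0) / ((Finset.univ.filter fun l => S l = true).card : ZMod (n + 1))
  suffices h : ∀ (S : ZMod (n + 1) → Bool) (_ : (∃ l, S l = true) ∧ ∃ l, S l = false) (j : ZMod (n + 1)),
      c (S ∘ Equiv.addRight j) = c S - j from ⟨c, h⟩
  rintro S ⟨⟨l, hl⟩, ⟨m, hm⟩⟩ j
  have e1 : (Finset.univ.filter fun l => (S ∘ Equiv.addRight j) l = true).card =
      (Finset.univ.filter fun l => S l = true).card := by
    refine Finset.card_equiv (Equiv.addRight j) fun l => ?_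
    exact ⟨fun h => Finset.mem_filter.2 ⟨Finset.mem_univ _, (Finset.mem_filter.1 h).2⟩,
      fun h => Finset.mem_filter.2 ⟨Finset.mem_univ _, (Finset.mem_filter.1 h).2⟩⟩
  have e2 : (∑ l, if (S ∘ Equiv.addRight j) l then l else 0) =
      (∑ l, if S l then l else 0) - (Finset.univ.filter fun l => S l = true).card * j := by
    have : (Finset.univ.filter fun l => S l = true).card * j = ∑ l, if S l then j else 0 := by
      rw [← Finset.sum_filter, Finset.sum_const, nsmul_eq_mul]
    rw [this, ← Finset.sum_sub_distrib]
    refine Fintype.sum_equiv (Equiv.addRight j) _ _ fun l => ?_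
    by_cases h : S (l + j) <;> simp [h]
  -- A proper subset has between `1` and `p - 1` elements, so its cardinality is invertible modulo
  -- `p`.
  have hk : ((Finset.univ.filter fun l => S l = true).card : ZMod (n + 1)) ≠ 0 := by
    rw [Ne, ZMod.natCast_eq_zero_iff]
    refine Nat.not_dvd_of_pos_of_lt (Finset.card_pos.2 ⟨l, by simpa using hl⟩) ?_
    have := Finset.card_lt_univ_of_notMem (s := Finset.univ.filter fun l => S l = true) (x := m)
      (by simpa using hm)
    rwa [ZMod.card] at this
  simp only [c]
  rw [e1, e2, sub_div, mul_div_cancel_left₀ _ hk]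

end Combinatorics

/-! ### Expansion of a tensor power along a pair of complementary idempotents. -/

section Graded

variable {R : Type u} [CommRing R] {ι : Type} [Fintype ι] [LinearOrder ι]
  {K K' L L' : ι → CochainComplex (ModuleCat.{u} R) ℤ}

lemma tensorPermX_tensorGraded (e : Equiv.Perm ι) (φ : ∀ l, K (e l) ⟶ K' l)
    (φ' : ∀ l, L (e l) ⟶ L' l) (ψ : ∀ l a, (K l).X a →ₗ[R] (L l).X a)
    (ψ' : ∀ l a, (K' l).X a →ₗ[R] (L' l).X a)
    (h : ∀ l a x, (φ' l).f a (ψ (e l) a x) = ψ' l a ((φ l).f a x)) (n : ℤ) (z : tensorX K n) :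
    tensorPermX e φ' n (tensorGraded ψ n z) = tensorGraded ψ' n (tensorPermX e φ n z) := by
  have : tensorPermX e φ' n ∘ₗ tensorGraded ψ n = tensorGraded ψ' n ∘ₗ tensorPermX e φ n := by
    refine tensorX_hom_ext fun i hi x => ?_
    rw [LinearMap.comp_apply, LinearMap.comp_apply, tensorGraded_incl, PiTensorProduct.map_tprod,
      tensorPermX_incl, tensorPermX_incl, map_zsmul, tensorGraded_incl, PiTensorProduct.map_tprod]
    congr 3
    exact funext fun l => h l _ _
  exact LinearMap.congr_fun this z

/-- Multilinear expansion of the tensor product of the identities `E true + E false`. -/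
lemma sum_tensorGraded (E : Bool → ∀ l a, (K l).X a →ₗ[R] (K l).X a)
    (hE : ∀ l a x, E true l a x + E false l a x = x) (n : ℤ) :
    ∑ S : ι → Bool, tensorGraded (fun l => E (S l) l) n = LinearMap.id := by
  refine tensorX_hom_ext fun i hi x => ?_
  rw [LinearMap.sum_apply]
  simp only [tensorGraded_incl, PiTensorProduct.map_tprod]
  rw [← map_sum, ← MultilinearMap.map_sum (PiTensorProduct.tprod R) fun l b => E b l (i l) (x l)]
  rw [LinearMap.id_apply]
  congr 2
  funext l
  rw [Fintype.sum_bool]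
  exact hE l _ _

end Graded

end SteenrodTate

namespace SteenrodTate

/-! ### The section of the augmentation on mixed tensors. -/

section GradedPresheaf

variable {R : Type u} [CommRing R] {X : TopCat.{u}} {p : ℕ} [NeZero p]
  {A B C : CochainComplex (Sh R X) ℤ}

/-- The maps on sections over the projections of an open set given by a family of maps of
sheaves. -/
def gradedSections (ψ : ∀ a, A.X a ⟶ B.X a) (U : EqOpens (Mu p) (MuPower p X)) (l : Fin p) (a : ℤ) :
    (((sectionsComplex X).obj (op (proj U l))).obj A).X a →ₗ[R]
      (((sectionsComplex X).obj (op (proj U l))).obj B).X a :=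
  ((ψ a).hom.app (op (proj U l))).hom

lemma gradedSections_restrict (ψ : ∀ a, A.X a ⟶ B.X a) {U V : EqOpens (Mu p) (MuPower p X)}
    (f : V ⟶ U) (l : Fin p) (a : ℤ) (x) :
    (((sectionsComplex X).map (homOfLE (proj_le f l)).op).app B).f a
        (gradedSections ψ U (rotation f.g l) a x) =
      gradedSections ψ V l a ((((sectionsComplex X).map (homOfLE (proj_le f l)).op).app A).f a x) :=
  (ConcreteCategory.congr_hom ((ψ a).hom.naturality (homOfLE (proj_le f l)).op) x).symm

/-- The map between external tensor powers, as graded presheaves, given by a family of maps of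
sheaves that need not commute with the differentials. -/
noncomputable def tensorPshGraded (p : ℕ) [NeZero p] (ψ : ∀ a, A.X a ⟶ B.X a) (n : ℤ) :
    (tensorPsh p A).X n ⟶ (tensorPsh p B).X n where
  app U := ModuleCat.ofHom (tensorGraded (gradedSections ψ U.unop) n)
  naturality U V f := ModuleCat.hom_ext (LinearMap.ext fun z =>
    (tensorPermX_tensorGraded (rotation f.unop.g) _ _ (gradedSections ψ U.unop)
      (gradedSections ψ V.unop) (fun l a x => gradedSections_restrict ψ f.unop l a x) n z).symm)

lemma tensorPshGraded_comp (ψ : ∀ a, A.X a ⟶ B.X a) (ψ' : ∀ a, B.X a ⟶ C.X a) (n : ℤ) :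
    tensorPshGraded p ψ n ≫ tensorPshGraded p ψ' n = tensorPshGraded p (fun a => ψ a ≫ ψ' a) n := by
  ext U : 2
  exact ModuleCat.hom_ext (tensorGraded_comp (gradedSections ψ U.unop) (gradedSections ψ' U.unop) n)

lemma tensorPshGraded_id (n : ℤ) : tensorPshGraded p (fun a => 𝟙 (A.X a)) n = 𝟙 _ := by
  ext U : 2
  exact ModuleCat.hom_ext (tensorGraded_id n)

lemma tensorPshMap_f (f : A ⟶ B) (n : ℤ) :
    ((complexOfFunctor _ _).map ((tensorPresheafFunctor R X p).map f)).f n =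
      tensorPshGraded p (fun a => f.f a) n := by
  ext U : 2
  exact ModuleCat.hom_ext (tensorPermX_one_eq (ι := Fin p)
    (fun l => ((sectionsComplex X).obj (op (proj U.unop l))).map f) n)

open Classical in
/-- The presheaf map `x ↦ ∑ S, e_S x ⊗ [- c S]`, where `S` runs over the proper subsets of `ℤ/p`,
`c S` is the barycentre of `S` and `e_S` is the tensor product of the idempotents
`e true` (for the factors in `S`) and `e false` (for the other factors). -/
lemma exists_section_of_splitting [Fact p.Prime] (i : ∀ a, A.X a ⟶ B.X a) (q : ∀ a, B.X a ⟶ C.X a)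
    (e : Bool → ∀ a, B.X a ⟶ B.X a) (he : ∀ a, e true a + e false a = 𝟙 _)
    (hi : ∀ a, i a ≫ e false a = 0) (hq : ∀ a, e true a ≫ q a = 0) (n : ℤ) :
    ∃ H : (tensorPsh p B).X n ⟶ (regular R p _).obj ((tensorPsh p B).X n),
      tensorPshGraded p i n ≫ H = 0 ∧ H ≫ (regular R p _).map (tensorPshGraded p q n) = 0 ∧
      H ≫ (augMap R p _).app _ =
        𝟙 _ - tensorPshGraded p (e true) n - tensorPshGraded p (e false) n := by
  obtain ⟨c, hc⟩ := exists_barycentre p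
  let Φ (U : EqOpens (Mu p) (MuPower p X)) (S : Fin p → Bool) :
      tensorX (fun l => ((sectionsComplex X).obj (op (proj U l))).obj B) n →ₗ[R]
        tensorX (fun l => ((sectionsComplex X).obj (op (proj U l))).obj B) n :=
    tensorGraded (fun l => gradedSections (e (S l)) U l) n
  let H (U : EqOpens (Mu p) (MuPower p X)) (j : Fin p) :
      tensorX (fun l => ((sectionsComplex X).obj (op (proj U l))).obj B) n →ₗ[R]
        tensorX (fun l => ((sectionsComplex X).obj (op (proj U l))).obj B) n :=
    ∑ S, if IsProperSubset S ∧ c S = -j then Φ U S else 0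
  -- A rotation turns the term of `S` into that of the translated subset, and moves its barycentre
  -- by the same translation by which the coordinates of `R[μ_p]` are permuted; so the sum can be
  -- reindexed.
  have nat {U V : EqOpens (Mu p) (MuPower p X)} (f : V ⟶ U) (j : Fin p) (z) :
      H V j (tensorPermX (rotation f.g)
        (fun l => ((sectionsComplex X).map (homOfLE (proj_le f l)).op).app B) n z) =
      tensorPermX (rotation f.g)
        (fun l => ((sectionsComplex X).map (homOfLE (proj_le f l)).op).app B) n
          (H U (j + f.g.toAdd) z) := by
    simp only [H, LinearMap.sum_apply, map_sum]
    refine (Fintype.sum_equiv ((rotation f.g).symm.arrowCongr (Equiv.refl Bool)) _ _ fun S => ?_).symm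
    have e1 : ((rotation f.g).symm.arrowCongr (Equiv.refl Bool)) S = S ∘ rotation f.g := rfl
    rw [e1]
    have e2 : (IsProperSubset S ∧ c S = -(j + f.g.toAdd)) ↔
        (IsProperSubset (S ∘ rotation f.g) ∧ c (S ∘ rotation f.g) = -j) := by
      rw [isProperSubset_comp]
      refine and_congr_right fun hS => ?_
      rw [rotation, hc S hS, sub_neg_eq_add, eq_neg_iff_add_eq_zero, eq_neg_iff_add_eq_zero,
        add_right_comm, add_assoc]
    by_cases h : IsProperSubset S ∧ c S = -(j + f.g.toAdd)
    · rw [if_pos h, if_pos (e2.1 h)]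
      exact tensorPermX_tensorGraded (rotation f.g) _ _ _ _
        (fun l a x => gradedSections_restrict (e (S (rotation f.g l))) f l a x) n z
    · rw [if_neg h, if_neg (fun h' => h (e2.2 h')), LinearMap.zero_apply, map_zero,
        LinearMap.zero_apply]
  -- A proper subset misses some place `l`, where `e false` stands, and `e false` kills the image of
  -- `i`. Below, dually, it contains some place, and `q` kills the image of `e true` there.
  have hΦi (U : EqOpens (Mu p) (MuPower p X)) (j : Fin p) (z) :
      H U j (tensorGraded (gradedSections i U) n z) = 0 := by
    simp only [H, LinearMap.sum_apply]
    refine Finset.sum_eq_zero fun S _ => ?_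
    split_ifs with h
    · obtain ⟨l, hl⟩ := h.1.2
      rw [← LinearMap.comp_apply]
      simp only [Φ]
      rw [tensorGraded_comp, tensorGraded_eq_zero _ l, LinearMap.zero_apply]
      intro a
      rw [hl]
      exact congrArg (fun f : A.X a ⟶ B.X a => (f.hom.app (op (proj U l))).hom) (hi a)
    · rfl
  have hΦq (U : EqOpens (Mu p) (MuPower p X)) (j : Fin p) (z) :
      tensorGraded (gradedSections q U) n (H U j z) = 0 := by
    simp only [H, LinearMap.sum_apply, map_sum]
    refine Finset.sum_eq_zero fun S _ => ?_
    split_ifs with h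
    · obtain ⟨l, hl⟩ := h.1.1
      rw [← LinearMap.comp_apply]
      simp only [Φ]
      rw [tensorGraded_comp, tensorGraded_eq_zero _ l, LinearMap.zero_apply]
      intro a
      rw [hl]
      exact congrArg (fun f : B.X a ⟶ C.X a => (f.hom.app (op (proj U l))).hom) (hq a)
    · rw [LinearMap.zero_apply, map_zero]
  -- Each proper subset contributes to exactly one coordinate, `j = -c S`. The sum over the
  -- coordinates is thus the full expansion of the identity without the terms of the full and of the
  -- empty subset.
  have hΦaug (U : EqOpens (Mu p) (MuPower p X)) (z) :
      ∑ j, H U j z = z - Φ U (fun _ => true) z - Φ U (fun _ => false) z := by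
    have e1 : ∑ S, Φ U S = LinearMap.id :=
      sum_tensorGraded (fun b => gradedSections (e b) U) (fun l a x =>
        ConcreteCategory.congr_hom (congrArg (fun f : B.X a ⟶ B.X a =>
          f.hom.app (op (proj U l))) (he a)) x) n
    have e2 : ∑ j, H U j = ∑ S, if IsProperSubset S then Φ U S else 0 := by
      simp only [H]
      rw [Finset.sum_comm]
      refine Finset.sum_congr rfl fun S _ => ?_
      by_cases hS : IsProperSubset S
      · simp only [hS, true_and, if_true]
        rw [Finset.sum_eq_single (-c S)]
        · simp
        · intro j _ hj
          rw [if_neg]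
          rintro h
          exact hj (by rw [h, neg_neg])
        · simp
      · simp [hS]
    have e3 : (∑ S, if IsProperSubset S then Φ U S else 0) + Φ U (fun _ => false) +
        Φ U (fun _ => true) = ∑ S, Φ U S := by
      have hne : (fun _ : Fin p => false) ≠ fun _ => true := fun h =>
        Bool.false_ne_true (congrFun h 0)
      have hp (S : Fin p → Bool) : ¬ IsProperSubset S ↔ S = (fun _ => false) ∨ S = fun _ => true := by
        rw [IsProperSubset, not_and_or, not_exists, not_exists, funext_iff, funext_iff]
        simp
      rw [← Finset.sum_filter, ← Finset.sum_filter_add_sum_filter_not Finset.univ IsProperSubset,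
        add_assoc]
      congr 1
      rw [← Finset.sum_pair (f := Φ U) hne]
      refine Finset.sum_congr ?_ fun _ _ => rfl
      ext S
      simp only [Finset.mem_filter, Finset.mem_univ, true_and, hp, Finset.mem_insert,
        Finset.mem_singleton]
    rw [← LinearMap.sum_apply, e2]
    have e4 := LinearMap.congr_fun (e3.trans e1) z
    exact eq_sub_of_add_eq (eq_sub_of_add_eq e4)
  refine ⟨{ app U := ModuleCat.ofHom (LinearMap.pi (H U.unop))
            naturality U V f := ModuleCat.hom_ext (LinearMap.ext fun z =>
              funext fun j => nat f.unop j z) }, ?_, ?_, ?_⟩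
  · ext U : 2
    exact ModuleCat.hom_ext (LinearMap.ext fun z => funext fun j => hΦi U.unop j z)
  · ext U : 2
    exact ModuleCat.hom_ext (LinearMap.ext fun z => funext fun j => hΦq U.unop (j + 0) z)
  · ext U : 2
    exact ModuleCat.hom_ext (LinearMap.ext fun z => hΦaug U.unop z)

end GradedPresheaf

end SteenrodTate

namespace SteenrodTate

/-! ### Descent of the section to a subquotient. -/

section SubquotientSection

variable {R : Type u} [CommRing R] {p : ℕ} [NeZero p] {Y : Type u} [TopologicalSpace Y]
  [MulAction (Mu p) Y] [ContinuousConstSMul (Mu p) Y]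

/-- Over an open set, tensoring with `R[μ_p]` is a `p`-fold product, so exactness holds
componentwise. The summands `0` come from the trivial translation with which `regular` acts on
natural maps. -/
lemma regular_shortExact {S : ShortComplex (EqPsh R p Y)} (h : S.ShortExact) :
    (S.map (regular R p Y)).ShortExact := by
  refine shortExact_of_evaluation _ fun U => ?_
  have hU := h.map_of_exact ((evaluation _ (ModuleCat.{u} R)).obj U)
  have ex := (ShortComplex.ShortExact.moduleCat_exact_iff_function_exact _).1 hU.exact
  have inj := (ModuleCat.mono_iff_injective _).1 hU.mono_f
  have surj := (ModuleCat.epi_iff_surjective _).1 hU.epi_g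
  refine ModuleCat.shortComplex_shortExact _ ?_ ?_ ?_
  · intro (v : Fin p → S.X₂.obj U)
    have key : (∀ j, S.g.app U (v j) = 0) ↔ ∃ w : Fin p → S.X₁.obj U, ∀ j, S.f.app U (w j) = v j :=
      (forall_congr' fun j => ex (v j)).trans Classical.skolem
    constructor
    · intro hv
      obtain ⟨w, hw⟩ := key.1 fun j => congrArg (S.g.app U) (congrArg v (add_zero j)).symm |>.trans
        (congrFun hv j)
      exact ⟨w, funext fun j => (congrArg (S.f.app U) (congrArg w (add_zero j))).trans (hw j)⟩
    · rintro ⟨(w : Fin p → S.X₁.obj U), rfl⟩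
      exact funext fun j => key.2 ⟨fun j => w (j + 0), fun _ => rfl⟩ (j + 0)
  · intro (v : Fin p → S.X₁.obj U) (w : Fin p → S.X₁.obj U) hvw
    funext j
    have := inj (congrFun hvw j : S.f.app U (v (j + 0)) = S.f.app U (w (j + 0)))
    rwa [add_zero] at this
  · intro (v : Fin p → S.X₃.obj U)
    choose w hw using fun j => surj (v j)
    exact ⟨w, funext fun j => (congrArg (fun k => S.g.app U (w k)) (add_zero j)).trans (hw j)⟩

/-- Here `E` is the kernel of `q` and `M` is `E` modulo `a`. The map `H` kills `a` and is killed by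
`q`, so it induces a map from `M` to `M ⊗ R[μ_p]`. Its defect from being a section consists of a
term through `q`, zero on `E`, and a term through `a`, zero in the quotient `M`. -/
lemma exists_section_of_shortExact {a b c E M : EqPsh R p Y} {ι : E ⟶ b} {q : b ⟶ c} {w : ι ≫ q = 0}
    (h₁ : (ShortComplex.mk ι q w).ShortExact) {j : a ⟶ E} {π : E ⟶ M} {w' : j ≫ π = 0}
    (h₂ : (ShortComplex.mk j π w').ShortExact) {f : a ⟶ b} (hf : j ≫ ι = f) (r : b ⟶ a) (s : c ⟶ b)
    (H : b ⟶ (regular R p Y).obj b) (hj : f ≫ H = 0) (hq : H ≫ (regular R p Y).map q = 0)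
    (ht : H ≫ (augMap R p Y).app b = 𝟙 b - r ≫ f - q ≫ s) :
    ∃ s : M ⟶ (regular R p Y).obj M, s ≫ (augMap R p Y).app M = 𝟙 M := by
  subst hf
  have h₁' := regular_shortExact h₁
  have := h₁'.mono_f
  have hm : Mono ((regular R p Y).map ι) := h₁'.mono_f
  have hmι : Mono ι := h₁.mono_f
  have := h₂.epi_g
  have he : Epi π := h₂.epi_g
  let H₁ : E ⟶ (regular R p Y).obj E := h₁'.exact.lift (ι ≫ H) (by
    change (ι ≫ H) ≫ (regular R p Y).map q = 0
    rw [Category.assoc, hq, comp_zero])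
  have hH₁ : H₁ ≫ (regular R p Y).map ι = ι ≫ H := h₁'.exact.lift_f _ _
  have hjH : j ≫ H₁ = 0 := by
    rw [← cancel_mono ((regular R p Y).map ι), Category.assoc, hH₁, ← Category.assoc, hj, zero_comp]
  let s : M ⟶ (regular R p Y).obj M := h₂.exact.desc (H₁ ≫ (regular R p Y).map π) (by
    change j ≫ H₁ ≫ (regular R p Y).map π = 0
    rw [reassoc_of% hjH, zero_comp])
  have hs : π ≫ s = H₁ ≫ (regular R p Y).map π := h₂.exact.g_desc _ _
  have haug : H₁ ≫ (augMap R p Y).app E = 𝟙 E - (ι ≫ r) ≫ j := by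
    rw [← cancel_mono ι, Category.assoc]
    refine (congrArg (H₁ ≫ ·) ((augMap R p Y).naturality ι).symm).trans ?_
    rw [reassoc_of% hH₁, ht, Preadditive.sub_comp, Category.id_comp, Category.assoc,
      Preadditive.comp_sub, Preadditive.comp_sub, reassoc_of% w, zero_comp, sub_zero,
      Category.comp_id, Category.assoc]
  refine ⟨s, ?_⟩
  rw [← cancel_epi π, reassoc_of% hs, Category.comp_id]
  refine (congrArg (H₁ ≫ ·) ((augMap R p Y).naturality π)).trans ?_
  refine (Category.assoc _ _ _).symm.trans ?_
  rw [haug]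
  refine (Preadditive.sub_comp _ _ _).trans ?_
  change 𝟙 E ≫ π - ((ι ≫ r) ≫ j) ≫ π = π
  rw [Category.id_comp, Category.assoc, w', comp_zero, sub_zero]

end SubquotientSection

/-! ### Bounded complexes under monomorphisms and epimorphisms. -/

section Bounded

variable {C : Type*} [Category* C] [Abelian C]

lemma boundedComplex_of_mono {K L : CochainComplex C ℤ} (f : K ⟶ L) [Mono f]
    (hL : boundedComplex C L) : boundedComplex C K := by
  obtain ⟨a, b, ha, hb⟩ := hL
  rw [CochainComplex.isStrictlyGE_iff] at ha
  rw [CochainComplex.isStrictlyLE_iff] at hb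
  refine ⟨a, b, ?_, ?_⟩
  · rw [CochainComplex.isStrictlyGE_iff]
    exact fun i hi => IsZero.of_mono (f.f i) (ha i hi)
  · rw [CochainComplex.isStrictlyLE_iff]
    exact fun i hi => IsZero.of_mono (f.f i) (hb i hi)

lemma boundedComplex_of_epi {K L : CochainComplex C ℤ} (f : K ⟶ L) [Epi f]
    (hK : boundedComplex C K) : boundedComplex C L := by
  obtain ⟨a, b, ha, hb⟩ := hK
  rw [CochainComplex.isStrictlyGE_iff] at ha
  rw [CochainComplex.isStrictlyLE_iff] at hb
  refine ⟨a, b, ?_, ?_⟩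
  · rw [CochainComplex.isStrictlyGE_iff]
    exact fun i hi => IsZero.of_epi (f.f i) (ha i hi)
  · rw [CochainComplex.isStrictlyLE_iff]
    exact fun i hi => IsZero.of_epi (f.f i) (hb i hi)

end Bounded

/-- A splitting, in each degree, of a short complex of complexes. -/
structure DegreewiseSplitting {C : Type*} [Category* C] [Preadditive C]
    (S : ShortComplex (CochainComplex C ℤ)) where
  /-- The retraction. -/
  r (a : ℤ) : S.X₂.X a ⟶ S.X₁.X a
  /-- The section. -/
  s (a : ℤ) : S.X₃.X a ⟶ S.X₂.X a
  f_r (a : ℤ) : S.f.f a ≫ r a = 𝟙 _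
  s_g (a : ℤ) : s a ≫ S.g.f a = 𝟙 _
  id (a : ℤ) : r a ≫ S.f.f a + S.g.f a ≫ s a = 𝟙 _

/-! ### The mixed part of the external tensor power of an extension. -/

section Cross

variable {R : Type u} [CommRing R] {X : TopCat.{u}} {p : ℕ} [NeZero p]

/-- The complex of presheaves `U ↦ ⨂ l, A (pr l (U))`, as a functor of `A`. -/
noncomputable abbrev tensorPshFunctor (R : Type u) [CommRing R] (X : TopCat.{u}) (p : ℕ) [NeZero p] :
    CochainComplex (Sh R X) ℤ ⥤ CochainComplex (EqPsh R p (MuPower p X)) ℤ :=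
  tensorPresheafFunctor R X p ⋙ complexOfFunctor _ _

lemma tensorPshFunctor_map_f {A B : CochainComplex (Sh R X) ℤ} (f : A ⟶ B) (n : ℤ) :
    ((tensorPshFunctor R X p).map f).f n = tensorPshGraded p (fun a => f.f a) n :=
  tensorPshMap_f f n

lemma tensorPshGraded_zero {A B : CochainComplex (Sh R X) ℤ} (n : ℤ) :
    tensorPshGraded p (fun a => (0 : A.X a ⟶ B.X a)) n = 0 := by
  ext U : 2
  exact ModuleCat.hom_ext (tensorGraded_eq_zero _ (0 : Fin p) (fun _ => rfl) n)

instance : (tensorPshFunctor R X p).PreservesZeroMorphisms where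
  map_zero A B := by
    ext n : 1
    exact (tensorPshMap_f (p := p) (0 : A ⟶ B) n).trans (tensorPshGraded_zero n)

/-- Sheafification of complexes of equivariant presheaves. -/
noncomputable abbrev sheafifyComplex (R : Type u) [CommRing R] (X : TopCat.{u}) (p : ℕ) [NeZero p] :
    CochainComplex (EqPsh R p (MuPower p X)) ℤ ⥤ CochainComplex (EqSh R (Mu p) (MuPower p X)) ℤ :=
  (presheafToSheaf (EqOpens.topology (Mu p) (MuPower p X)) _).mapHomologicalComplex _

lemma sheafifyComplex_shortExact {S : ShortComplex (CochainComplex (EqPsh R p (MuPower p X)) ℤ)}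
    (h : S.ShortExact) : (S.map (sheafifyComplex R X p)).ShortExact :=
  HomologicalComplex.shortExact_of_degreewise_shortExact _ fun n =>
    (h.map_of_exact (HomologicalComplex.eval _ _ n)).map_of_exact
      (presheafToSheaf (EqOpens.topology (Mu p) (MuPower p X)) (ModuleCat.{u} R))

variable (p) in
/-- The kernel of the map from the external tensor power of `B` to that of `C`, for a short exact
sequence of complexes `0 ⟶ A ⟶ B ⟶ C ⟶ 0`. -/
noncomputable abbrev crossKernel (S : ShortComplex (CochainComplex (Sh R X) ℤ)) :
    CochainComplex (EqPsh R p (MuPower p X)) ℤ :=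
  kernel ((tensorPshFunctor R X p).map S.g)

variable (p) in
/-- The map from the external tensor power of `A` to the kernel of the map from that of `B` to that
of `C`, for a short exact sequence of complexes `0 ⟶ A ⟶ B ⟶ C ⟶ 0`. -/
noncomputable abbrev crossIncl (S : ShortComplex (CochainComplex (Sh R X) ℤ)) :
    (tensorPshFunctor R X p).obj S.X₁ ⟶ crossKernel p S :=
  kernel.lift _ ((tensorPshFunctor R X p).map S.f) (by
    rw [← Functor.map_comp, S.zero, Functor.map_zero])

variable {S : ShortComplex (CochainComplex (Sh R X) ℤ)} (σ : DegreewiseSplitting S)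

include σ

/-- In each degree the tensor power of the section `σ.s` splits the map onto the tensor power of the
quotient; that `σ.s` is not a chain map does not matter for surjectivity. -/
lemma shortExact_crossKernel : (ShortComplex.mk (kernel.ι ((tensorPshFunctor R X p).map S.g))
    ((tensorPshFunctor R X p).map S.g) (kernel.condition _)).ShortExact := by
  have : Epi ((tensorPshFunctor R X p).map S.g) := HomologicalComplex.epi_of_epi_f _ fun n => by
    have h : tensorPshGraded p σ.s n ≫ ((tensorPshFunctor R X p).map S.g).f n = 𝟙 _ := by
      rw [tensorPshFunctor_map_f]
      refine (tensorPshGraded_comp _ _ _).trans (Eq.trans ?_ (tensorPshGraded_id n))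
      congr 1
      exact funext σ.s_g
    have : IsSplitEpi (((tensorPshFunctor R X p).map S.g).f n) := IsSplitEpi.mk' ⟨_, h⟩
    exact SplitEpi.epi ⟨_, h⟩
  exact ⟨ShortComplex.exact_kernel _⟩

lemma shortExact_crossIncl : (ShortComplex.mk (crossIncl p S) (cokernel.π (crossIncl p S))
    (cokernel.condition _)).ShortExact := by
  have : Mono ((tensorPshFunctor R X p).map S.f) := HomologicalComplex.mono_of_mono_f _ fun n => by
    have h : ((tensorPshFunctor R X p).map S.f).f n ≫ tensorPshGraded p σ.r n = 𝟙 _ := by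
      rw [tensorPshFunctor_map_f]
      refine (tensorPshGraded_comp _ _ _).trans (Eq.trans ?_ (tensorPshGraded_id n))
      congr 1
      exact funext σ.f_r
    exact SplitMono.mono ⟨_, h⟩
  have : Mono (crossIncl p S) := mono_of_mono_fac (kernel.lift_ι _ _ _)
  exact ⟨ShortComplex.exact_cokernel _⟩

/-- The idempotents are the two projectors of the splitting: onto the subobject for the places in
`S`, onto the complement for the others. Their full tensor powers factor through the tensor powers
of `S.X₁` and `S.X₃`. -/
lemma exists_graded_section [Fact p.Prime] (n : ℤ) :
    ∃ H : (tensorPsh p S.X₂).X n ⟶ (regular R p _).obj ((tensorPsh p S.X₂).X n),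
      tensorPshGraded p (fun a => S.f.f a) n ≫ H = 0 ∧
      H ≫ (regular R p _).map (tensorPshGraded p (fun a => S.g.f a) n) = 0 ∧
      H ≫ (augMap R p _).app _ = 𝟙 _ -
        tensorPshGraded p σ.r n ≫ tensorPshGraded p (fun a => S.f.f a) n -
        tensorPshGraded p (fun a => S.g.f a) n ≫ tensorPshGraded p σ.s n := by
  have w (a : ℤ) : S.f.f a ≫ S.g.f a = 0 := HomologicalComplex.congr_hom S.zero a
  obtain ⟨H, h1, h2, h3⟩ := exists_section_of_splitting (p := p) (fun a => S.f.f a) (fun a => S.g.f a)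
    (fun b a => if b then σ.r a ≫ S.f.f a else S.g.f a ≫ σ.s a) σ.id
    (fun a => by
      change S.f.f a ≫ S.g.f a ≫ σ.s a = 0
      rw [reassoc_of% (w a), zero_comp])
    (fun a => by
      change (σ.r a ≫ S.f.f a) ≫ S.g.f a = 0
      rw [Category.assoc, w, comp_zero]) n
  refine ⟨H, h1, h2, h3.trans ?_⟩
  rw [tensorPshGraded_comp, tensorPshGraded_comp]
  rfl

/-- The cokernel carries the mixed tensors, those with factors of both kinds, and on them the
barycentre section splits the augmentation. The splitting is obtained separately in each degree, as
`σ` ignores the differentials. -/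
lemma relProj_cokernel_crossIncl [Fact p.Prime] (n : ℤ) :
    RelProj R p _ (((sheafifyComplex R X p).obj (cokernel (crossIncl p S))).X n) := by
  obtain ⟨H, h1, h2, h3⟩ := exists_graded_section (p := p) σ n
  have e1 := (shortExact_crossKernel (p := p) σ).map_of_exact (HomologicalComplex.eval _ _ n)
  have e2 := (shortExact_crossIncl (p := p) σ).map_of_exact (HomologicalComplex.eval _ _ n)
  have e3 : (crossIncl p S).f n ≫ (kernel.ι ((tensorPshFunctor R X p).map S.g)).f n =
      ((tensorPshFunctor R X p).map S.f).f n :=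
    (HomologicalComplex.congr_hom (kernel.lift_ι ((tensorPshFunctor R X p).map S.g) _ _) n)
  rw [← tensorPshFunctor_map_f, ← tensorPshFunctor_map_f] at h3
  rw [← tensorPshFunctor_map_f] at h1 h2
  obtain ⟨s, hs⟩ := exists_section_of_shortExact e1 e2 e3 (tensorPshGraded p σ.r n)
    (tensorPshGraded p σ.s n) H h1 h2 h3
  exact relProj_presheafToSheaf s hs

end Cross

end SteenrodTate

namespace SteenrodTate

/-! ### Replacing an object of a triangle by an isomorphic one. -/

section TransportTriangle

open Pretriangulated

variable {D E : Type*} [Category* D] [Category* E] [HasZeroObject D] [HasZeroObject E]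
  [HasShift D ℤ] [HasShift E ℤ] [Preadditive D] [Preadditive E]
  [∀ n : ℤ, (shiftFunctor D n).Additive] [∀ n : ℤ, (shiftFunctor E n).Additive]
  [Pretriangulated D] [Pretriangulated E] (L : D ⥤ E) [L.CommShift ℤ] [L.IsTriangulated]

/-- The image of a morphism `Q₃ ⟶ Q₁[1]` under a triangulated functor `L`, with `L.obj Q₁` replaced
by an isomorphic object. -/
noncomputable def transportδ {Q₁ Q₃ : D} {A : E} (i : A ⟶ L.obj Q₁) [IsIso i] (δ : Q₃ ⟶ Q₁⟦(1 : ℤ)⟧) :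
    L.obj Q₃ ⟶ A⟦(1 : ℤ)⟧ :=
  L.map δ ≫ (L.commShiftIso (1 : ℤ)).hom.app _ ≫ (inv i)⟦(1 : ℤ)⟧'

lemma transportδ_distinguished {Q₁ Q₂ Q₃ : D} {u : Q₁ ⟶ Q₂} {v : Q₂ ⟶ Q₃} {δ : Q₃ ⟶ Q₁⟦(1 : ℤ)⟧}
    (h : Triangle.mk u v δ ∈ distTriang D) {A : E} (i : A ⟶ L.obj Q₁) [hi : IsIso i]
    (f : A ⟶ L.obj Q₂) (hf : i ≫ L.map u = f) :
    Triangle.mk f (L.map v) (transportδ L i δ) ∈ distTriang E := by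
  let e : A ≅ L.obj Q₁ := asIso i
  refine isomorphic_distinguished _ (L.map_distinguished _ h) _
    (Triangle.isoMk _ _ e (Iso.refl _) (Iso.refl _) ?_ ?_ ?_)
  · exact (Category.comp_id _).trans hf.symm
  · exact (Category.comp_id _).trans (Category.id_comp _).symm
  · have h1 : (inv i)⟦(1 : ℤ)⟧' ≫ i⟦(1 : ℤ)⟧' = 𝟙 _ := by
      rw [← Functor.map_comp, IsIso.inv_hom_id, CategoryTheory.Functor.map_id]
    exact ((Category.assoc _ _ _).trans (congrArg (L.map δ ≫ ·) ((Category.assoc _ _ _).trans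
      ((congrArg (_ ≫ ·) h1).trans (Category.comp_id _))))).trans (Category.id_comp _).symm

omit [HasZeroObject D] [HasZeroObject E] [∀ n : ℤ, (shiftFunctor D n).Additive]
  [∀ n : ℤ, (shiftFunctor E n).Additive] [Pretriangulated D] [Pretriangulated E] [L.IsTriangulated] in
lemma transportδ_naturality {Q₁ Q₃ Q₁' Q₃' : D} {δ : Q₃ ⟶ Q₁⟦(1 : ℤ)⟧} {δ' : Q₃' ⟶ Q₁'⟦(1 : ℤ)⟧}
    {A A' : E} (i : A ⟶ L.obj Q₁) [hi : IsIso i] (i' : A' ⟶ L.obj Q₁') [hi' : IsIso i'] {κ : Q₁ ⟶ Q₁'}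
    {c : Q₃ ⟶ Q₃'} {a : A ⟶ A'} (h : δ ≫ κ⟦(1 : ℤ)⟧' = c ≫ δ') (ha : i ≫ L.map κ = a ≫ i') :
    transportδ L i δ ≫ a⟦(1 : ℤ)⟧' = L.map c ≫ transportδ L i' δ' := by
  have e : inv i ≫ a = L.map κ ≫ inv i' := by
    rw [IsIso.inv_comp_eq, ← Category.assoc, ha, Category.assoc, IsIso.hom_inv_id, Category.comp_id]
  unfold transportδ
  rw [Category.assoc, Category.assoc, ← Functor.map_comp, e, ← L.map_comp_assoc, ← h, L.map_comp,
    Category.assoc, L.commShiftIso_hom_naturality_assoc, Functor.map_comp]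

end TransportTriangle

/-! ### Natural triangles on degreewise split exact sequences. -/

section SplitTriangles

open CochainComplex Pretriangulated DerivedCategory

variable {C T : Type*} [Category* C] [Abelian C] [Category* T] [HasZeroObject T] [HasShift T ℤ]
  [Preadditive T] [∀ n : ℤ, (CategoryTheory.shiftFunctor T n).Additive] [Pretriangulated T]
  {F : (boundedComplex C).FullSubcategory ⥤ T}

variable (F) in
/-- A natural extension of the images under `F` of the degreewise split short exact sequences of
bounded complexes to distinguished triangles. -/
structure SplitTriangles where
  /-- The connecting morphism. -/
  δ {S : ShortComplex (CochainComplex C ℤ)} (σ : DegreewiseSplitting S)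
    (h₁ : boundedComplex C S.X₁) (h₂ : boundedComplex C S.X₂) (h₃ : boundedComplex C S.X₃) :
    F.obj (bdd _ h₃) ⟶ (F.obj (bdd _ h₁))⟦(1 : ℤ)⟧
  distinguished {S : ShortComplex (CochainComplex C ℤ)} (σ : DegreewiseSplitting S)
    (h₁ : boundedComplex C S.X₁) (h₂ : boundedComplex C S.X₂) (h₃ : boundedComplex C S.X₃) :
    Triangle.mk (F.map (ObjectProperty.homMk S.f : bdd _ h₁ ⟶ bdd _ h₂))
      (F.map (ObjectProperty.homMk S.g : bdd _ h₂ ⟶ bdd _ h₃)) (δ σ h₁ h₂ h₃) ∈ distTriang T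
  naturality {S : ShortComplex (CochainComplex C ℤ)} (σ : DegreewiseSplitting S)
    (h₁ : boundedComplex C S.X₁) (h₂ : boundedComplex C S.X₂) (h₃ : boundedComplex C S.X₃)
    {S' : ShortComplex (CochainComplex C ℤ)} (σ' : DegreewiseSplitting S') (f : S ⟶ S')
    (h₁' : boundedComplex C S'.X₁) (h₂' : boundedComplex C S'.X₂) (h₃' : boundedComplex C S'.X₃) :
    δ σ h₁ h₂ h₃ ≫ (F.map (ObjectProperty.homMk f.τ₁ : bdd _ h₁ ⟶ bdd _ h₁'))⟦(1 : ℤ)⟧' =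
      F.map (ObjectProperty.homMk f.τ₃ : bdd _ h₃ ⟶ bdd _ h₃') ≫ δ σ' h₁' h₂' h₃'

variable {C' : Type*} [Category* C'] [Abelian C'] [HasDerivedCategory C'] (L : Bounded C' ⥤ T)
  (G : (boundedComplex C).FullSubcategory ⥤ (boundedComplex C').FullSubcategory)

/-- A natural factorization of the images under `G` of the degreewise split short exact sequences
`0 ⟶ S₁ ⟶ S₂ ⟶ S₃ ⟶ 0` of bounded complexes through short exact sequences
`0 ⟶ E ⟶ G S₂ ⟶ G S₃ ⟶ 0`, such that `G S₁ ⟶ E` becomes an isomorphism under `L`. -/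
structure SplitComparison where
  /-- The kernel. -/
  E {S : ShortComplex (CochainComplex C ℤ)} (σ : DegreewiseSplitting S)
    (h₂ : boundedComplex C S.X₂) : (boundedComplex C').FullSubcategory
  /-- The comparison map. -/
  i {S : ShortComplex (CochainComplex C ℤ)} (σ : DegreewiseSplitting S)
    (h₁ : boundedComplex C S.X₁) (h₂ : boundedComplex C S.X₂) : G.obj (bdd _ h₁) ⟶ E σ h₂
  /-- The inclusion of the kernel. -/
  u {S : ShortComplex (CochainComplex C ℤ)} (σ : DegreewiseSplitting S)
    (h₂ : boundedComplex C S.X₂) : E σ h₂ ⟶ G.obj (bdd _ h₂)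
  i_u {S : ShortComplex (CochainComplex C ℤ)} (σ : DegreewiseSplitting S)
    (h₁ : boundedComplex C S.X₁) (h₂ : boundedComplex C S.X₂) :
    i σ h₁ h₂ ≫ u σ h₂ = G.map (ObjectProperty.homMk S.f)
  u_map {S : ShortComplex (CochainComplex C ℤ)} (σ : DegreewiseSplitting S)
    (h₂ : boundedComplex C S.X₂) (h₃ : boundedComplex C S.X₃) :
    (u σ h₂).hom ≫ (G.map (ObjectProperty.homMk S.g : bdd _ h₂ ⟶ bdd _ h₃)).hom = 0
  shortExact {S : ShortComplex (CochainComplex C ℤ)} (σ : DegreewiseSplitting S)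
    (h₂ : boundedComplex C S.X₂) (h₃ : boundedComplex C S.X₃) :
    (ShortComplex.mk _ _ (u_map σ h₂ h₃)).ShortExact
  isIso {S : ShortComplex (CochainComplex C ℤ)} (σ : DegreewiseSplitting S)
    (h₁ : boundedComplex C S.X₁) (h₂ : boundedComplex C S.X₂) :
    IsIso (L.map ((boundedQ C').map (i σ h₁ h₂)))
  /-- The functoriality of the kernel. -/
  κ {S : ShortComplex (CochainComplex C ℤ)} (σ : DegreewiseSplitting S)
    (h₂ : boundedComplex C S.X₂) {S' : ShortComplex (CochainComplex C ℤ)}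
    (σ' : DegreewiseSplitting S') (h₂' : boundedComplex C S'.X₂) (f : S ⟶ S') : E σ h₂ ⟶ E σ' h₂'
  i_κ {S : ShortComplex (CochainComplex C ℤ)} (σ : DegreewiseSplitting S)
    (h₁ : boundedComplex C S.X₁) (h₂ : boundedComplex C S.X₂)
    {S' : ShortComplex (CochainComplex C ℤ)} (σ' : DegreewiseSplitting S')
    (h₁' : boundedComplex C S'.X₁) (h₂' : boundedComplex C S'.X₂) (f : S ⟶ S') :
    i σ h₁ h₂ ≫ κ σ h₂ σ' h₂' f = G.map (ObjectProperty.homMk f.τ₁) ≫ i σ' h₁' h₂'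
  κ_u {S : ShortComplex (CochainComplex C ℤ)} (σ : DegreewiseSplitting S)
    (h₂ : boundedComplex C S.X₂) {S' : ShortComplex (CochainComplex C ℤ)}
    (σ' : DegreewiseSplitting S') (h₂' : boundedComplex C S'.X₂) (f : S ⟶ S') :
    κ σ h₂ σ' h₂' f ≫ u σ' h₂' = u σ h₂ ≫ G.map (ObjectProperty.homMk f.τ₂)

variable {L G} [L.CommShift ℤ] [L.IsTriangulated]

/-- The triangles given by a comparison with short exact sequences. -/
noncomputable def SplitComparison.splitTriangles (H : SplitComparison L G) :
    SplitTriangles (G ⋙ boundedQ C' ⋙ L) where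
  δ σ h₁ h₂ h₃ :=
    have := H.isIso σ h₁ h₂
    transportδ L (L.map ((boundedQ C').map (H.i σ h₁ h₂)))
      (boundedδ (H.shortExact σ h₂ h₃) (H.E σ h₂).property (G.obj (bdd _ h₃)).property)
  distinguished σ h₁ h₂ h₃ :=
    transportδ_distinguished L (boundedδ_distinguished (H.shortExact σ h₂ h₃) (H.E σ h₂).property
      (G.obj (bdd _ h₂)).property (G.obj (bdd _ h₃)).property) _ (hi := H.isIso σ h₁ h₂) _ (by
        refine (L.map_comp _ _).symm.trans (congrArg L.map ?_)
        exact ((boundedQ C').map_comp _ _).symm.trans (congrArg _ (H.i_u σ h₁ h₂)))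
  naturality {S} σ h₁ h₂ h₃ {S'} σ' f h₁' h₂' h₃' := by
    let φ : ShortComplex.mk _ _ (H.u_map σ h₂ h₃) ⟶ ShortComplex.mk _ _ (H.u_map σ' h₂' h₃') :=
      { τ₁ := (H.κ σ h₂ σ' h₂' f).hom
        τ₂ := (G.map (ObjectProperty.homMk f.τ₂ : bdd _ h₂ ⟶ bdd _ h₂')).hom
        τ₃ := (G.map (ObjectProperty.homMk f.τ₃ : bdd _ h₃ ⟶ bdd _ h₃')).hom
        comm₁₂ := congrArg (·.hom) (H.κ_u σ h₂ σ' h₂' f)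
        comm₂₃ := by
          have h : (ObjectProperty.homMk f.τ₂ : bdd _ h₂ ⟶ bdd _ h₂') ≫
              (ObjectProperty.homMk S'.g : bdd _ h₂' ⟶ bdd _ h₃') =
              (ObjectProperty.homMk S.g : bdd _ h₂ ⟶ bdd _ h₃) ≫ ObjectProperty.homMk f.τ₃ := by
            ext1
            exact f.comm₂₃
          have h' := congrArg G.map h
          rw [G.map_comp, G.map_comp] at h'
          exact congrArg (·.hom) h' }
    refine transportδ_naturality L _ (hi := H.isIso σ h₁ h₂) _ (hi' := H.isIso σ' h₁' h₂')
      (boundedδ_naturality (H.shortExact σ h₂ h₃) (H.shortExact σ' h₂' h₃') φ (H.E σ h₂).property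
        (G.obj (bdd _ h₃)).property (H.E σ' h₂').property (G.obj (bdd _ h₃')).property) ?_
    refine (L.map_comp _ _).symm.trans ((congrArg L.map ?_).trans (L.map_comp _ _))
    exact ((boundedQ C').map_comp _ _).symm.trans
      ((congrArg _ (H.i_κ σ h₁ h₂ σ' h₁' h₂' f)).trans ((boundedQ C').map_comp _ _))

end SplitTriangles

/-! ### Natural triangles for Steenrod's construction. -/

section CrossTriangle

variable {R : Type u} [CommRing R] {X : TopCat.{u}} (p : ℕ) [NeZero p]

variable (S : ShortComplex (CochainComplex (Sh R X) ℤ))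

/-- The short complex of complexes of equivariant sheaves `0 ⟶ E ⟶ St B ⟶ St C ⟶ 0`. -/
noncomputable abbrev crossSES : ShortComplex (CochainComplex (EqSh R (Mu p) (MuPower p X)) ℤ) :=
  (ShortComplex.mk (kernel.ι ((tensorPshFunctor R X p).map S.g))
    ((tensorPshFunctor R X p).map S.g) (kernel.condition _)).map (sheafifyComplex R X p)

/-- The functoriality of the kernels. -/
noncomputable abbrev crossKernelMap {S S' : ShortComplex (CochainComplex (Sh R X) ℤ)} (f : S ⟶ S') :
    crossKernel p S ⟶ crossKernel p S' :=
  kernel.map _ _ ((tensorPshFunctor R X p).map f.τ₂) ((tensorPshFunctor R X p).map f.τ₃) (by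
    rw [← Functor.map_comp, ← Functor.map_comp, f.comm₂₃])

lemma crossIncl_naturality {S S' : ShortComplex (CochainComplex (Sh R X) ℤ)} (f : S ⟶ S') :
    crossIncl p S ≫ crossKernelMap p f = (tensorPshFunctor R X p).map f.τ₁ ≫ crossIncl p S' := by
  rw [← cancel_mono (kernel.ι _), Category.assoc, Category.assoc, kernel.lift_ι, kernel.lift_ι,
    kernel.lift_ι_assoc, ← Functor.map_comp, ← Functor.map_comp, f.comm₁₂]

variable {S} {p} (σ : DegreewiseSplitting S) (h₁ : boundedComplex _ S.X₁) (h₂ : boundedComplex _ S.X₂)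
  (h₃ : boundedComplex _ S.X₃)

include σ in
lemma crossSES_shortExact : (crossSES p S).ShortExact :=
  sheafifyComplex_shortExact (shortExact_crossKernel σ)

include σ h₂ in
lemma boundedComplex_crossKernel :
    boundedComplex _ ((sheafifyComplex R X p).obj (crossKernel p S)) := by
  have := (crossSES_shortExact (p := p) σ).mono_f
  exact @boundedComplex_of_mono _ _ _ _ _ (crossSES p S).f this ((steenrodCb R X p).obj (bdd _ h₂)).property

/-- The map from the external tensor power of `A` to the kernel of the map from that of `B` to that
of `C`, as a map of bounded complexes. -/
noncomputable abbrev boundedCrossIncl : (steenrodCb R X p).obj (bdd _ h₁) ⟶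
    bdd _ (boundedComplex_crossKernel (p := p) σ h₂) :=
  ObjectProperty.homMk ((sheafifyComplex R X p).map (crossIncl p S))

variable {T : Type*} [Category* T] [HasZeroObject T] [HasShift T ℤ] [Preadditive T]
  [∀ n : ℤ, (shiftFunctor T n).Additive] [Pretriangulated T]
  {L : EqDb R (Mu p) (MuPower p X) ⥤ T} [L.CommShift ℤ] [L.IsTriangulated] [Fact p.Prime]

/-- The condition that a functor on `D^b_{μ_p}(X ^ μ_p, R)` vanishes on the bounded complexes of
sheaves of relatively projective `R[μ_p]`-modules. -/
def VanishesOnRelProj (L : EqDb R (Mu p) (MuPower p X) ⥤ T) : Prop :=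
  ∀ (K : CochainComplex (EqSh R (Mu p) (MuPower p X)) ℤ) (hK : boundedComplex _ K),
    (∀ n, RelProj R p _ (K.X n)) → IsZero (L.obj ((boundedQ _).obj (bdd K hK)))

/-- The third object of the triangle on this map is the mixed part, a bounded complex of relatively
projective sheaves, which `L` kills. -/
lemma VanishesOnRelProj.isIso_map_boundedCrossIncl (hL : VanishesOnRelProj L) :
    IsIso (L.map ((boundedQ _).map (boundedCrossIncl (p := p) σ h₁ h₂))) := by
  have hS := sheafifyComplex_shortExact (shortExact_crossIncl (p := p) σ)
  have hE := boundedComplex_crossKernel (p := p) σ h₂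
  have := hS.epi_g
  have hM : boundedComplex _ ((sheafifyComplex R X p).obj (cokernel (crossIncl p S))) :=
    boundedComplex_of_epi ((sheafifyComplex R X p).map (cokernel.π (crossIncl p S))) hE
  have hd := L.map_distinguished _ (boundedδ_distinguished hS
    ((steenrodCb R X p).obj (bdd _ h₁)).property hE hM)
  exact (Pretriangulated.Triangle.isZero₃_iff_isIso₁ _ hd).1
    (hL _ hM (relProj_cokernel_crossIncl σ))

/-- Up to complexes of sheaves of relatively projective modules, Steenrod's construction preserves
degreewise split short exact sequences. -/
noncomputable def VanishesOnRelProj.splitComparison (hL : VanishesOnRelProj L) :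
    SplitComparison L (steenrodCb R X p) where
  E σ h₂ := bdd _ (boundedComplex_crossKernel (p := p) σ h₂)
  i σ h₁ h₂ := boundedCrossIncl σ h₁ h₂
  u {S} σ h₂ := ObjectProperty.homMk
    ((sheafifyComplex R X p).map (kernel.ι ((tensorPshFunctor R X p).map S.g)))
  i_u σ h₁ h₂ := by
    ext1
    exact ((sheafifyComplex R X p).map_comp _ _).symm.trans
      (congrArg (sheafifyComplex R X p).map (kernel.lift_ι _ _ _))
  u_map {S} σ h₂ h₃ := (crossSES p S).zero
  shortExact σ h₂ h₃ := crossSES_shortExact σ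
  isIso σ h₁ h₂ := hL.isIso_map_boundedCrossIncl σ h₁ h₂
  κ σ h₂ _ σ' h₂' f := ObjectProperty.homMk ((sheafifyComplex R X p).map (crossKernelMap p f))
  i_κ σ h₁ h₂ _ σ' h₁' h₂' f := by
    ext1
    exact ((sheafifyComplex R X p).map_comp _ _).symm.trans
      ((congrArg (sheafifyComplex R X p).map (crossIncl_naturality p f)).trans
        ((sheafifyComplex R X p).map_comp _ _))
  κ_u σ h₂ _ σ' h₂' f := by
    ext1
    exact ((sheafifyComplex R X p).map_comp _ _).symm.trans
      ((congrArg (sheafifyComplex R X p).map (kernel.lift_ι _ _ _)).trans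
        ((sheafifyComplex R X p).map_comp _ _))

end CrossTriangle

end SteenrodTate

namespace SteenrodTate

/-! ### A criterion for a functor on a localization to be triangulated. -/

section TriangulatedDeformation

open Pretriangulated

variable {C D T : Type*} [Category* C] [Category* D] [Category* T] [HasZeroObject D]
  [HasZeroObject T] [HasShift D ℤ] [HasShift T ℤ] [Preadditive D] [Preadditive T]
  [∀ n : ℤ, (shiftFunctor D n).Additive] [∀ n : ℤ, (shiftFunctor T n).Additive]
  [Pretriangulated D] [Pretriangulated T]

/-- A functor `F'` on a localization of `C`, given by a functor `F` on a class `P` of objects of `C`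
into which every object can be deformed, is triangulated if `F` commutes with cones. -/
lemma exists_isTriangulated_of_deformation (L : C ⥤ D) (W : MorphismProperty C) [L.IsLocalization W]
    {r : C ⥤ C} {ε : r ⟶ 𝟭 C} (hε : ∀ X, W (ε.app X)) (P : ObjectProperty C)
    (hP : ∀ X, P (r.obj X)) (S : C ⥤ C) (hS : ∀ X, P X → P (S.obj X))
    (s : S ⋙ L ≅ L ⋙ shiftFunctor D (1 : ℤ)) (F : C ⥤ T) (θ : S ⋙ F ⟶ F ⋙ shiftFunctor T (1 : ℤ))
    (hθ : ∀ X, P X → IsIso (θ.app X)) (F' : D ⥤ T) (E : P.ι ⋙ L ⋙ F' ≅ P.ι ⋙ F)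
    (hcone : ∀ {K K' : C} (f : K ⟶ K'), P K → P K' → ∃ (M : C) (_ : P M) (i : K' ⟶ M)
      (o : M ⟶ S.obj K),
      Triangle.mk (L.map f) (L.map i) (L.map o ≫ s.hom.app K) ∈ distTriang D ∧
      Triangle.mk (F.map f) (F.map i) (F.map o ≫ θ.app K) ∈ distTriang T)
    (harrow : ∀ {A B : D} (f : A ⟶ B), ∃ (K K' : C) (_ : P K) (_ : P K') (g : K ⟶ K')
      (e₁ : A ≅ L.obj K) (e₂ : B ≅ L.obj K'), f ≫ e₂.hom = e₁.hom ≫ L.map g) :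
    ∃ _ : F'.CommShift ℤ, F'.IsTriangulated := by
  let E' (X : C) (hX : P X) : F'.obj (L.obj X) ≅ F.obj X := E.app ⟨X, hX⟩
  have hE {X Y : C} (hX : P X) (hY : P Y) (f : X ⟶ Y) :
      F'.map (L.map f) ≫ (E' Y hY).hom = (E' X hX).hom ≫ F.map f :=
    E.hom.naturality (X := ⟨X, hX⟩) (Y := ⟨Y, hY⟩) (ObjectProperty.homMk f)
  -- On objects of `P` the derived functor is `F`, so `θ` supplies the commutation with the shift
  -- there. It extends to all objects by deformation, and to all degrees because degree `1`
  -- generates.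
  let τ₀ (X : C) (hX : P X) : F'.obj ((L.obj X)⟦(1 : ℤ)⟧) ≅ (F'.obj (L.obj X))⟦(1 : ℤ)⟧ :=
    have := hθ X hX
    F'.mapIso (s.app X).symm ≪≫ E' _ (hS X hX) ≪≫ asIso (θ.app X) ≪≫
      (shiftFunctor T (1 : ℤ)).mapIso (E' X hX).symm
  have hτ₀ (X : C) (hX : P X) : (τ₀ X hX).hom = F'.map (s.inv.app X) ≫ (E' _ (hS X hX)).hom ≫
      θ.app X ≫ (E' X hX).inv⟦(1 : ℤ)⟧' := rfl
  let τ : P.ι ⋙ L ⋙ (shiftFunctor D (1 : ℤ) ⋙ F') ≅ P.ι ⋙ L ⋙ (F' ⋙ shiftFunctor T (1 : ℤ)) :=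
    NatIso.ofComponents (fun X => τ₀ X.obj X.property) (fun {X Y} f => by
      change F'.map ((L.map f.hom)⟦(1 : ℤ)⟧') ≫ (τ₀ _ _).hom =
        (τ₀ _ _).hom ≫ (F'.map (L.map f.hom))⟦(1 : ℤ)⟧'
      rw [hτ₀, hτ₀, Category.assoc, Category.assoc, Category.assoc, ← Functor.map_comp]
      have h1 : (L.map f.hom)⟦(1 : ℤ)⟧' ≫ s.inv.app Y.obj = s.inv.app X.obj ≫ L.map (S.map f.hom) :=
        s.inv.naturality f.hom
      have h2 : (E' X.obj X.property).inv ≫ F'.map (L.map f.hom) =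
          F.map f.hom ≫ (E' Y.obj Y.property).inv := by
        rw [Iso.inv_comp_eq, ← Category.assoc, ← hE X.property Y.property, Category.assoc, Iso.hom_inv_id, Category.comp_id]
      have h3 : F.map (S.map f.hom) ≫ θ.app Y.obj = θ.app X.obj ≫ (F.map f.hom)⟦(1 : ℤ)⟧' :=
        θ.naturality f.hom
      rw [h2, ← F'.map_comp_assoc, h1, F'.map_comp_assoc,
        reassoc_of% (hE (hS _ X.property) (hS _ Y.property) (S.map f.hom)), reassoc_of% h3,
        Functor.map_comp])
  obtain ⟨e, he⟩ := exists_natIso_of_deformation (L := L) hε P hP τ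
  obtain ⟨hF', rfl⟩ := exists_commShift e
  refine ⟨hF', ⟨fun A hA => ?_⟩⟩
  -- The first map of a distinguished triangle determines the triangle up to isomorphism, and this
  -- map is the image of a map in `P`; so only cone triangles need be considered.
  obtain ⟨K, K', hK, hK', g, e₁, e₂, comm⟩ := harrow A.mor₁
  obtain ⟨M, hM, i, o, h1, h2⟩ := hcone g hK hK'
  refine isomorphic_distinguished _ h2 _
    (F'.mapTriangle.mapIso (isoTriangleOfIso₁₂ _ _ hA h1 e₁ e₂ comm) ≪≫
      Triangle.isoMk _ _ (E' K hK) (E' K' hK') (E' M hM) (hE hK hK' g) (hE hK' hM i) ?_)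
  have h3 : (F'.commShiftIso (1 : ℤ)).hom.app (L.obj K) = (τ₀ K hK).hom := he K hK
  change (F'.map (L.map o ≫ s.hom.app K) ≫ (F'.commShiftIso (1 : ℤ)).hom.app (L.obj K)) ≫
    ((E' K hK).hom)⟦(1 : ℤ)⟧' = (E' M hM).hom ≫ F.map o ≫ θ.app K
  have h4 : ((E' K hK).inv)⟦(1 : ℤ)⟧' ≫ ((E' K hK).hom)⟦(1 : ℤ)⟧' = 𝟙 _ := by
    rw [← Functor.map_comp, Iso.inv_hom_id, CategoryTheory.Functor.map_id]
  have h5 : F'.map (L.map o ≫ s.hom.app K) ≫ F'.map (s.inv.app K) = F'.map (L.map o) := by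
    rw [← F'.map_comp, Category.assoc, Iso.hom_inv_id_app]
    exact congrArg F'.map (Category.comp_id _)
  rw [h3, hτ₀, Category.assoc, Category.assoc, Category.assoc, Category.assoc, h4, reassoc_of% h5,
    reassoc_of% (hE hM (hS K hK) o)]
  exact congrArg (_ ≫ _ ≫ ·) (Category.comp_id _)

end TriangulatedDeformation

end SteenrodTate

namespace SteenrodTate

/-! ### Cones and shifts of bounded complexes. -/

section BoundedCones

open CochainComplex Pretriangulated DerivedCategory

variable {C : Type*} [Category* C] [Abelian C]

lemma boundedComplex_shift {K : CochainComplex C ℤ} (hK : boundedComplex C K) :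
    boundedComplex C (K⟦(1 : ℤ)⟧) := by
  obtain ⟨a, b, _, _⟩ := hK
  exact ⟨a - 1, b - 1, K.isStrictlyGE_shift a 1 _ (by lia), K.isStrictlyLE_shift b 1 _ (by lia)⟩

/-- The shift of bounded complexes. -/
noncomputable def boundedShift (C : Type*) [Category* C] [Abelian C] :
    (boundedComplex C).FullSubcategory ⥤ (boundedComplex C).FullSubcategory :=
  (boundedComplex C).lift ((boundedComplex C).ι ⋙ CategoryTheory.shiftFunctor _ (1 : ℤ))
    fun K => boundedComplex_shift K.property

variable {K L K' L' : (boundedComplex C).FullSubcategory}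

/-- The mapping cone of a morphism of bounded complexes. -/
noncomputable abbrev boundedCone (f : K ⟶ L) : (boundedComplex C).FullSubcategory :=
  bdd (mappingCone f.hom) (boundedComplex_mappingCone f.hom K.property L.property)

/-- The inclusion into the mapping cone. -/
noncomputable abbrev boundedConeInr (f : K ⟶ L) : L ⟶ boundedCone f :=
  ObjectProperty.homMk (mappingCone.inr f.hom)

/-- The map from the mapping cone to the shift. -/
noncomputable abbrev boundedConeOut (f : K ⟶ L) : boundedCone f ⟶ (boundedShift C).obj K :=
  ObjectProperty.homMk (mappingCone.triangle f.hom).mor₃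

/-- The short complex `0 ⟶ L ⟶ cone f ⟶ K[1] ⟶ 0`. -/
noncomputable abbrev coneShortComplex {K L : CochainComplex C ℤ} (f : K ⟶ L) :
    ShortComplex (CochainComplex C ℤ) :=
  ShortComplex.mk (mappingCone.inr f) (mappingCone.triangle f).mor₃ (mappingCone.inr_triangleδ f)

/-- The sequence `0 ⟶ L ⟶ cone f ⟶ K[1] ⟶ 0` is split in each degree. -/
noncomputable def coneSplitting {K L : CochainComplex C ℤ} (f : K ⟶ L) :
    DegreewiseSplitting (coneShortComplex f) where
  r a := ((mappingCone.triangleRotateShortComplexSplitting f) a).r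
  s a := ((mappingCone.triangleRotateShortComplexSplitting f) a).s
  f_r a := ((mappingCone.triangleRotateShortComplexSplitting f) a).f_r
  s_g a := ((mappingCone.triangleRotateShortComplexSplitting f) a).s_g
  id a := ((mappingCone.triangleRotateShortComplexSplitting f) a).id

/-- The map between the sequences `0 ⟶ L ⟶ cone f ⟶ K[1] ⟶ 0` given by a commutative square. -/
noncomputable abbrev coneShortComplexMap {K₁ L₁ K₂ L₂ : CochainComplex C ℤ} {f₁ : K₁ ⟶ L₁}
    {f₂ : K₂ ⟶ L₂} (a : K₁ ⟶ K₂) (b : L₁ ⟶ L₂) (comm : f₁ ≫ b = a ≫ f₂) :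
    coneShortComplex f₁ ⟶ coneShortComplex f₂ where
  τ₁ := b
  τ₂ := mappingCone.map f₁ f₂ a b comm
  τ₃ := a⟦(1 : ℤ)⟧'
  comm₁₂ := (mappingCone.triangleMap f₁ f₂ a b comm).comm₂.symm
  comm₂₃ := (mappingCone.triangleMap f₁ f₂ a b comm).comm₃.symm

variable [HasDerivedCategory C]

/-- The functor from bounded complexes to the bounded derived category commutes with the shift. -/
noncomputable def boundedQShift (C : Type*) [Category* C] [Abelian C] [HasDerivedCategory C] :
    boundedShift C ⋙ boundedQ C ≅ boundedQ C ⋙ CategoryTheory.shiftFunctor _ (1 : ℤ) :=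
  ((Functor.FullyFaithful.ofFullyFaithful (Bounded.ι (C := C))).whiskeringRight _).preimageIso
    (Functor.isoWhiskerLeft (boundedComplex C).ι (Q.commShiftIso (1 : ℤ)) ≪≫
      Functor.isoWhiskerLeft (boundedQ C) (Bounded.ι.commShiftIso (1 : ℤ)).symm)

lemma ι_map_boundedQShift_hom_app (K : (boundedComplex C).FullSubcategory) :
    (Bounded.ι (C := C)).map ((boundedQShift C).hom.app K) ≫
      ((Bounded.ι (C := C)).commShiftIso (1 : ℤ)).hom.app ((boundedQ C).obj K) =
    (Q.commShiftIso (1 : ℤ)).hom.app K.obj := by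
  have e : (Bounded.ι (C := C)).map ((boundedQShift C).hom.app K) =
      (Q.commShiftIso (1 : ℤ)).hom.app K.obj ≫
        ((Bounded.ι (C := C)).commShiftIso (1 : ℤ)).inv.app ((boundedQ C).obj K) :=
    congr_app (((Functor.FullyFaithful.ofFullyFaithful
      (Bounded.ι (C := C))).whiskeringRight _).map_preimage _) K
  rw [e]
  exact (Category.assoc _ _ _).trans ((congrArg ((Q.commShiftIso (1 : ℤ)).hom.app K.obj ≫ ·)
    (Iso.inv_hom_id_app ((Bounded.ι (C := C)).commShiftIso (1 : ℤ)) ((boundedQ C).obj K))).trans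
    (Category.comp_id _))

lemma boundedCone_distinguished (f : K ⟶ L) :
    Triangle.mk ((boundedQ C).map f) ((boundedQ C).map (boundedConeInr f))
      ((boundedQ C).map (boundedConeOut f) ≫ (boundedQShift C).hom.app K) ∈
        distTriang (Bounded C) := by
  rw [← (Bounded.ι (C := C)).map_distinguished_iff]
  refine isomorphic_distinguished _ (mappingCone_triangle_distinguished f.hom) _
    (Triangle.isoMk _ _ (Iso.refl _) (Iso.refl _) (Iso.refl _) ?_ ?_ ?_)
  · exact (Category.comp_id _).trans (Category.id_comp _).symm
  · exact (Category.comp_id _).trans (Category.id_comp _).symm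
  · refine ((congrArg (_ ≫ ·) (CategoryTheory.Functor.map_id _ _)).trans
      (Category.comp_id _)).trans (Eq.trans ?_ (Category.id_comp _).symm)
    refine (congrArg (· ≫ _) ((Bounded.ι (C := C)).map_comp _ _)).trans ?_
    exact (Category.assoc _ _ _).trans (congrArg (Q.map (mappingCone.triangle f.hom).mor₃ ≫ ·)
      (ι_map_boundedQShift_hom_app K))

/-- A morphism is a fraction `s⁻¹ g` with `s` a quasi-isomorphism, hence isomorphic to the image of
`g`; by naturality of `ε`, also to that of `r.map g`. -/
lemma boundedQ_arrow {r : (boundedComplex C).FullSubcategory ⥤ (boundedComplex C).FullSubcategory}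
    {ε : r ⟶ 𝟭 _} (hε : ∀ K, boundedQuasiIso C (ε.app K)) {A B : Bounded C} (f : A ⟶ B) :
    ∃ (K K' : (boundedComplex C).FullSubcategory) (g : K ⟶ K') (e₁ : A ≅ (boundedQ C).obj (r.obj K))
      (e₂ : B ≅ (boundedQ C).obj (r.obj K')), f ≫ e₂.hom = e₁.hom ≫ (boundedQ C).map (r.map g) := by
  have hε' (K) : IsIso ((boundedQ C).map (ε.app K)) := boundedQuasiIso_inverted _ (hε K)
  let q (K) : (boundedQ C).obj (r.obj K) ≅ (boundedQ C).obj K := asIso ((boundedQ C).map (ε.app K))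
  obtain ⟨K₀, ⟨eA⟩⟩ : ∃ K, Nonempty ((boundedQ C).obj K ≅ A) := Functor.EssSurj.mem_essImage (boundedQ C) A
  obtain ⟨L₀, ⟨eB⟩⟩ : ∃ L, Nonempty ((boundedQ C).obj L ≅ B) := Functor.EssSurj.mem_essImage (boundedQ C) B
  obtain ⟨K', s, hs, g, h⟩ := boundedQ_right_fac (eA.hom ≫ f ≫ eB.inv)
  have hs' : IsIso ((boundedQ C).map s) := boundedQuasiIso_inverted _ hs
  have e : (boundedQ C).map (r.map g) ≫ (q L₀).hom = (q K').hom ≫ (boundedQ C).map g := by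
    refine ((boundedQ C).map_comp _ _).symm.trans (Eq.trans ?_ ((boundedQ C).map_comp _ _))
    exact congrArg _ (ε.naturality g)
  refine ⟨K', L₀, g, eA.symm ≪≫ (asIso ((boundedQ C).map s)).symm ≪≫ (q K').symm,
    eB.symm ≪≫ (q L₀).symm, ?_⟩
  rw [← cancel_mono (q L₀).hom]
  simp only [Iso.trans_hom, Iso.symm_hom, asIso_inv, Category.assoc, Iso.inv_hom_id,
    Category.comp_id, e, Iso.inv_hom_id_assoc, ← h, IsIso.inv_hom_id_assoc]

end BoundedCones

end SteenrodTate

namespace SteenrodTate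

/-! ### Undoing a rotation of a triangle. -/

section RotateTriangle

open Pretriangulated

variable {T : Type*} [Category* T] [HasZeroObject T] [HasShift T ℤ] [Preadditive T]
  [∀ n : ℤ, (shiftFunctor T n).Additive] [Pretriangulated T]

/-- The last map of a rotated triangle is `-f[1]`, so `S` must be identified with `A[1]` by `-t` and
not by `t`. -/
lemma distinguished_of_rotate_of_iso {A B M S : T} {f : A ⟶ B} {u : B ⟶ M} {v : M ⟶ S}
    {t : S ⟶ A⟦(1 : ℤ)⟧} (ht : IsIso t) (h : Triangle.mk u v (t ≫ f⟦(1 : ℤ)⟧') ∈ distTriang T) :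
    Triangle.mk f u (v ≫ (-t)) ∈ distTriang T := by
  rw [rotate_distinguished_triangle]
  let e : S ≅ A⟦(1 : ℤ)⟧ := ⟨-t, -inv t, by simp, by simp⟩
  refine isomorphic_distinguished _ h _ (Triangle.isoMk (Triangle.mk u v (t ≫ f⟦(1 : ℤ)⟧'))
    (Triangle.mk f u (v ≫ (-t))).rotate (Iso.refl _) (Iso.refl _) e ?_ ?_ ?_).symm
  · exact (Category.comp_id _).trans (Category.id_comp _).symm
  · exact (Category.id_comp _).symm
  · change (t ≫ f⟦(1 : ℤ)⟧') ≫ (𝟙 B)⟦(1 : ℤ)⟧' = (-t) ≫ (-f⟦(1 : ℤ)⟧')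
    rw [CategoryTheory.Functor.map_id, Category.comp_id, Preadditive.neg_comp_neg]

end RotateTriangle

/-! ### From natural triangles to a triangulated functor. -/

section SplitTriangles

open CochainComplex Pretriangulated DerivedCategory

variable {C T : Type*} [Category* C] [Abelian C] [Category* T] [HasZeroObject T] [HasShift T ℤ]
  [Preadditive T] [∀ n : ℤ, (CategoryTheory.shiftFunctor T n).Additive] [Pretriangulated T]
  {F : (boundedComplex C).FullSubcategory ⥤ T}

/-- Since `F` need not be additive, contractibility of the cone does not by itself make its image
vanish. A termwise zero complex does have a computable image, and the cone is quasi-isomorphic to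
one. -/
lemma exists_boundedQuasiIso_of_cone_id (K : (boundedComplex C).FullSubcategory) :
    ∃ (Z : (boundedComplex C).FullSubcategory) (f : boundedCone (𝟙 K) ⟶ Z),
      (∀ n, IsZero (Z.obj.X n)) ∧ boundedQuasiIso C f := by
  obtain ⟨Z₀, hZ₀⟩ : ∃ Z : CochainComplex C ℤ, IsZero Z := HasZeroObject.zero
  have hZ (n : ℤ) : IsZero (Z₀.X n) := (HomologicalComplex.eval _ _ n).map_isZero hZ₀
  refine ⟨bdd Z₀ ⟨0, 0, ?_, ?_⟩, ObjectProperty.homMk 0, hZ, ?_⟩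
  · rw [CochainComplex.isStrictlyGE_iff]
    exact fun i _ => hZ i
  · rw [CochainComplex.isStrictlyLE_iff]
    exact fun i _ => hZ i
  · change QuasiIso (0 : mappingCone (𝟙 K.obj) ⟶ Z₀)
    rw [quasiIso_iff]
    intro n
    rw [quasiIsoAt_iff_exactAt]
    · exact ShortComplex.exact_of_isZero_X₂ _ (hZ n)
    · exact acyclic_mappingCone_id K.obj n

namespace SplitTriangles

variable (H : SplitTriangles F) {K L K' L' : (boundedComplex C).FullSubcategory}

/-- The connecting morphism of the cone sequence of a map of bounded complexes. -/
noncomputable def coneδ (f : K ⟶ L) : F.obj ((boundedShift C).obj K) ⟶ (F.obj L)⟦(1 : ℤ)⟧ :=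
  H.δ (coneSplitting f.hom) L.property (boundedCone f).property ((boundedShift C).obj K).property

lemma coneδ_distinguished (f : K ⟶ L) :
    Triangle.mk (F.map (boundedConeInr f)) (F.map (boundedConeOut f)) (H.coneδ f) ∈ distTriang T :=
  H.distinguished (coneSplitting f.hom) L.property (boundedCone f).property
    ((boundedShift _).obj K).property

lemma coneδ_naturality (f : K ⟶ L) (f' : K' ⟶ L') (a : K ⟶ K') (b : L ⟶ L')
    (comm : f ≫ b = a ≫ f') :
    H.coneδ f ≫ (F.map b)⟦(1 : ℤ)⟧' = F.map ((boundedShift C).map a) ≫ H.coneδ f' :=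
  H.naturality (coneSplitting f.hom) L.property (boundedCone f).property
    ((boundedShift _).obj K).property (coneSplitting f'.hom)
    (coneShortComplexMap a.hom b.hom (congrArg (·.hom) comm)) L'.property (boundedCone f').property
    ((boundedShift _).obj K').property

/-- The natural map `F (K[1]) ⟶ (F K)[1]`. -/
noncomputable def shiftMap : boundedShift C ⋙ F ⟶ F ⋙ CategoryTheory.shiftFunctor T (1 : ℤ) where
  -- The sign compensates the one that arises when the cone sequence is rotated back to a triangle
  -- starting with `f`.
  app K := -H.coneδ (𝟙 K)
  naturality K L f := by
    have := H.coneδ_naturality (𝟙 K) (𝟙 L) f f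
      ((Category.id_comp f).trans (Category.comp_id f).symm)
    exact (Preadditive.comp_neg _ _).trans ((congrArg (-·) this.symm).trans
      (Preadditive.neg_comp _ _).symm)

lemma isIso_coneδ_id (hK : IsZero (F.obj (boundedCone (𝟙 K)))) : IsIso (H.coneδ (𝟙 K)) :=
  (Triangle.isZero₂_iff_isIso₃ _ (H.coneδ_distinguished (𝟙 K))).1 hK

lemma isIso_shiftMap_app (hK : IsZero (F.obj (boundedCone (𝟙 K)))) : IsIso (H.shiftMap.app K) := by
  have := H.isIso_coneδ_id hK
  exact ⟨-inv (H.coneδ (𝟙 K)), (Preadditive.neg_comp_neg _ _).trans (IsIso.hom_inv_id _),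
    (Preadditive.neg_comp_neg _ _).trans (IsIso.inv_hom_id _)⟩

/-- The square with sides `id_K` and `f` maps the cone sequence of `id_K` to that of `f`. Naturality
then expresses the connecting map of `f` as that of `id_K`, which is invertible, followed by the
shift of `F.map f`. -/
lemma shiftMap_distinguished (f : K ⟶ L) (hK : IsZero (F.obj (boundedCone (𝟙 K)))) :
    Triangle.mk (F.map f) (F.map (boundedConeInr f))
      (F.map (boundedConeOut f) ≫ H.shiftMap.app K) ∈ distTriang T := by
  have h := H.coneδ_naturality (𝟙 K) f (𝟙 K) f rfl
  rw [CategoryTheory.Functor.map_id, CategoryTheory.Functor.map_id] at h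
  have h' : H.coneδ f = H.coneδ (𝟙 K) ≫ (F.map f)⟦(1 : ℤ)⟧' := (h.trans (Category.id_comp _)).symm
  exact distinguished_of_rotate_of_iso (H.isIso_coneδ_id hK) (h' ▸ H.coneδ_distinguished f)

/-- A functor on the bounded derived category that is given, on a class of bounded complexes, by a
functor with a natural extension of split exact sequences to triangles is triangulated. -/
lemma exists_isTriangulated [HasDerivedCategory C]
    {r : (boundedComplex C).FullSubcategory ⥤ (boundedComplex C).FullSubcategory} {ε : r ⟶ 𝟭 _}
    (H : SplitTriangles F) (hε : ∀ K, boundedQuasiIso C (ε.app K))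
    (P : ObjectProperty (boundedComplex C).FullSubcategory) (hP : ∀ K, P (r.obj K))
    (hshift : ∀ K, P K → P ((boundedShift C).obj K))
    (hcone : ∀ {K L} (f : K ⟶ L), P K → P L → P (boundedCone f))
    (hid : ∀ K, P K → IsZero (F.obj (boundedCone (𝟙 K)))) (F' : Bounded C ⥤ T)
    (E : P.ι ⋙ boundedQ C ⋙ F' ≅ P.ι ⋙ F) : ∃ _ : F'.CommShift ℤ, F'.IsTriangulated := by
  refine exists_isTriangulated_of_deformation (boundedQ C) (boundedQuasiIso C) hε P hP
    (boundedShift C) hshift (boundedQShift C) F H.shiftMap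
    (fun K hK => H.isIso_shiftMap_app (hid K hK)) F' E (fun {K K'} f hK hK' => ?_)
    (fun {A B} f => ?_)
  · exact ⟨boundedCone f, hcone f hK hK', boundedConeInr f, boundedConeOut f,
      boundedCone_distinguished f, H.shiftMap_distinguished f (hid K hK)⟩
  · obtain ⟨K, K', g, e₁, e₂, h⟩ := boundedQ_arrow hε f
    exact ⟨r.obj K, r.obj K', hP K, hP K', r.map g, e₁, e₂, h⟩

end SplitTriangles

end SplitTriangles

/-! ### Flat complexes, and the image of the cone of an identity. -/

section SteenrodTriangles

variable {R : Type u} [CommRing R] {X : TopCat.{u}} {p : ℕ} [Fact p.Prime]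

/-- The bounded complexes with flat stalks. -/
def FlatComplex (R : Type u) [CommRing R] (X : TopCat.{u}) :
    ObjectProperty (boundedComplex (Sh R X)).FullSubcategory := fun K => HasFlatStalks K.obj

variable {K K' : (boundedComplex (Sh R X)).FullSubcategory}

lemma flatComplex_shift (h : FlatComplex R X K) : FlatComplex R X ((boundedShift _).obj K) :=
  fun x n => h x (n + 1)

lemma flatComplex_cone (f : K ⟶ K') (hK : FlatComplex R X K) (hK' : FlatComplex R X K') :
    FlatComplex R X (boundedCone f) :=
  (hasFlatStalks_iff _).2 fun n => (FlatSheaf R X).prop_of_iso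
    (HomologicalComplex.homotopyCofiber.XIsoBiprod f.hom n (n + 1) rfl).symm
    (flatSheaf_biprod _ _ ((hasFlatStalks_iff _).1 hK (n + 1)) ((hasFlatStalks_iff _).1 hK' n))

lemma isIso_steenrodCD_map (f : K ⟶ K') (hf : boundedQuasiIso _ f) (hK : FlatComplex R X K)
    (hK' : FlatComplex R X K') : IsIso ((steenrodCD R X p).map f) := by
  obtain ⟨a, b, _, _, _, _⟩ := exists_bounds K.obj K'.obj K.property K'.property
  have : QuasiIso f.hom := hf
  exact (isIso_boundedQ_map_iff _).2 (quasiIso_steenrodC_map f.hom hK hK' a)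

variable {T : Type*} [Category* T] [HasZeroObject T] [HasShift T ℤ] [Preadditive T]
  [∀ n : ℤ, (shiftFunctor T n).Additive] [Pretriangulated T]
  {L : EqDb R (Mu p) (MuPower p X) ⥤ T}

lemma VanishesOnRelProj.isZero_of_isZero (hL : VanishesOnRelProj L) (h : ∀ n, IsZero (K.obj.X n)) :
    IsZero (L.obj ((steenrodCD R X p).obj K)) :=
  hL _ ((steenrodCb R X p).obj K).property fun n =>
    relProj_of_isZero (isZero_steenrodC_X K.obj n fun i _ => ⟨0, h (i 0)⟩)

/-- Both the cone and the termwise zero complex to which it is quasi-isomorphic have flat stalks, so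
Steenrod's construction identifies their images, and a termwise zero complex has a termwise zero
tensor power. -/
lemma VanishesOnRelProj.isZero_cone_id (hL : VanishesOnRelProj L) (hK : FlatComplex R X K) :
    IsZero (L.obj ((steenrodCD R X p).obj (boundedCone (𝟙 K)))) := by
  obtain ⟨Z, f, hZ, hf⟩ := exists_boundedQuasiIso_of_cone_id K
  have hZ' : FlatComplex R X Z := fun x n => by
    have := ModuleCat.isZero_iff_subsingleton.1
      (((pt x).sheafFiber (A := ModuleCat.{u} R)).map_isZero (hZ n))
    exact inferInstanceAs (Module.Flat R (((pt x).sheafFiber (A := ModuleCat.{u} R)).obj (Z.obj.X n)))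
  have := isIso_steenrodCD_map (p := p) f hf (flatComplex_cone _ hK hK) hZ'
  exact (hL.isZero_of_isZero hZ).of_iso (L.mapIso (asIso ((steenrodCD R X p).map f)))

end SteenrodTriangles

end SteenrodTate

namespace SteenrodTate

/-! ### Scalars act through their `p`-th powers. -/

section Scalars

/-- Linearity passes to a left adjoint, here sheafification, by naturality of the unit. -/
lemma map_smul_of_adjunction {R : Type*} [Semiring R] {C D : Type*} [Category* C] [Category* D]
    [Preadditive C] [Preadditive D] [Linear R C] [Linear R D] {F : C ⥤ D} {G : D ⥤ C} (adj : F ⊣ G)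
    [G.Additive] [G.Linear R] {X Y : C} (r : R) (f : X ⟶ Y) : F.map (r • f) = r • F.map f := by
  apply (adj.homEquiv _ _).injective
  rw [adj.homEquiv_unit, adj.homEquiv_unit, G.map_smul, Linear.comp_smul]
  exact (adj.unit.naturality (r • f)).symm.trans ((Linear.smul_comp _ _ _ r f _).trans
    (congrArg (r • ·) (adj.unit.naturality f)))

variable {R : Type u} [CommRing R]

lemma tensorGraded_smul {ι : Type} [Fintype ι] [LinearOrder ι]
    {K K' : ι → CochainComplex (ModuleCat.{u} R) ℤ} (r : R)
    (φ : ∀ l a, (K l).X a →ₗ[R] (K' l).X a) (n : ℤ) :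
    tensorGraded (fun l a => r • φ l a) n = r ^ Fintype.card ι • tensorGraded φ n := by
  refine tensorX_hom_ext fun i hi x => ?_
  rw [LinearMap.smul_apply, tensorGraded_incl, tensorGraded_incl, ← map_smul,
    PiTensorProduct.map_tprod, PiTensorProduct.map_tprod]
  refine congrArg (incl K' i hi) ?_
  have h := (PiTensorProduct.tprod R).map_smul_univ (fun _ : ι => r) fun l => φ l (i l) (x l)
  rw [Finset.prod_const, Finset.card_univ] at h
  exact h

variable {X : TopCat.{u}} {p : ℕ} [NeZero p]

lemma tensorPshGraded_smul {A B : CochainComplex (Sh R X) ℤ} (r : R) (ψ : ∀ a, A.X a ⟶ B.X a)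
    (n : ℤ) : tensorPshGraded p (fun a => r • ψ a) n = r ^ p • tensorPshGraded p ψ n := by
  ext U : 2
  refine ModuleCat.hom_ext ((tensorGraded_smul r (gradedSections ψ U.unop) n).trans ?_)
  rw [Fintype.card_fin]
  rfl

lemma steenrodC_map_smul {A B : CochainComplex (Sh R X) ℤ} (r : R) (f : A ⟶ B) :
    (steenrodC R X p).map (r • f) = r ^ p • (steenrodC R X p).map f := by
  ext n : 1
  have h1 : ((steenrodC R X p).map (r • f)).f n = (presheafToSheaf _ _).map
      (((tensorPshFunctor R X p).map (r • f)).f n) := rfl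
  have h2 : ((steenrodC R X p).map f).f n = (presheafToSheaf _ _).map
      (((tensorPshFunctor R X p).map f).f n) := rfl
  have h3 : ((tensorPshFunctor R X p).map (r • f)).f n =
      r ^ p • ((tensorPshFunctor R X p).map f).f n := by
    rw [tensorPshFunctor_map_f, tensorPshFunctor_map_f]
    exact tensorPshGraded_smul r _ n
  refine h1.trans ((congrArg _ h3).trans ?_)
  exact (map_smul_of_adjunction (sheafificationAdjunction _ _) _ _).trans
    (congrArg (r ^ p • ·) h2.symm)

lemma boundedQ_map_smul {C : Type*} [Category* C] [Abelian C] [Linear R C] [HasDerivedCategory C]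
    {K L : (boundedComplex C).FullSubcategory} (r : R) (f : K ⟶ L) :
    (boundedQ C).map (r • f) = r • (boundedQ C).map f := by
  ext
  exact DerivedCategory.Q.map_smul r f.hom

lemma steenrodCD_map_smul {K K' : (boundedComplex (Sh R X)).FullSubcategory} (r : R) (f : K ⟶ K') :
    (steenrodCD R X p).map (r • f) = r ^ p • (steenrodCD R X p).map f := by
  have h : (steenrodCb R X p).map (r • f) = r ^ p • (steenrodCb R X p).map f := by
    ext1
    exact steenrodC_map_smul r f.hom
  exact (congrArg (boundedQ _).map h).trans (boundedQ_map_smul _ _)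

end Scalars

/-! ### Existence, uniqueness and scalars for functors given by a deformation. -/

section Deformation

variable {C D E : Type*} [Category* C] [Category* D] [Category* E] {L : C ⥤ D}
  {W : MorphismProperty C} [L.IsLocalization W] {F : C ⥤ E} {r : C ⥤ C} {ε : r ⟶ 𝟭 C}

lemma isIso_map_deformation (hε : ∀ X, W (ε.app X)) {X Y : C} (f : X ⟶ Y) (hf : W f) :
    IsIso (L.map (r.map f)) := by
  have := Localization.inverts L W f hf
  have := Localization.inverts L W _ (hε X)
  have := Localization.inverts L W _ (hε Y)
  have h : L.map (r.map f) ≫ L.map (ε.app Y) = L.map (ε.app X) ≫ L.map f := by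
    rw [← L.map_comp, ← L.map_comp]
    exact congrArg _ (ε.naturality f)
  have : IsIso (L.map (r.map f) ≫ L.map (ε.app Y)) := by
    rw [h]
    infer_instance
  exact IsIso.of_isIso_comp_right _ (L.map (ε.app Y))

variable (L) in
lemma exists_isRightKanExtension_of_deformation (hε : ∀ X, W (ε.app X))
    (hF : ∀ X Y (f : X ⟶ Y), W f → IsIso (F.map (r.map f)))
    (hF' : ∀ X, IsIso (F.map (ε.app (r.obj X)))) : ∃ (RF : D ⥤ E) (α : L ⋙ RF ⟶ F),
      RF.IsRightKanExtension α ∧ ∀ X, IsIso (F.map (ε.app X)) → IsIso (α.app X) := by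
  let e := Localization.fac (r ⋙ F) (W := W) (fun X Y f hf => hF X Y f hf) L
  refine ⟨_, deformationCounit e ε, isRightKanExtension_deformationCounit e hε hF', fun X hX => ?_⟩
  exact IsIso.comp_isIso (f := e.hom.app X) (h := F.map (ε.app X))

/-- Kan extensions are unique up to an isomorphism compatible with the counits, so invertibility may
be tested on the one built from a deformation. -/
lemma isIso_counit_app_of_isRightKanExtension {G G' : D ⥤ E} (α : L ⋙ G ⟶ F)
    [G.IsRightKanExtension α] (α' : L ⋙ G' ⟶ F) [G'.IsRightKanExtension α'] (X : C)
    (hX : IsIso (α'.app X)) : IsIso (α.app X) := by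
  have h1 := G.liftOfIsRightKanExtension_fac_app α G' α' X
  have h2 : IsIso (G.liftOfIsRightKanExtension α G' α') := by
    rw [← G'.rightKanExtensionUnique_hom α' G α]
    infer_instance
  have h3 : IsIso ((G.liftOfIsRightKanExtension α G' α').app (L.obj X) ≫ α.app X) := by
    rwa [h1]
  exact IsIso.of_isIso_comp_left ((G.liftOfIsRightKanExtension α G' α').app (L.obj X)) _

/-- Every morphism of `D` is isomorphic to the image of one between objects of `P`, where `F'`
agrees with `F`. Only the pair `(c, d)` matters, so the argument covers `c ↦ c ^ p`. -/
lemma map_smul_of_deformation {R : Type*} [Ring R] [Preadditive C] [Preadditive D] [Preadditive E]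
    [Linear R C] [Linear R D] [Linear R E] {P : ObjectProperty C} {c d : R}
    (hL : ∀ {X Y : C} (f : X ⟶ Y), L.map (c • f) = c • L.map f)
    (hF : ∀ {X Y : C} (f : X ⟶ Y), F.map (c • f) = d • F.map f) {F' : D ⥤ E}
    (E : P.ι ⋙ L ⋙ F' ≅ P.ι ⋙ F)
    (harrow : ∀ {A B : D} (f : A ⟶ B), ∃ (K K' : C) (_ : P K) (_ : P K') (g : K ⟶ K')
      (e₁ : A ≅ L.obj K) (e₂ : B ≅ L.obj K'), f ≫ e₂.hom = e₁.hom ≫ L.map g)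
    {A B : D} (f : A ⟶ B) : F'.map (c • f) = d • F'.map f := by
  obtain ⟨K, K', hK, hK', g, e₁, e₂, h⟩ := harrow f
  let E₁ : F'.obj (L.obj K) ≅ F.obj K := E.app ⟨K, hK⟩
  let E₂ : F'.obj (L.obj K') ≅ F.obj K' := E.app ⟨K', hK'⟩
  have hE (g : K ⟶ K') : F'.map (L.map g) = E₁.hom ≫ F.map g ≫ E₂.inv := by
    rw [← Category.assoc, Iso.eq_comp_inv]
    exact E.hom.naturality (X := ⟨K, hK⟩) (Y := ⟨K', hK'⟩) (ObjectProperty.homMk g)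
  have h1 : f = e₁.hom ≫ L.map g ≫ e₂.inv := by
    rw [← Category.assoc, Iso.eq_comp_inv, h]
  have h2 : c • f = e₁.hom ≫ L.map (c • g) ≫ e₂.inv := by
    rw [h1, hL, Linear.smul_comp, Linear.comp_smul]
  rw [h2, h1]
  simp only [Functor.map_comp, hE, hF, Linear.smul_comp, Linear.comp_smul]

end Deformation

/-! ### The derived functor and its properties after localization. -/

section Derived

variable {R : Type u} [CommRing R] {X : TopCat.{u}} {p : ℕ} [Fact p.Prime]
  {r : (boundedComplex (Sh R X)).FullSubcategory ⥤ (boundedComplex (Sh R X)).FullSubcategory}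
  {ε : r ⟶ 𝟭 _} (hε : ∀ K, boundedQuasiIso _ (ε.app K)) (hr : ∀ K, FlatComplex R X (r.obj K))

include hε hr

lemma exists_steenrod_derived (p : ℕ) [Fact p.Prime] :
    ∃ (St : Db R X ⥤ EqDb R (Mu p) (MuPower p X)) (α : boundedQ (Sh R X) ⋙ St ⟶ steenrodCD R X p),
      St.IsRightKanExtension α ∧ ∀ K, FlatComplex R X K → IsIso (α.app K) := by
  obtain ⟨St, α, h, h'⟩ := exists_isRightKanExtension_of_deformation (boundedQ (Sh R X))
    (F := steenrodCD R X p) hε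
    (fun K L f hf => isIso_steenrodCD_map _
      ((isIso_boundedQ_map_iff _).1 (isIso_map_deformation hε f hf)) (hr K) (hr L))
    (fun K => isIso_steenrodCD_map _ (hε _) (hr _) (hr _))
  exact ⟨St, α, h, fun K hK => h' K (isIso_steenrodCD_map _ (hε K) (hr K) hK)⟩

lemma isIso_steenrod_counit {St : Db R X ⥤ EqDb R (Mu p) (MuPower p X)}
    (α : boundedQ (Sh R X) ⋙ St ⟶ steenrodCD R X p) [St.IsRightKanExtension α]
    (K : (boundedComplex (Sh R X)).FullSubcategory) (hK : FlatComplex R X K) : IsIso (α.app K) := by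
  obtain ⟨St', α', h, h'⟩ := exists_steenrod_derived hε hr p
  exact isIso_counit_app_of_isRightKanExtension α α' K (h' K hK)

lemma flatComplex_arrow {A B : Db R X} (f : A ⟶ B) :
    ∃ (K K' : (boundedComplex (Sh R X)).FullSubcategory) (_ : FlatComplex R X K)
      (_ : FlatComplex R X K') (g : K ⟶ K') (e₁ : A ≅ (boundedQ (Sh R X)).obj K)
      (e₂ : B ≅ (boundedQ (Sh R X)).obj K'), f ≫ e₂.hom = e₁.hom ≫ (boundedQ (Sh R X)).map g := by
  obtain ⟨K, K', g, e₁, e₂, h⟩ := boundedQ_arrow hε f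
  exact ⟨r.obj K, r.obj K', hr K, hr K', r.map g, e₁, e₂, h⟩

variable {St : Db R X ⥤ EqDb R (Mu p) (MuPower p X)}
  (α : boundedQ (Sh R X) ⋙ St ⟶ steenrodCD R X p) [St.IsRightKanExtension α]

include α

lemma exists_iso_steenrodCD_comp {T : Type*} [Category* T] (L : EqDb R (Mu p) (MuPower p X) ⥤ T) :
    Nonempty ((FlatComplex R X).ι ⋙ boundedQ (Sh R X) ⋙ (St ⋙ L) ≅
      (FlatComplex R X).ι ⋙ (steenrodCb R X p ⋙ boundedQ _ ⋙ L)) := by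
  refine ⟨NatIso.ofComponents (fun K =>
    have := isIso_steenrod_counit hε hr α K.obj K.property
    L.mapIso (asIso (α.app K.obj))) fun {K K'} f => ?_⟩
  change L.map (St.map ((boundedQ _).map f.hom)) ≫ L.map (α.app K'.obj) =
    L.map (α.app K.obj) ≫ L.map ((steenrodCD R X p).map f.hom)
  rw [← Functor.map_comp, ← Functor.map_comp]
  exact congrArg _ (α.naturality f.hom)

variable {T : Type*} [Category* T] [HasZeroObject T] [HasShift T ℤ] [Preadditive T]
  [∀ n : ℤ, (shiftFunctor T n).Additive] [Pretriangulated T]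
  {L : EqDb R (Mu p) (MuPower p X) ⥤ T} [L.CommShift ℤ] [L.IsTriangulated]
  (hL : VanishesOnRelProj L)

include hL

/-- Complexes with flat stalks are closed under shifts and cones, and on them the derived functor is
given by Steenrod's construction, for which the natural triangles are available. -/
lemma exists_isTriangulated_steenrod : ∃ _ : (St ⋙ L).CommShift ℤ, (St ⋙ L).IsTriangulated := by
  obtain ⟨E⟩ := exists_iso_steenrodCD_comp hε hr α L
  exact hL.splitComparison.splitTriangles.exists_isTriangulated hε (FlatComplex R X) hr
    (fun _ => flatComplex_shift) flatComplex_cone (fun _ => hL.isZero_cone_id) _ E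

/-- Additivity is a consequence of exactness, as any triangulated functor is additive; the cross
terms of `(f + g)^{⊠p}` are never examined directly. -/
lemma additive_steenrod : (St ⋙ L).Additive := by
  obtain ⟨_, _⟩ := exists_isTriangulated_steenrod hε hr α hL
  infer_instance

omit [L.CommShift ℤ] [L.IsTriangulated] [HasZeroObject T] [HasShift T ℤ]
  [∀ n : ℤ, (shiftFunctor T n).Additive] [Pretriangulated T] hL in
lemma steenrod_map_smul [Linear R T] [L.Linear R] {A B : Db R X} (c : R) (f : A ⟶ B) :
    (St ⋙ L).map (c • f) = c ^ p • (St ⋙ L).map f := by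
  obtain ⟨E⟩ := exists_iso_steenrodCD_comp hε hr α L
  have hQ {K K' : (boundedComplex (Sh R X)).FullSubcategory} (f : K ⟶ K') :
      (boundedQ (Sh R X)).map (c • f) = c • (boundedQ (Sh R X)).map f := boundedQ_map_smul c f
  have hF {K K' : (boundedComplex (Sh R X)).FullSubcategory} (f : K ⟶ K') :
      (steenrodCb R X p ⋙ boundedQ _ ⋙ L).map (c • f) =
        c ^ p • (steenrodCb R X p ⋙ boundedQ _ ⋙ L).map f :=
    (congrArg L.map (steenrodCD_map_smul c f)).trans (L.map_smul _ _)
  exact map_smul_of_deformation (L := boundedQ (Sh R X)) (F := steenrodCb R X p ⋙ boundedQ _ ⋙ L)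
    (F' := St ⋙ L) (P := FlatComplex R X) (c := c) (d := c ^ p) hQ hF E
    (flatComplex_arrow hε hr) f

lemma isFrobeniusLinear_steenrod [Linear R T] [L.Linear R] : IsFrobeniusLinear p R (St ⋙ L) where
  map_add f g := by
    have := additive_steenrod hε hr α hL
    exact Functor.map_add _
  map_smul c f := steenrod_map_smul hε hr α c f

lemma preservesFiniteCoproducts_steenrod : PreservesFiniteCoproducts (St ⋙ L) := by
  have := additive_steenrod hε hr α hL
  have := Functor.preservesFiniteBiproductsOfAdditive (St ⋙ L)
  exact ⟨fun n => preservesCoproductsOfShape_of_preservesBiproductsOfShape _⟩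

end Derived

/-! ### Rings of finite weak dimension. -/

section FiniteWeakDimension

variable {R : Type u} [CommRing R] {X : TopCat.{u}} {p : ℕ} [Fact p.Prime]
  {T : Type*} [Category* T] [HasZeroObject T] [HasShift T ℤ] [Preadditive T]
  [∀ n : ℤ, (shiftFunctor T n).Additive] [Pretriangulated T] [Linear R T]
  {L : EqDb R (Mu p) (MuPower p X) ⥤ T} [L.CommShift ℤ] [L.IsTriangulated] [L.Linear R]

lemma steenrod_of_finiteWeakDimension (hL : VanishesOnRelProj L)
    (hR : HasFiniteWeakDimension R) : (boundedQ (Sh R X)).HasRightKanExtension (steenrodCD R X p) ∧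
      ∀ (St : Db R X ⥤ EqDb R (Mu p) (MuPower p X))
        (α : boundedQ (Sh R X) ⋙ St ⟶ steenrodCD R X p) [St.IsRightKanExtension α],
        (∃ _ : (St ⋙ L).CommShift ℤ, (St ⋙ L).IsTriangulated) ∧ IsFrobeniusLinear p R (St ⋙ L) ∧
          PreservesFiniteCoproducts (St ⋙ L) := by
  obtain ⟨r, ε, hε, hr⟩ := exists_flat_resolution R X hR
  obtain ⟨St, α, h, -⟩ := exists_steenrod_derived hε hr p
  exact ⟨Functor.HasRightKanExtension.mk St α, fun St α _ =>
    ⟨exists_isTriangulated_steenrod hε hr α hL, isFrobeniusLinear_steenrod hε hr α hL,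
      preservesFiniteCoproducts_steenrod hε hr α hL⟩⟩

end FiniteWeakDimension

/-! ### Functors on the Frobenius twist. -/

namespace FrobTwist

variable {p : ℕ} {k C D : Type*} [Category* C] [Category* D] [Preadditive C]
  [Preadditive D]

lemma additive_untwist_comp (F : C ⥤ D) [F.Additive] : (untwist p k C ⋙ F).Additive :=
  ⟨fun {X Y f g} => F.map_add (X := (untwist p k C).obj X) (Y := (untwist p k C).obj Y)
    (f := (untwist p k C).map f) (g := (untwist p k C).map g)⟩

/-- In the twist `c` acts as `c ^ (1/p)`, and the functor raises this to its `p`-th power, giving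
back `c`. -/
lemma linear_untwist_comp [Field k] [Fact p.Prime] [CharP k p] [PerfectRing k p] [Linear k C]
    [Linear k D] (F : C ⥤ D)
    (hF : ∀ {X Y : C} (c : k) (f : X ⟶ Y), F.map (c • f) = c ^ p • F.map f) :
    (untwist p k C ⋙ F).Linear k :=
  ⟨fun f c => (hF ((frobeniusEquiv k p).symm c) ((untwist p k C).map f)).trans
    (congrArg (· • F.map ((untwist p k C).map f)) (frobeniusEquiv_symm_pow_p k p c))⟩

lemma exists_isTriangulated_untwist_comp [HasZeroObject C] [HasZeroObject D] [HasShift C ℤ]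
    [HasShift D ℤ] [∀ n : ℤ, (shiftFunctor C n).Additive] [∀ n : ℤ, (shiftFunctor D n).Additive]
    [Pretriangulated C] [Pretriangulated D] (F : C ⥤ D)
    (hF : ∃ _ : F.CommShift ℤ, F.IsTriangulated) :
    ∃ _ : (untwist p k C ⋙ F).CommShift ℤ, (untwist p k C ⋙ F).IsTriangulated := hF

end FrobTwist

lemma flatComplex_of_field {k : Type u} [Field k] {X : TopCat.{u}}
    (K : (boundedComplex (Sh k X)).FullSubcategory) : FlatComplex k X K :=
  fun _ _ => inferInstance

lemma boundedQuasiIso_id {C : Type*} [Category* C] [Abelian C]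
    (K : (boundedComplex C).FullSubcategory) : boundedQuasiIso C (𝟙 K) :=
  inferInstanceAs (QuasiIso (𝟙 K.obj))

/-! ### Perfect fields. -/

section PerfectField

variable {k : Type u} [Field k] {X : TopCat.{u}} {p : ℕ} [Fact p.Prime] [CharP k p] [PerfectRing k p]
  {T : Type*} [Category* T] [HasZeroObject T] [HasShift T ℤ] [Preadditive T]
  [∀ n : ℤ, (shiftFunctor T n).Additive] [Pretriangulated T] [Linear k T]
  {L : EqDb k (Mu p) (MuPower p X) ⥤ T} [L.CommShift ℤ] [L.IsTriangulated] [L.Linear k]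

/-- All modules over a field are flat, so the identity serves as the deformation, and the counit is
invertible on every complex. -/
lemma steenrod_of_perfectField (hL : VanishesOnRelProj L) :
    (boundedQ (Sh k X)).HasRightKanExtension (steenrodCD k X p) ∧
      ∀ (St : Db k X ⥤ EqDb k (Mu p) (MuPower p X))
        (α : boundedQ (Sh k X) ⋙ St ⟶ steenrodCD k X p) [St.IsRightKanExtension α],
        IsIso α ∧ (FrobTwist.untwist p k (Db k X) ⋙ St ⋙ L).Additive ∧
        (FrobTwist.untwist p k (Db k X) ⋙ St ⋙ L).Linear k ∧
        ∃ _ : (FrobTwist.untwist p k (Db k X) ⋙ St ⋙ L).CommShift ℤ,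
          (FrobTwist.untwist p k (Db k X) ⋙ St ⋙ L).IsTriangulated := by
  have hε (K : (boundedComplex (Sh k X)).FullSubcategory) :
      boundedQuasiIso _ ((𝟙 (𝟭 (boundedComplex (Sh k X)).FullSubcategory) :).app K) :=
    boundedQuasiIso_id K
  have hr (K : (boundedComplex (Sh k X)).FullSubcategory) :
      FlatComplex k X ((𝟭 (boundedComplex (Sh k X)).FullSubcategory).obj K) :=
    flatComplex_of_field K
  obtain ⟨St, α, h, -⟩ := exists_steenrod_derived hε hr p
  refine ⟨Functor.HasRightKanExtension.mk St α, fun St α _ => ?_⟩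
  have hα (K) : IsIso (α.app K) := isIso_steenrod_counit hε hr α K (hr K)
  have := additive_steenrod hε hr α hL
  exact ⟨NatIso.isIso_of_isIso_app α, FrobTwist.additive_untwist_comp _,
    FrobTwist.linear_untwist_comp _ fun c f => steenrod_map_smul hε hr α c f,
    FrobTwist.exists_isTriangulated_untwist_comp _ (exists_isTriangulated_steenrod hε hr α hL)⟩

end PerfectField

end SteenrodTate

theorem mainTheorem3 (p : ℕ) [Fact p.Prime] (hp : p ≠ 2) (X : TopCat.{u}) :
    (∀ (R : Type u) [CommRing R], HasFiniteWeakDimension R →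
      (boundedQ (Sh R X)).HasRightKanExtension (steenrodCD R X p) ∧
      ∀ (St : Db R X ⥤ EqDb R (Mu p) (MuPower p X))
        (α : boundedQ (Sh R X) ⋙ St ⟶ steenrodCD R X p) [St.IsRightKanExtension α],
        (∃ _ : (St ⋙ toTateDb R p (MuPower p X)).CommShift ℤ,
          (St ⋙ toTateDb R p (MuPower p X)).IsTriangulated) ∧
        IsFrobeniusLinear p R (St ⋙ toTateDb R p (MuPower p X)) ∧
        (∀ (K L : TateDb R p (MuPower p X)) (f : K ⟶ L), (p : R) • f = 0) ∧
        PreservesFiniteCoproducts (St ⋙ toTateDb R p (MuPower p X))) ∧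
    (∀ (k : Type u) [Field k] [CharP k p] [PerfectRing k p],
      (boundedQ (Sh k X)).HasRightKanExtension (steenrodCD k X p) ∧
      ∀ (St : Db k X ⥤ EqDb k (Mu p) (MuPower p X))
        (α : boundedQ (Sh k X) ⋙ St ⟶ steenrodCD k X p) [St.IsRightKanExtension α],
        IsIso α ∧
        (FrobTwist.untwist p k (Db k X) ⋙ St ⋙ toTateDb k p (MuPower p X)).Additive ∧
        (FrobTwist.untwist p k (Db k X) ⋙ St ⋙ toTateDb k p (MuPower p X)).Linear k ∧
        ∃ _ : (FrobTwist.untwist p k (Db k X) ⋙ St ⋙ toTateDb k p (MuPower p X)).CommShift ℤ,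
          (FrobTwist.untwist p k (Db k X) ⋙ St ⋙
            toTateDb k p (MuPower p X)).IsTriangulated) := by
  refine ⟨fun R _ hR => ?_, fun k _ _ _ => ?_⟩
  -- The only property of the localization functor required here, beyond being triangulated and
  -- linear, is that it kills the bounded complexes of relatively projective sheaves.
  · have h := steenrod_of_finiteWeakDimension (L := toTateDb R p (MuPower p X))
      isZero_tateQ_of_relProj hR
    refine ⟨h.1, fun St α _ => ?_⟩
    obtain ⟨h₁, h₂, h₃⟩ := h.2 St α
    exact ⟨h₁, h₂, fun K L f => smul_eq_zero_of_tateDb f, h₃⟩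
  · exact steenrod_of_perfectField (L := toTateDb k p (MuPower p X)) isZero_tateQ_of_relProj
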